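/- Let $n,d\ge 1$ and let $v$ be an indeterminate. **Weyl group.** Let $\widetilde W$ be the group of permutations $g$ of $\mathbb Z$ with $g(i+d)=g(i)+d$ for all $i$; let $\pi\in\widetilde W$ be $t\mapsto t+1$, and (for $d\ge2$; for $d=1$ there are none) let $s_i=\prod_{k\in\mathbb Z}(kd+i,\,kd+i+1)$, $1\le i\le d$. Every $g\in\widetilde W$ is uniquely $g=\pi^z w$ with $z\in\mathbb Z$ and $w\in W=\langle s_1,\dots,s_d\rangle$; let $\ell(g)$ be the length of $w$ with respect to $s_1,\dots,s_d$. For a weak composition $\lambda=(\lambda_1,\dots,\lambda_n)$ of $d$ let $W_\lambda$ be the (finite) subgroup generated by the $s_i$ with $1\le i\le d$ and $i\notin\{\lambda_1,\lambda_1+\lambda_2,\dots,\lambda_1+\dots+\lambda_n=d\}$; let $R^\lambda_i=\{t\in\mathbb Z:\lambda_1+\dots+\lambda_{i-1}<t\le\lambda_1+\dots+\lambda_i\}$ for $1\le i\le n$ and $R^\lambda_{i+n}=R^\lambda_i+d$. Let $\mathcal D_{\lambda\mu}$ be the set of those $g\in\widetilde W$ with $\ell(xg)=\ell(x)+\ell(g)$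 for all $x\in W_\lambda$ and $\ell(gy)=\ell(g)+\ell(y)$ for all $y\in W_\mu$. **Schur algebra.** Let $\mathcal H$ be the extended affine Hecke algebra over $\mathbb Z[v,v^{-1}]$, with basis $T_g$ $(g\in\widetilde W)$ and relations $T_wT_{w'}=T_{ww'}$ if $\ell(ww')=\ell(w)+\ell(w')$ and $(T_{s_i}+1)(T_{s_i}-v^2)=0$. Put $x_\lambda=\sum_{w\in W_\lambda}T_w$. The affine $q$-Schur algebra is $\mathrm{End}_{\mathcal H}\big(\bigoplus_\lambda x_\lambda\mathcal H\big)$ (right $\mathcal H$-modules, $\lambda$ running over the weak compositions of $d$ into $n$ parts), with composition $*$ as product. **Standard basis and order.** Let $\Theta_d$ be the set of $\mathbb Z\times\mathbb Z$ matrices $A=(a_{ij})$ over $\mathbb N$ with $a_{ij}=a_{i+n,j+n}$ and $\sum_{i=1}^n\sum_{j\in\mathbb Z}a_{ij}=d$, and let $\mathrm{ro}$, $\mathrm{co}$ denote row and column sum vectors. Each $A\in\Theta_d$ corresponds to a unique triple $(\lambda,g,\mu)$ with $g\in\mathcal D_{\lambda\mu}$ and $a_{ij}=|R^\lambda_i\cap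 gR^\mu_j|$ for all $i,j$; let $e_A$ be the right $\mathcal H$-linear map that sends $x_\mu$ to $\sum_{w\in W_\lambda gW_\mu}T_w\in x_\lambda\mathcal H$ and is zero on the other summands. Put $[A]=v^{-d_A}e_A$ with $d_A=\sum_{1\le i\le n,\,j\in\mathbb Z}\ \sum_{x\le i,\,y>j}a_{ij}a_{xy}$. Write $A\le_a B$ if $\mathrm{ro}(A)=\mathrm{ro}(B)$, $\mathrm{co}(A)=\mathrm{co}(B)$ and $\sigma_{ij}(A)\le\sigma_{ij}(B)$ for all $i\ne j$, where $\sigma_{ij}(A)=\sum_{x\le i,\,y\ge j}a_{xy}$ if $i<j$ and $\sigma_{ij}(A)=\sum_{x\ge i,\,y\le j}a_{xy}$ if $i>j$. Write $A<_aB$ if $A\le_aB$ and $A\neq B$. **Algorithm.** Let $A\in\Theta_d$. Start with $U^{(0)}=A$. As long as $U^{(t)}$ is not lower triangular, let $k>0$ be the largest integer such that some entry $u^{(t)}_{i,i+k}$ is nonzero; let $B^{(t+1)}$ be the matrix whose off-diagonal entries are $u^{(t)}_{i,i+k}$ at $(i,i+1)$ for all $i\in\mathbb Z$ and zero elsewhere,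 and let $U^{(t+1)}$ be obtained from $U^{(t)}$ by moving, for all $i$, the entry at $(i,i+k)$ down by one row, to be added to the entry at $(i+1,i+k)$. When $U^{(x)}$ is lower triangular, put $L^{(0)}=U^{(x)}$. As long as $L^{(s)}$ is not lower bidiagonal (that is, has nonzero entries outside the positions $(i,i)$, $(i,i-1)$), let $k>0$ be the largest integer such that some entry $l^{(s)}_{i,i-k}$ is nonzero; let $B_{(s+1)}$ be the matrix whose off-diagonal entries are $l^{(s)}_{i,i-k}$ at $(i,i-1)$ for all $i$ and zero elsewhere, and let $L^{(s+1)}$ be obtained from $L^{(s)}$ by moving the entry at $(i,i-k)$ up by one row, to be added to the entry at $(i-1,i-k)$, for all $i$. When $L^{(y-1)}$ is lower bidiagonal, put $B_{(y)}=L^{(y-1)}$ and stop. The diagonal entries of the other matrices are determined by the conditions that the first matrix of the sequence $B^{(1)},\dots,B^{(x)},B_{(1)},\dots,B_{(y)}$ has row sum vector $\mathrm{ro}(A)$ and that the column sum vector of each matrix of the sequence is the row sum vector of the next. **Theorem.** For each $A\in\Theta_d$ the algorithm terminates and produces uniquely determined upper bidiagonal matrices $B^{(1)},\dots,B^{(x)}\in\Theta_d$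 and lower bidiagonal matrices $B_{(1)},\dots,B_{(y)}\in\Theta_d$, and there are finitely many $A'\in\Theta_d$ with $A'<_aA$ and coefficients $c_{A'}\in\mathbb Z[v,v^{-1}]$ such that $$[B^{(1)}]*\cdots*[B^{(x)}]*[B_{(1)}]*\cdots*[B_{(y)}]=[A]+\sum_{A'<_aA}c_{A'}[A'].$$ -/

import Mathlib

open scoped DirectSum

namespace AffineSchur

noncomputable section

/-! ### The extended affine Weyl group -/

/-- The extended affine Weyl group of type `A_{d-1}`, realized as the group of all permutations
`g` of `ℤ` with `g (i + d) = g i + d`. -/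
def ExtWeyl (d : ℕ) : Subgroup (Equiv.Perm ℤ) where
  carrier := {g | ∀ i : ℤ, g (i + d) = g i + d}
  one_mem' := fun _ => rfl
  mul_mem' := by
    intro a b ha hb i
    change ∀ i : ℤ, a (i + d) = a i + d at ha
    change ∀ i : ℤ, b (i + d) = b i + d at hb
    change (a * b) (i + d) = (a * b) i + d
    rw [Equiv.Perm.mul_apply, Equiv.Perm.mul_apply, hb, ha]
  inv_mem' := by
    intro a ha i
    change ∀ i : ℤ, a (i + d) = a i + d at ha
    change a⁻¹ (i + d) = a⁻¹ i + d
    rw [Equiv.Perm.inv_eq_iff_eq, ha]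
    simp

/-- The element `π : t ↦ t + 1`. -/
def rot (d : ℕ) : ExtWeyl d :=
  ⟨Equiv.addRight 1, fun i => by simp only [Equiv.coe_addRight]; ring⟩

/-- `s` is the simple reflection `s_i = ∏_k (kd + i, kd + i + 1)`. (When `d = 1` no element of
`ExtWeyl d` satisfies this: there are no simple reflections.) -/
def IsSimpleRefl {d : ℕ} (s : ExtWeyl d) (i : ℤ) : Prop :=
  s.1 i = i + 1 ∧ s.1 (i + 1) = i ∧
    ∀ t : ℤ, ¬ t ≡ i [ZMOD d] → ¬ t ≡ i + 1 [ZMOD d] → s.1 t = t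

/-- The set `S = {s_1, …, s_d}` of simple reflections. -/
def simpleRefls (d : ℕ) : Set (ExtWeyl d) :=
  {s | ∃ i : ℤ, 1 ≤ i ∧ i ≤ d ∧ IsSimpleRefl s i}

/-- The length of `g = π^z w`: the least number of simple reflections in an expression of `w`. -/
def length {d : ℕ} (g : ExtWeyl d) : ℕ :=
  sInf {k | ∃ (z : ℤ) (l : List (ExtWeyl d)),
    (∀ s ∈ l, s ∈ simpleRefls d) ∧ l.length = k ∧ g = rot d ^ z * l.prod}

/-! ### Compositions, parabolic subgroups, distinguished representatives -/

/-- Weak compositions of `d` into `n` parts; the part `λ_k` of the usual notation is the value at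
the index `k - 1`. -/
abbrev Comp (n d : ℕ) : Type := {l : Fin n → ℕ // ∑ k, l k = d}

/-- The partial sum `λ_1 + ⋯ + λ_m`, extended to all integers `m` by
`psum (m + n) = psum m + d`. -/
def Comp.psum {n d : ℕ} (l : Comp n d) (m : ℤ) : ℤ :=
  (m / n) * d + ∑ k : Fin n, if ((k : ℕ) : ℤ) < m % n then (l.1 k : ℤ) else 0

/-- The integral interval `R_i^λ = (λ_1 + ⋯ + λ_{i-1} .. λ_1 + ⋯ + λ_i]`, with
`R_{i+n}^λ = R_i^λ + d`. -/
def Comp.interval {n d : ℕ} (l : Comp n d) (i : ℤ) : Set ℤ :=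
  Set.Ioc (l.psum (i - 1)) (l.psum i)

/-- The (finite) parabolic subgroup `W_λ`, generated by the simple reflections other than
`s_{λ_1}, s_{λ_1 + λ_2}, …, s_{λ_1 + ⋯ + λ_n} = s_d`. -/
def parabolic {n d : ℕ} (l : Comp n d) : Subgroup (ExtWeyl d) :=
  Subgroup.closure {s | ∃ i : ℤ, 1 ≤ i ∧ i ≤ d ∧ IsSimpleRefl s i ∧
    ∀ m : ℤ, 1 ≤ m → m ≤ n → i ≠ l.psum m}

/-- Distinguished representatives of the right cosets `W_λ w`. -/
def distinguished {n d : ℕ} (l : Comp n d) : Set (ExtWeyl d) :=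
  {w | ∀ g ∈ parabolic l, length (g * w) = length g + length w}

/-- Distinguished representatives of the double cosets `W_λ g W_μ`. -/
def distinguishedDouble {n d : ℕ} (l m : Comp n d) : Set (ExtWeyl d) :=
  {g | g ∈ distinguished l ∧ g⁻¹ ∈ distinguished m}

/-! ### The extended affine Hecke algebra -/

/-- The ring `ℤ[v, v⁻¹]`. -/
abbrev Zv : Type := LaurentPolynomial ℤ

/-- The power `v ^ k` for an integer `k`. -/
def vpow (k : ℤ) : Zv := LaurentPolynomial.T k

/-- Defining relations of the Hecke algebra on the generators `T_g`. -/
inductive HeckeRel (d : ℕ) : FreeAlgebra Zv (ExtWeyl d) → FreeAlgebra Zv (ExtWeyl d) → Prop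
  | one : HeckeRel d (FreeAlgebra.ι Zv 1) 1
  | mul (w w' : ExtWeyl d) (h : length w + length w' = length (w * w')) :
      HeckeRel d (FreeAlgebra.ι Zv w * FreeAlgebra.ι Zv w') (FreeAlgebra.ι Zv (w * w'))
  | quad (s : ExtWeyl d) (h : s ∈ simpleRefls d) :
      HeckeRel d ((FreeAlgebra.ι Zv s + 1) *
        (FreeAlgebra.ι Zv s - algebraMap Zv (FreeAlgebra Zv (ExtWeyl d)) (vpow 2))) 0

/-- The extended affine Hecke algebra over `ℤ[v, v⁻¹]`. -/
abbrev Hecke (d : ℕ) : Type := RingQuot (HeckeRel d)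

/-- The element `T_g`. -/
def heckeT {d : ℕ} (g : ExtWeyl d) : Hecke d :=
  RingQuot.mkAlgHom Zv (HeckeRel d) (FreeAlgebra.ι Zv g)

/-- `T_X = ∑_{w ∈ X} T_w` for a finite set `X`. -/
def heckeTSet {d : ℕ} (X : Set (ExtWeyl d)) : Hecke d := ∑ᶠ w ∈ X, heckeT w

/-- `x_λ = T_{W_λ}`. -/
def xElt {n d : ℕ} (l : Comp n d) : Hecke d := heckeTSet (parabolic l : Set (ExtWeyl d))

/-- The right ideal `x_λ H`, as a right `H`-module. -/
abbrev xIdeal {n d : ℕ} (l : Comp n d) : Submodule (Hecke d)ᵐᵒᵖ (Hecke d) :=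
  Submodule.span (Hecke d)ᵐᵒᵖ {xElt l}

/-- `x_λ` as an element of `x_λ H`. -/
def xGen {n d : ℕ} (l : Comp n d) : xIdeal l :=
  ⟨xElt l, Submodule.mem_span_singleton_self _⟩

/-! ### The affine `q`-Schur algebra -/

/-- The affine `q`-Schur algebra `End_H (⨁_λ x_λ H)`; its product is composition of maps. -/
abbrev Schur (n d : ℕ) : Type :=
  Module.End (Hecke d)ᵐᵒᵖ (⨁ l : Comp n d, xIdeal l)

open Classical in
/-- The right `H`-linear map `x_μ H → x_λ H` that sends `x_μ` to `T_{W_λ g W_μ}` (it is unique,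
since `x_μ` generates `x_μ H`). -/
def phiHom {n d : ℕ} (l m : Comp n d) (g : ExtWeyl d) :
    xIdeal m →ₗ[(Hecke d)ᵐᵒᵖ] xIdeal l :=
  if h : ∃ f : xIdeal m →ₗ[(Hecke d)ᵐᵒᵖ] xIdeal l,
      (f (xGen m) : Hecke d) =
        heckeTSet (DoubleCoset.doubleCoset g (parabolic l : Set (ExtWeyl d)) (parabolic m))
  then h.choose else 0

/-- `φ_{λμ}^g` as an element of the Schur algebra (zero on the summands other than `x_μ H`). -/
def phi {n d : ℕ} (l m : Comp n d) (g : ExtWeyl d) : Schur n d :=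
  DirectSum.lof (Hecke d)ᵐᵒᵖ (Comp n d) (fun k => xIdeal k) l ∘ₗ phiHom l m g ∘ₗ
    DirectSum.component (Hecke d)ᵐᵒᵖ (Comp n d) (fun k => xIdeal k) m

/-! ### Periodic matrices -/

/-- The set `Θ_d` of `ℤ × ℤ` matrices over `ℕ` with `a_{ij} = a_{i+n,j+n}` and
`∑_{1 ≤ i ≤ n} ∑_j a_{ij} = d`. -/
@[ext]
structure Theta (n d : ℕ) where
  entry : ℤ → ℤ → ℕ
  periodic : ∀ i j : ℤ, entry (i + n) (j + n) = entry i j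
  finite : ∀ i : ℤ, (Function.support (entry i)).Finite
  total : ∑ i ∈ Finset.Icc (1 : ℤ) n, ∑ᶠ j : ℤ, entry i j = d

/-- Row sums. -/
def Theta.ro {n d : ℕ} (A : Theta n d) (k : ℤ) : ℕ := ∑ᶠ j : ℤ, A.entry k j

/-- Column sums. -/
def Theta.co {n d : ℕ} (A : Theta n d) (k : ℤ) : ℕ := ∑ᶠ i : ℤ, A.entry i k

/-- `A = κ(λ, g, μ)`, that is, `g ∈ D_{λμ}` and `a_{ij} = |R_i^λ ∩ g R_j^μ|`. -/
def IsKappa {n d : ℕ} (l : Comp n d) (g : ExtWeyl d) (m : Comp n d) (A : Theta n d) : Prop :=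
  g ∈ distinguishedDouble l m ∧
    ∀ i j : ℤ, A.entry i j = (l.interval i ∩ g.1 '' m.interval j).ncard

open Classical in
/-- `e_A = φ_{λμ}^g` where `A = κ(λ, g, μ)`. -/
def eElt {n d : ℕ} (A : Theta n d) : Schur n d :=
  if h : ∃ t : Comp n d × ExtWeyl d × Comp n d, IsKappa t.1 t.2.1 t.2.2 A
  then phi h.choose.1 h.choose.2.2 h.choose.2.1 else 0

/-- `d_A = ∑_{1 ≤ i ≤ n, j} ∑_{x ≤ i, y > j} a_{ij} a_{xy}`. -/
def Theta.dNum {n d : ℕ} (A : Theta n d) : ℕ :=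
  ∑ i ∈ Finset.Icc (1 : ℤ) n, ∑ᶠ j : ℤ, ∑ᶠ p : ℤ × ℤ,
    if p.1 ≤ i ∧ j < p.2 then A.entry i j * A.entry p.1 p.2 else 0

/-- The standard basis element `[A] = v^{-d_A} e_A`. -/
def std {n d : ℕ} (A : Theta n d) : Schur n d := vpow (-(A.dNum : ℤ)) • eElt A

/-- `σ_{ij}(A)`: the sum of the entries weakly north-east of `(i, j)` if `i < j`, and weakly
south-west of `(i, j)` if `i > j`. -/
def Theta.sigma {n d : ℕ} (A : Theta n d) (i j : ℤ) : ℕ :=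
  if i < j then ∑ᶠ p : ℤ × ℤ, if p.1 ≤ i ∧ j ≤ p.2 then A.entry p.1 p.2 else 0
  else ∑ᶠ p : ℤ × ℤ, if i ≤ p.1 ∧ p.2 ≤ j then A.entry p.1 p.2 else 0

/-- The partial order `A ≤_a B`. -/
def Theta.LeA {n d : ℕ} (A B : Theta n d) : Prop :=
  A.ro = B.ro ∧ A.co = B.co ∧ ∀ i j : ℤ, i ≠ j → A.sigma i j ≤ B.sigma i j

/-- `A <_a B`. -/
def Theta.LtA {n d : ℕ} (A B : Theta n d) : Prop := A.LeA B ∧ A ≠ B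

/-! ### The algorithm -/

def Theta.IsLowerTriangular {n d : ℕ} (A : Theta n d) : Prop :=
  ∀ i j : ℤ, i < j → A.entry i j = 0

def Theta.IsUpperBidiagonal {n d : ℕ} (A : Theta n d) : Prop :=
  ∀ i j : ℤ, j ≠ i → j ≠ i + 1 → A.entry i j = 0

def Theta.IsLowerBidiagonal {n d : ℕ} (A : Theta n d) : Prop :=
  ∀ i j : ℤ, j ≠ i → j ≠ i - 1 → A.entry i j = 0

/-- The matrix formed by the entries of `A` at the positions `(i, i + k)`. -/
def Theta.diagonalPart {n d : ℕ} (A : Theta n d) (k : ℤ) (i j : ℤ) : ℕ :=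
  if j = i + k then A.entry i j else 0

/-- One step of the first loop: `k > 0` is the outermost nonzero upper diagonal of `U`, the
off-diagonal part of `B` is `∑ u_{i,i+k} E_{i,i+1}`, and `U'` is obtained from `U` by shifting
that diagonal down by one row. -/
def UpperStep {n d : ℕ} (U B U' : Theta n d) : Prop :=
  ∃ k : ℤ, 0 < k ∧ (∃ i, U.entry i (i + k) ≠ 0) ∧ (∀ i j, i + k < j → U.entry i j = 0) ∧
    (∀ i j, j ≠ i → B.entry i j = if j = i + 1 then U.entry i (i + k) else 0) ∧
    (∀ i j, U'.entry i j =
      U.entry i j - U.diagonalPart k i j + U.diagonalPart k (i - 1) j)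

/-- One step of the second loop: `k > 0` is the outermost nonzero lower diagonal of `L`, the
off-diagonal part of `B` is `∑ l_{i,i-k} E_{i,i-1}`, and `L'` is obtained from `L` by shifting
that diagonal up by one row. -/
def LowerStep {n d : ℕ} (L B L' : Theta n d) : Prop :=
  ∃ k : ℤ, 0 < k ∧ (∃ i, L.entry i (i - k) ≠ 0) ∧ (∀ i j, j < i - k → L.entry i j = 0) ∧
    (∀ i j, j ≠ i → B.entry i j = if j = i - 1 then L.entry i (i - k) else 0) ∧
    (∀ i j, L'.entry i j =
      L.entry i j - L.diagonalPart (-k) i j + L.diagonalPart (-k) (i + 1) j)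

/-- The first loop, started at `U`, produces the list `B^(1), …, B^(x)` (up to diagonals) and
terminates with a lower triangular matrix. -/
inductive UpperLoop {n d : ℕ} : Theta n d → List (Theta n d) → Theta n d → Prop
  | done (U : Theta n d) (h : U.IsLowerTriangular) : UpperLoop U [] U
  | step (U B U' L : Theta n d) (Bs : List (Theta n d)) (h : ¬ U.IsLowerTriangular)
      (hs : UpperStep U B U') (ht : UpperLoop U' Bs L) : UpperLoop U (B :: Bs) L

/-- The second loop, started at `L`, produces the list `B_(1), …, B_(y)` (up to the diagonals of
all but the last member); the last member is the lower bidiagonal matrix at which it stops. -/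
inductive LowerLoop {n d : ℕ} : Theta n d → List (Theta n d) → Prop
  | done (L : Theta n d) (h : L.IsLowerBidiagonal) : LowerLoop L [L]
  | step (L B L' : Theta n d) (Bs : List (Theta n d)) (h : ¬ L.IsLowerBidiagonal)
      (hs : LowerStep L B L') (ht : LowerLoop L' Bs) : LowerLoop L (B :: Bs)

/-- The algorithm, applied to `A`, outputs `B^(1), …, B^(x)` and `B_(1), …, B_(y)`. The last two
clauses are the conditions that fix the diagonals: the first matrix of the combined list has the
row sums of `A`, and the column sums of each matrix are the row sums of the next one. -/
def AlgorithmOutput {n d : ℕ} (A : Theta n d) (Bup Blow : List (Theta n d)) : Prop :=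
  (∃ L : Theta n d, UpperLoop A Bup L ∧ LowerLoop L Blow) ∧
    (∀ B ∈ (Bup ++ Blow).head?, B.ro = A.ro) ∧
    List.IsChain (fun B B' : Theta n d => B.co = B'.ro) (Bup ++ Blow)

end

end AffineSchur

namespace AffineSchur

noncomputable section

/-! ### Periodic permutations -/

section Weyl

variable {d : ℕ}

/-! A matrix in `Θ_d` is the table of joint fibre sizes of two functions `c, e : ℤ → ℤ` that satisfy
`c (t + d) = c t + n` and `e (t + d) = e t + n`. Two pairs have the same matrix exactly when a Weyl
group element carries one to the other (`Theta.exists_fn`, `exists_act_pair`). The triple `(λ, g,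
μ)` belongs to the pair formed by the coloring of `λ` (color `i` on `R_i^λ`) and the coloring of `μ`
composed with `g⁻¹`, so matrices are double cosets (`mat_eq_mat_iff`). In this language `W_λ` is the
group that preserves a coloring, length counts inversions, and `g` is shortest in `W_λ g` when `g⁻¹`
is increasing on color fibres.

One step of the algorithm starts from a pair `(c, e)` for `U`, where `c` is the coloring of `λ` and
`g` is shortest. Let `ε = 1` in the first loop and `ε = -1` in the second, and let `k > 0` bound `ε
(e - c)`. Adding `ε` to `c` wherever `e - c = ε k` gives a function `p` (`EquivFun.push`). The pair
`(c, p)` has matrix `B`, and `(p, e)` has the shifted matrix `U'`. Since `p` is still monotone, it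
is a rotated coloring of a composition, and `B` is the matrix of a power `π^z`. Products with such a
factor can be computed (`eElt_mul_eElt`): in `e_B e_A` only matrices of pairs `(c, f)` occur for
which `(p, f)` has matrix `A`.

Triangularity is then combinatorial. If `A ≤ U'`, every such `(c, f)` has a matrix below or equal to
`U` (`leA_of_push`). Equality forces `A = U'`: an element of `W_λ` that carries `e` to `f` must
preserve the set of pushed positions, hence `p` (`ne_of_leA_push`, `act_push_of_ne`). The same
rigidity gives the coefficient 1 to `e_U` in `e_B e_{U'}`, and `d_U = d_B + d_{U'}` (`dNum_push`)
keeps it 1 after normalization. Thus `[B] * [U'] = [U] + lower`, and left multiplication by `[B]`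
takes terms below `U'` to combinations of terms below `U` (`exists_shift`). Each step narrows the
band, so induction on the bandwidth multiplies all factors out. -/

theorem mul_apply (g h : ExtWeyl d) (t : ℤ) : (g * h).1 t = g.1 (h.1 t) := rfl

theorem inv_apply_self (g : ExtWeyl d) (t : ℤ) : g⁻¹.1 (g.1 t) = t :=
  g.1.symm_apply_apply t

theorem apply_inv_self (g : ExtWeyl d) (t : ℤ) : g.1 (g⁻¹.1 t) = t :=
  g.1.apply_symm_apply t

theorem ext_apply {g h : ExtWeyl d} (H : ∀ t, g.1 t = h.1 t) : g = h :=
  Subtype.ext (Equiv.ext H)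

theorem apply_add_mul (g : ExtWeyl d) (i k : ℤ) : g.1 (i + k * d) = g.1 i + k * d := by
  induction k using Int.induction_on with
  | zero => simp
  | succ k ih =>
    have := g.2 (i + k * d)
    rw [ih] at this
    rw [show i + ((k : ℤ) + 1) * d = i + k * d + d by ring, this]; ring
  | pred k ih =>
    have := g.2 (i + (-(k : ℤ) - 1) * d)
    rw [show i + (-(k : ℤ) - 1) * d + d = i + -k * d by ring, ih] at this
    linarith

theorem apply_add (g : ExtWeyl d) (i : ℤ) : g.1 (i + d) = g.1 i + d := g.2 i

theorem rot_zpow_apply (z t : ℤ) : (rot d ^ z).1 t = t + z := by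
  have h : ∀ t, (rot d).1 t = t + 1 := fun t => rfl
  induction z using Int.induction_on generalizing t with
  | zero => simp
  | succ k ih => rw [zpow_add_one, mul_apply, ih, h]; ring
  | pred k ih =>
    rw [zpow_sub_one, mul_apply, ih]
    have := apply_inv_self (rot d) t
    rw [h] at this
    linarith

theorem strictMono_rot (z : ℤ) : StrictMono (rot d ^ z).1 := by
  intro a b h
  rw [rot_zpow_apply, rot_zpow_apply]
  lia

theorem exists_displacement_bound (hd : 0 < d) (g : ExtWeyl d) :
    ∃ C : ℤ, ∀ t, |g.1 t - t| ≤ C := by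
  obtain ⟨C, hC⟩ := ((Finset.Ico (0 : ℤ) d).image fun t => |g.1 t - t|).bddAbove
  refine ⟨C, fun t => ?_⟩
  have hd' : (0 : ℤ) < d := by exact_mod_cast hd
  have h1 := apply_add_mul g (t % d) (t / d)
  have h2 : t % d + t / d * d = t := Int.emod_add_ediv_mul t d
  rw [h2] at h1
  have : g.1 t - t = g.1 (t % d) - t % d := by rw [h1]; linarith
  rw [this]
  apply hC
  simp only [Finset.coe_image, Set.mem_image, Finset.coe_Ico, Set.mem_Ico]
  exact ⟨t % d, ⟨Int.emod_nonneg _ hd'.ne', Int.emod_lt_of_pos _ hd'⟩, rfl⟩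

/-- An increasing bijection of `ℤ` cannot skip a value, so it advances by exactly one at each step.
-/
theorem exists_rot_zpow_of_strictMono {g : ExtWeyl d} (h : StrictMono g.1) :
    ∃ z : ℤ, g = rot d ^ z := by
  have hs : ∀ t, g.1 (t + 1) = g.1 t + 1 := by
    intro t
    have h1 : g.1 t < g.1 (t + 1) := h (by lia)
    by_contra hne
    obtain ⟨u, hu⟩ := g.1.surjective (g.1 t + 1)
    have h2 : t < u := h.lt_iff_lt.1 (by lia)
    have h3 : u < t + 1 := h.lt_iff_lt.1 (by lia)
    lia
  refine ⟨g.1 0, ext_apply fun t => ?_⟩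
  rw [rot_zpow_apply]
  induction t using Int.induction_on with
  | zero => simp
  | succ k ih => rw [hs, ih]; ring
  | pred k ih =>
    have := hs (-(k : ℤ) - 1)
    rw [show -(k : ℤ) - 1 + 1 = -k by ring, ih] at this
    linarith

/-! ### Simple reflections -/

theorem IsSimpleRefl.two_le (hd : 0 < d) {s : ExtWeyl d} {a : ℤ} (h : IsSimpleRefl s a) :
    2 ≤ d := by
  by_contra hlt
  obtain rfl : d = 1 := by lia
  have h1 := apply_add s a
  obtain ⟨h2, h3, -⟩ := h
  push_cast at h1
  lia

theorem IsSimpleRefl.apply_left {s : ExtWeyl d} {a : ℤ} (h : IsSimpleRefl s a) (k : ℤ) :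
    s.1 (a + k * d) = a + 1 + k * d := by
  rw [apply_add_mul, h.1]

theorem IsSimpleRefl.apply_right {s : ExtWeyl d} {a : ℤ} (h : IsSimpleRefl s a) (k : ℤ) :
    s.1 (a + 1 + k * d) = a + k * d := by
  rw [apply_add_mul, h.2.1]

/-- The three kinds of integers with respect to a simple reflection. -/
theorem IsSimpleRefl.cases {s : ExtWeyl d} {a : ℤ} (h : IsSimpleRefl s a) (t : ℤ) :
    (∃ k : ℤ, t = a + k * d ∧ s.1 t = t + 1) ∨ (∃ k : ℤ, t = a + 1 + k * d ∧ s.1 t = t - 1) ∨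
      (¬ t ≡ a [ZMOD d] ∧ ¬ t ≡ a + 1 [ZMOD d] ∧ s.1 t = t) := by
  by_cases h1 : t ≡ a [ZMOD d]
  · obtain ⟨k, hk⟩ := h1.symm.dvd
    have : t = a + k * d := by linarith
    refine Or.inl ⟨k, this, ?_⟩
    rw [this, h.apply_left]; ring
  · by_cases h2 : t ≡ a + 1 [ZMOD d]
    · obtain ⟨k, hk⟩ := h2.symm.dvd
      have : t = a + 1 + k * d := by linarith
      refine Or.inr (Or.inl ⟨k, this, ?_⟩)
      rw [this, h.apply_right]; ring
    · exact Or.inr (Or.inr ⟨h1, h2, h.2.2 t h1 h2⟩)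

theorem IsSimpleRefl.apply_apply {s : ExtWeyl d} {a : ℤ} (h : IsSimpleRefl s a) (t : ℤ) :
    s.1 (s.1 t) = t := by
  rcases h.cases t with ⟨k, hk, e⟩ | ⟨k, hk, e⟩ | ⟨-, -, e⟩
  · rw [e, hk, show a + k * d + 1 = a + 1 + k * d by ring, h.apply_right]
  · rw [e, hk, show a + 1 + k * d - 1 = a + k * d by ring, h.apply_left]
  · rw [e, e]

theorem IsSimpleRefl.mul_self {s : ExtWeyl d} {a : ℤ} (h : IsSimpleRefl s a) : s * s = 1 :=
  ext_apply h.apply_apply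

theorem IsSimpleRefl.inv_eq {s : ExtWeyl d} {a : ℤ} (h : IsSimpleRefl s a) : s⁻¹ = s :=
  inv_eq_of_mul_eq_one_right h.mul_self

theorem IsSimpleRefl.shift {s : ExtWeyl d} {a : ℤ} (h : IsSimpleRefl s a) (k : ℤ) :
    IsSimpleRefl s (a + k * d) := by
  have e : a + k * d ≡ a [ZMOD d] := by
    refine (Int.modEq_iff_dvd.2 ⟨k, by ring⟩ : a ≡ a + k * d [ZMOD d]).symm
  refine ⟨by rw [h.apply_left]; ring, ?_, fun t h1 h2 => h.2.2 t ?_ ?_⟩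
  · rw [show a + k * d + 1 = a + 1 + k * d by ring, h.apply_right]
  · exact fun h3 => h1 (h3.trans e.symm)
  · exact fun h3 => h2 (h3.trans (e.symm.add_right 1))

theorem IsSimpleRefl.mem (hd : 0 < d) {s : ExtWeyl d} {a : ℤ} (h : IsSimpleRefl s a) :
    s ∈ simpleRefls d := by
  have hd' : (0 : ℤ) < d := by exact_mod_cast hd
  have h1 := Int.emod_add_ediv_mul (a - 1) d
  have h2 := Int.emod_nonneg (a - 1) hd'.ne'
  have h3 := Int.emod_lt_of_pos (a - 1) hd'
  refine ⟨(a - 1) % d + 1, by lia, by lia, ?_⟩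
  have := h.shift (-((a - 1) / d))
  rwa [show a + -((a - 1) / d) * d = (a - 1) % d + 1 by linarith] at this

theorem exists_isSimpleRefl (hd : 2 ≤ d) (a : ℤ) : ∃ s : ExtWeyl d, IsSimpleRefl s a := by
  classical
  let f : ℤ → ℤ := fun t => if (d : ℤ) ∣ t - a then t + 1 else if (d : ℤ) ∣ t - a - 1 then t - 1
    else t
  have hn : ∀ t : ℤ, (d : ℤ) ∣ t → ¬ (d : ℤ) ∣ t + 1 := by
    intro t h1 h2
    have h3 := (Int.dvd_add_right h1).1 h2
    have := Int.le_of_dvd one_pos h3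
    lia
  have hf : Function.Involutive f := by
    intro t
    simp only [f]
    by_cases h1 : (d : ℤ) ∣ t - a
    · have : ¬ (d : ℤ) ∣ t + 1 - a := by
        rw [show t + 1 - a = t - a + 1 by ring]; exact hn _ h1
      rw [if_pos h1, if_neg this, if_pos (by rwa [show t + 1 - a - 1 = t - a by ring])]
      ring
    · by_cases h2 : (d : ℤ) ∣ t - a - 1
      · rw [if_neg h1, if_pos h2, if_pos (by rwa [show t - 1 - a = t - a - 1 by ring])]
        ring
      · simp only [if_neg h1, if_neg h2]
  have hp : ∀ t : ℤ, f (t + d) = f t + d := by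
    intro t
    simp only [f]
    have e1 : (d : ℤ) ∣ t + d - a ↔ (d : ℤ) ∣ t - a := by
      rw [show t + d - a = t - a + d by ring]; exact dvd_add_self_right
    have e2 : (d : ℤ) ∣ t + d - a - 1 ↔ (d : ℤ) ∣ t - a - 1 := by
      rw [show t + d - a - 1 = t - a - 1 + d by ring]; exact dvd_add_self_right
    simp only [e1, e2]
    split_ifs <;> ring
  refine ⟨⟨hf.toPerm, hp⟩, ?_, ?_, ?_⟩
  · change f a = a + 1
    simp [f]
  · change f (a + 1) = a
    have : ¬ (d : ℤ) ∣ 1 := by simpa using hn 0 (dvd_zero _)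
    simp [f, this]
  · intro t h1 h2
    change f t = t
    have h1' : ¬ (d : ℤ) ∣ t - a := fun h => h1 (Int.modEq_iff_dvd.2 h).symm
    have h2' : ¬ (d : ℤ) ∣ t - a - 1 := fun h =>
      h2 (Int.modEq_iff_dvd.2 (by rwa [← sub_sub])).symm
    simp only [f, if_neg h1', if_neg h2']

/-- A simple reflection reverses the order of a pair only if it swaps it. -/
theorem IsSimpleRefl.lt_of_lt {s : ExtWeyl d} {a : ℤ} (h : IsSimpleRefl s a) {p q : ℤ}
    (hpq : p < q) (hne : ∀ k : ℤ, p = a + k * d → q ≠ p + 1) : s.1 p < s.1 q := by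
  have hinj : s.1 p ≠ s.1 q := fun e => hpq.ne (s.1.injective e)
  rcases h.cases p with ⟨k, hk, e⟩ | ⟨k, hk, e⟩ | ⟨-, -, e⟩
  · have := hne k hk
    rcases h.cases q with ⟨k', -, e'⟩ | ⟨k', -, e'⟩ | ⟨-, -, e'⟩ <;> lia
  · rcases h.cases q with ⟨k', -, e'⟩ | ⟨k', -, e'⟩ | ⟨-, -, e'⟩ <;> lia
  · rcases h.cases q with ⟨k', -, e'⟩ | ⟨k', -, e'⟩ | ⟨-, -, e'⟩ <;> lia

theorem IsSimpleRefl.conj_rot {s : ExtWeyl d} {a : ℤ} (h : IsSimpleRefl s a) (z : ℤ) :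
    IsSimpleRefl (rot d ^ z * s * (rot d ^ z)⁻¹) (a + z) := by
  have e : ∀ t, (rot d ^ z * s * (rot d ^ z)⁻¹).1 t = s.1 (t - z) + z := by
    intro t
    rw [mul_apply, mul_apply, rot_zpow_apply, ← zpow_neg, rot_zpow_apply, sub_eq_add_neg]
  refine ⟨?_, ?_, fun t h1 h2 => ?_⟩
  · rw [e, add_sub_cancel_right, h.1]; ring
  · rw [e, show a + z + 1 - z = a + 1 by ring, h.2.1]
  · rw [e, h.2.2 (t - z) ?_ ?_]
    · ring
    · intro h3; apply h1; simpa using h3.add_right z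
    · intro h3; apply h2
      have := h3.add_right z
      rwa [sub_add_cancel, show a + 1 + z = a + z + 1 by ring] at this

/-! ### Inversions and length -/

/-- The positions to the right of `i` that carry a smaller value. -/
def invSet (g : ExtWeyl d) (i : ℤ) : Set ℤ := {j | i < j ∧ g.1 j < g.1 i}

theorem invSet_finite (hd : 0 < d) (g : ExtWeyl d) (i : ℤ) : (invSet g i).Finite := by
  obtain ⟨C, hC⟩ := exists_displacement_bound hd g
  refine (Set.finite_Icc i (g.1 i + C)).subset fun j hj => ?_
  have := abs_le.1 (hC j)
  exact ⟨hj.1.le, by have := hj.2; lia⟩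

/-- The number of inversions of `g`, up to translation by `d`. -/
def invNum (g : ExtWeyl d) : ℕ := ∑ i ∈ Finset.Ico (0 : ℤ) d, (invSet g i).ncard

theorem ncard_invSet_add (g : ExtWeyl d) (i : ℤ) :
    (invSet g (i + d)).ncard = (invSet g i).ncard := by
  have : invSet g (i + d) = (fun t => t + (d : ℤ)) '' invSet g i := by
    ext j
    simp only [invSet, Set.mem_ofPred_eq, Set.mem_image]
    constructor
    · rintro ⟨h1, h2⟩
      refine ⟨j - d, ⟨by lia, ?_⟩, by ring⟩
      have := apply_add g (j - d)
      rw [sub_add_cancel] at this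
      rw [apply_add] at h2
      lia
    · rintro ⟨t, ⟨h1, h2⟩, rfl⟩
      rw [apply_add, apply_add]
      lia
  rw [this, Set.ncard_image_of_injective _ (add_left_injective _)]

/-- The sum of a `d`-periodic function over a period does not depend on the period. -/
theorem sum_period {M : Type*} [AddCommGroup M] {n : ℕ} (f : ℤ → M) (hf : ∀ i, f (i + n) = f i)
    (a b : ℤ) : ∑ i ∈ Finset.Ico a (a + n), f i = ∑ i ∈ Finset.Ico b (b + n), f i := by
  have step : ∀ a : ℤ, ∑ i ∈ Finset.Ico (a + 1) (a + 1 + n), f i =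
      ∑ i ∈ Finset.Ico a (a + n), f i := by
    intro a
    rcases Nat.eq_zero_or_pos n with rfl | hn
    · simp
    · have h1 : Finset.Ico a (a + n) = insert a (Finset.Ico (a + 1) (a + n)) := by
        ext t; simp only [Finset.mem_Ico, Finset.mem_insert]; lia
      have h2 : Finset.Ico (a + 1) (a + 1 + n) =
          insert (a + n) (Finset.Ico (a + 1) (a + n)) := by
        ext t; simp only [Finset.mem_Ico, Finset.mem_insert]; lia
      rw [h1, h2, Finset.sum_insert (by simp), Finset.sum_insert (by simp), hf]
  have base : ∀ a : ℤ, ∑ i ∈ Finset.Ico a (a + n), f i = ∑ i ∈ Finset.Ico (0 : ℤ) (0 + n), f i := by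
    intro a
    induction a using Int.induction_on with
    | zero => rfl
    | succ k ih => rw [step, ih]
    | pred k ih =>
      have := step (-(k : ℤ) - 1)
      rw [sub_add_cancel] at this
      rw [← this, ih]
  rw [base a, base b]

theorem sum_period_nat {n : ℕ} (f : ℤ → ℕ) (hf : ∀ i, f (i + n) = f i) (a b : ℤ) :
    ∑ i ∈ Finset.Ico a (a + n), f i = ∑ i ∈ Finset.Ico b (b + n), f i := by
  have := sum_period (n := n) (fun i => (f i : ℤ)) (fun i => by rw [hf]) a b
  exact_mod_cast this

theorem invNum_eq (g : ExtWeyl d) (a : ℤ) :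
    invNum g = ∑ i ∈ Finset.Ico a (a + d), (invSet g i).ncard := by
  have := sum_period_nat (fun i => (invSet g i).ncard) (ncard_invSet_add g) 0 a
  rwa [zero_add] at this

/-- Inversions are counted over the period that starts at `a`. The counts at `a` and `a + 1` trade
places and the pair `(a, a + 1)` becomes one new inversion; at the other positions `s` only permutes
what lies to the right. -/
theorem invNum_mul_simpleRefl (hd : 0 < d) {g s : ExtWeyl d} {a : ℤ} (hs : IsSimpleRefl s a)
    (h : g.1 a < g.1 (a + 1)) : invNum (g * s) = invNum g + 1 := by
  have hd2 := hs.two_le hd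
  have hinv : ∀ t, s.1 (s.1 t) = t := hs.apply_apply
  -- `s` can carry a point from the right of `i` to its left or onto it only if `i ≡ a` modulo `d`,
  -- which the chosen period excludes for `i ≠ a`.
  have key : ∀ i : ℤ, i ≠ a → a ≤ i → i < a + d → ∀ j, i < j → i < s.1 j := by
    intro i h1 h2 h3 j hj
    rcases hs.cases j with ⟨k, hk, e⟩ | ⟨k, hk, e⟩ | ⟨-, -, e⟩
    · lia
    · rw [e]
      have : a + k * d ≠ i := by
        rintro rfl
        rcases lt_trichotomy k 0 with h | h | h
        · nlinarith
        · subst h; simp at h1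
        · nlinarith
      lia
    · lia
  have img : ∀ i : ℤ, i ≠ a → a ≤ i → i < a + d → ∀ b : ℤ,
      {j | i < j ∧ g.1 (s.1 j) < b}.ncard = {j | i < j ∧ g.1 j < b}.ncard := by
    intro i h1 h2 h3 b
    have : {j | i < j ∧ g.1 j < b} = s.1 '' {j | i < j ∧ g.1 (s.1 j) < b} := by
      ext j
      simp only [Set.mem_ofPred_eq, Set.mem_image]
      constructor
      · rintro ⟨h4, h5⟩
        exact ⟨s.1 j, ⟨key i h1 h2 h3 j h4, by rwa [hinv]⟩, hinv j⟩
      · rintro ⟨t, ⟨h4, h5⟩, rfl⟩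
        exact ⟨key i h1 h2 h3 t h4, h5⟩
    rw [this, Set.ncard_image_of_injective _ s.1.injective]
  have dec : Finset.Ico a (a + d) = insert a (insert (a + 1) (Finset.Ico (a + 2) (a + d))) := by
    ext t; simp only [Finset.mem_Ico, Finset.mem_insert]; lia
  rw [invNum_eq _ a, invNum_eq g a, dec, Finset.sum_insert (by simp),
    Finset.sum_insert (by simp), Finset.sum_insert (by simp), Finset.sum_insert (by simp)]
  have rest : ∑ i ∈ Finset.Ico (a + 2) (a + d), (invSet (g * s) i).ncard =
      ∑ i ∈ Finset.Ico (a + 2) (a + d), (invSet g i).ncard := by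
    refine Finset.sum_congr rfl fun i hi => ?_
    rw [Finset.mem_Ico] at hi
    have e : s.1 i = i := by
      rcases hs.cases i with ⟨k, hk, e⟩ | ⟨k, hk, e⟩ | ⟨-, -, e⟩
      · exfalso
        rcases lt_trichotomy k 0 with h | h | h
        · nlinarith
        · subst h; lia
        · nlinarith
      · exfalso
        rcases lt_trichotomy k 0 with h | h | h
        · nlinarith
        · subst h; lia
        · nlinarith
      · exact e
    have := img i (by lia) (by lia) (by lia) (g.1 i)
    simpa only [invSet, mul_apply, e] using this
  have h1 : (invSet (g * s) (a + 1)).ncard = (invSet g a).ncard := by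
    have := img (a + 1) (by lia) (by lia) (by lia) (g.1 a)
    simp only [invSet, mul_apply, hs.2.1, this]
    congr 1
    ext j
    simp only [Set.mem_ofPred_eq]
    refine ⟨fun hj => ⟨by lia, hj.2⟩, fun hj => ⟨?_, hj.2⟩⟩
    have : j ≠ a + 1 := by rintro rfl; lia
    lia
  have h2 : (invSet (g * s) a).ncard = (invSet g (a + 1)).ncard + 1 := by
    have := img (a + 1) (by lia) (by lia) (by lia) (g.1 (a + 1))
    have e : invSet (g * s) a = insert (a + 1) {j | a + 1 < j ∧ g.1 (s.1 j) < g.1 (a + 1)} := by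
      ext j
      simp only [invSet, mul_apply, hs.1, Set.mem_ofPred_eq, Set.mem_insert_iff]
      constructor
      · rintro ⟨h3, h4⟩
        rcases eq_or_lt_of_le (show a + 1 ≤ j by lia) with h5 | h5
        · exact Or.inl h5.symm
        · exact Or.inr ⟨h5, h4⟩
      · rintro (rfl | ⟨h3, h4⟩)
        · rw [hs.2.1]; exact ⟨by lia, h⟩
        · exact ⟨by lia, h4⟩
    have fin : {j | a + 1 < j ∧ g.1 (s.1 j) < g.1 (a + 1)}.Finite :=
      (invSet_finite hd (g * s) a).subset (by rw [e]; exact Set.subset_insert _ _)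
    rw [e, Set.ncard_insert_of_notMem (by simp) fin, this, invSet]
  rw [rest, h1, h2]
  ring

theorem invNum_mul_simpleRefl_of_gt (hd : 0 < d) {g s : ExtWeyl d} {a : ℤ}
    (hs : IsSimpleRefl s a) (h : g.1 (a + 1) < g.1 a) : invNum g = invNum (g * s) + 1 := by
  have := invNum_mul_simpleRefl hd (g := g * s) hs (by rwa [mul_apply, mul_apply, hs.1, hs.2.1])
  rwa [mul_assoc, hs.mul_self, mul_one] at this

theorem invNum_eq_zero (hd : 0 < d) {g : ExtWeyl d} (h : StrictMono g.1) : invNum g = 0 := by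
  refine Finset.sum_eq_zero fun i _ => ?_
  rw [Set.ncard_eq_zero (invSet_finite hd g i), Set.eq_empty_iff_forall_notMem]
  rintro j ⟨h1, h2⟩
  exact absurd (h h1) (not_lt.2 h2.le)

/-- A permutation without adjacent descents is increasing. -/
theorem strictMono_of_lt_succ {g : ExtWeyl d} (h : ∀ a, ¬ g.1 (a + 1) < g.1 a) :
    StrictMono g.1 := by
  refine strictMono_int_of_lt_succ fun a => lt_of_le_of_ne (not_lt.1 (h a)) fun e => ?_
  have := g.1.injective e
  lia

theorem two_le_of_descent (hd : 0 < d) {g : ExtWeyl d} {a : ℤ} (h : g.1 (a + 1) < g.1 a) :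
    2 ≤ d := by
  by_contra hlt
  obtain rfl : d = 1 := by lia
  have := apply_add g a
  push_cast at this
  lia

/-- Each adjacent descent can be removed by a simple reflection that lowers the inversion number by
one; when none is left, the permutation is a power of `π`. -/
theorem exists_word (hd : 0 < d) (g : ExtWeyl d) :
    ∃ (z : ℤ) (l : List (ExtWeyl d)), (∀ s ∈ l, s ∈ simpleRefls d) ∧ l.length = invNum g ∧
      g = rot d ^ z * l.prod := by
  induction hk : invNum g generalizing g with
  | zero =>
    have : StrictMono g.1 := strictMono_of_lt_succ fun a ha => by
      obtain ⟨s, hs⟩ := exists_isSimpleRefl (two_le_of_descent hd ha) a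
      have := invNum_mul_simpleRefl_of_gt hd hs ha
      lia
    obtain ⟨z, hz⟩ := exists_rot_zpow_of_strictMono this
    exact ⟨z, [], by simp, rfl, by simpa using hz⟩
  | succ k ih =>
    by_cases hm : ∃ a, g.1 (a + 1) < g.1 a
    · obtain ⟨a, ha⟩ := hm
      obtain ⟨s, hs⟩ := exists_isSimpleRefl (two_le_of_descent hd ha) a
      have := invNum_mul_simpleRefl_of_gt hd hs ha
      obtain ⟨z, l, h1, h2, h3⟩ := ih (g * s) (by lia)
      refine ⟨z, l ++ [s], ?_, by simp [h2], ?_⟩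
      · intro t ht
        rcases List.mem_append.1 ht with ht | ht
        · exact h1 t ht
        · rw [List.mem_singleton.1 ht]; exact hs.mem hd
      · rw [List.prod_append, List.prod_singleton, ← mul_assoc, ← h3, mul_assoc, hs.mul_self,
          mul_one]
    · push Not at hm
      have := invNum_eq_zero hd (strictMono_of_lt_succ fun a => not_lt.2 (hm a))
      lia

theorem invNum_word_le (hd : 0 < d) (z : ℤ) (l : List (ExtWeyl d))
    (hl : ∀ s ∈ l, s ∈ simpleRefls d) : invNum (rot d ^ z * l.prod) ≤ l.length := by
  induction l using List.reverseRecOn with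
  | nil =>
    rw [invNum_eq_zero hd]
    · simp
    · rw [List.prod_nil, mul_one]; exact strictMono_rot z
  | append_singleton l s ih =>
    have ih' := ih fun t ht => hl t (by simp [ht])
    obtain ⟨a, -, -, hs⟩ := hl s (by simp)
    rw [List.prod_append, List.prod_singleton, ← mul_assoc, List.length_append,
      List.length_singleton]
    rcases lt_trichotomy ((rot d ^ z * l.prod).1 a) ((rot d ^ z * l.prod).1 (a + 1)) with h | h | h
    · rw [invNum_mul_simpleRefl hd hs h]; lia
    · have := (rot d ^ z * l.prod).1.injective h
      lia
    · have := invNum_mul_simpleRefl_of_gt hd hs h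
      lia

/-- A word of this length exists, and no word is shorter because a simple reflection changes the
inversion number by one and `π` does not contribute. -/
theorem length_eq_invNum (hd : 0 < d) (g : ExtWeyl d) : length g = invNum g := by
  obtain ⟨z, l, h1, h2, h3⟩ := exists_word hd g
  apply le_antisymm
  · exact Nat.sInf_le ⟨z, l, h1, h2, h3⟩
  · refine le_csInf ⟨_, z, l, h1, h2, h3⟩ ?_
    rintro k ⟨z', l', h1', h2', h3'⟩
    rw [← h2', h3']
    exact invNum_word_le hd z' l' h1'

/-- From `g = π^z s_1 ⋯ s_r` one gets `g⁻¹ = π^{-z} (π^z s_r π^{-z}) ⋯ (π^z s_1 π^{-z})`, and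
conjugation by `π^z` permutes the simple reflections. -/
theorem length_inv_le (hd : 0 < d) (g : ExtWeyl d) : length g⁻¹ ≤ length g := by
  obtain ⟨z, l, h1, h2, h3⟩ := exists_word hd g
  rw [length_eq_invNum hd g]
  refine Nat.sInf_le ⟨-z, (l.map fun s => rot d ^ z * s * (rot d ^ z)⁻¹).reverse, ?_, ?_, ?_⟩
  · intro s hs
    rw [List.mem_reverse, List.mem_map] at hs
    obtain ⟨t, ht, rfl⟩ := hs
    obtain ⟨a, -, -, ha⟩ := h1 t ht
    exact (ha.conj_rot z).mem hd
  · simp [h2]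
  · have e : ∀ l : List (ExtWeyl d), (∀ s ∈ l, s ∈ simpleRefls d) →
        (l.map fun s => rot d ^ z * s * (rot d ^ z)⁻¹).reverse.prod =
          rot d ^ z * l.prod⁻¹ * (rot d ^ z)⁻¹ := by
      intro l hl
      induction l with
      | nil => simp
      | cons s l ih =>
        obtain ⟨a, -, -, ha⟩ := hl s (by simp)
        rw [List.map_cons, List.reverse_cons, List.prod_append, ih fun t ht => hl t (by simp [ht]),
          List.prod_singleton, List.prod_cons, mul_inv_rev, ha.inv_eq]
        group
    rw [e l h1, h3]
    group

theorem length_inv (hd : 0 < d) (g : ExtWeyl d) : length g⁻¹ = length g :=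
  le_antisymm (length_inv_le hd g) (by simpa using length_inv_le hd g⁻¹)

theorem length_mul_simpleRefl (hd : 0 < d) {g s : ExtWeyl d} {a : ℤ} (hs : IsSimpleRefl s a)
    (h : g.1 a < g.1 (a + 1)) : length (g * s) = length g + 1 := by
  rw [length_eq_invNum hd, length_eq_invNum hd, invNum_mul_simpleRefl hd hs h]

theorem length_simpleRefl_mul (hd : 0 < d) {g s : ExtWeyl d} {a : ℤ} (hs : IsSimpleRefl s a)
    (h : g⁻¹.1 a < g⁻¹.1 (a + 1)) : length (s * g) = length g + 1 := by
  rw [← length_inv hd, mul_inv_rev, hs.inv_eq, length_mul_simpleRefl hd hs h, length_inv hd]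

theorem length_simpleRefl_mul_of_gt (hd : 0 < d) {g s : ExtWeyl d} {a : ℤ}
    (hs : IsSimpleRefl s a) (h : g⁻¹.1 (a + 1) < g⁻¹.1 a) : length g = length (s * g) + 1 := by
  have := length_simpleRefl_mul hd (g := s * g) hs
    (by rwa [mul_inv_rev, hs.inv_eq, mul_apply, mul_apply, hs.1, hs.2.1])
  rwa [← mul_assoc, hs.mul_self, one_mul] at this

theorem length_rot (hd : 0 < d) (z : ℤ) : length (rot d ^ z) = 0 := by
  rw [length_eq_invNum hd, invNum_eq_zero hd (strictMono_rot z)]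

theorem length_one (hd : 0 < d) : length (1 : ExtWeyl d) = 0 := by
  simpa using length_rot hd 0

theorem length_simpleRefl (hd : 0 < d) {s : ExtWeyl d} {a : ℤ} (hs : IsSimpleRefl s a) :
    length s = 1 := by
  have := length_mul_simpleRefl hd (g := 1) hs (by simp)
  rwa [one_mul, length_one hd, zero_add] at this

theorem length_rot_mul (hd : 0 < d) (z : ℤ) (g : ExtWeyl d) :
    length (rot d ^ z * g) = length g := by
  rw [length_eq_invNum hd, length_eq_invNum hd]
  refine Finset.sum_congr rfl fun i _ => ?_
  simp only [invSet, mul_apply, rot_zpow_apply, add_lt_add_iff_right]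

end Weyl

/-! ### Colorings of the integers and their fixers -/

section Coloring

variable {d : ℕ} {P Q : Type*}

/-- A monotone coloring of `ℤ` whose fibres are permuted by translations by multiples of `d` and
have at most `d` elements. -/
structure IsColoring (d : ℕ) [PartialOrder P] (c : ℤ → P) : Prop where
  mono : Monotone c
  shift : ∀ a b k : ℤ, c a = c b → c (a + k * d) = c (b + k * d)
  ne : ∀ a, c a ≠ c (a + d)

/-- The group of the elements that preserve a coloring. -/
def fixer (d : ℕ) (c : ℤ → P) : Subgroup (ExtWeyl d) where
  carrier := {w | ∀ t, c (w.1 t) = c t}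
  one_mem' := fun _ => rfl
  mul_mem' := by
    intro a b ha hb t
    rw [mul_apply, ha, hb]
  inv_mem' := by
    intro a ha t
    rw [← ha (a⁻¹.1 t), apply_inv_self]

theorem apply_of_mem_fixer {c : ℤ → P} {w : ExtWeyl d} (h : w ∈ fixer d c) (t : ℤ) :
    c (w.1 t) = c t := h t

theorem inv_apply_of_mem_fixer {c : ℤ → P} {w : ExtWeyl d} (h : w ∈ fixer d c) (t : ℤ) :
    c (w⁻¹.1 t) = c t := (fixer d c).inv_mem h t

/-- `g⁻¹` is increasing on every fibre of the coloring. -/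
def IncOn (c : ℤ → P) (g : ExtWeyl d) : Prop := ∀ a b, a < b → c a = c b → g⁻¹.1 a < g⁻¹.1 b

theorem IncOn.refine {c : ℤ → P} {e : ℤ → Q} (h : ∀ a b, e a = e b → c a = c b) {g : ExtWeyl d}
    (hg : IncOn c g) : IncOn e g := fun a b hab hc => hg a b hab (h a b hc)

/-- `u⁻¹` keeps points of one `e`-fibre inside one `c`-fibre, where `g⁻¹` neither creates nor
destroys inversions. -/
theorem incOn_mul_iff {c : ℤ → P} {e : ℤ → Q} (h : ∀ a b, e a = e b → c a = c b)
    {u g : ExtWeyl d} (hu : u ∈ fixer d c) (hg : IncOn c g) :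
    IncOn e (u * g) ↔ IncOn e u := by
  have key : ∀ a b, e a = e b → (g⁻¹.1 (u⁻¹.1 a) < g⁻¹.1 (u⁻¹.1 b) ↔ u⁻¹.1 a < u⁻¹.1 b) := by
    intro a b hab
    have hc : c (u⁻¹.1 a) = c (u⁻¹.1 b) := by
      rw [inv_apply_of_mem_fixer hu, inv_apply_of_mem_fixer hu, h a b hab]
    refine ⟨fun hlt => ?_, fun hlt => hg _ _ hlt hc⟩
    by_contra hge
    rcases eq_or_lt_of_le (not_lt.1 hge) with h1 | h1
    · rw [h1] at hlt; exact lt_irrefl _ hlt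
    · exact absurd (hg _ _ h1 hc.symm) (not_lt.2 hlt.le)
  constructor
  · intro H a b hab he
    have := H a b hab he
    rw [mul_inv_rev, mul_apply, mul_apply] at this
    exact (key a b he).1 this
  · intro H a b hab he
    rw [mul_inv_rev, mul_apply, mul_apply]
    exact (key a b he).2 (H a b hab he)

variable [PartialOrder P] {c : ℤ → P}

theorem IsColoring.eq_of_between (hc : IsColoring d c) {a t b : ℤ} (h1 : a ≤ t) (h2 : t ≤ b)
    (h : c a = c b) : c t = c a :=
  le_antisymm ((hc.mono h2).trans h.ge) (hc.mono h1)

theorem IsColoring.abs_sub_lt (hc : IsColoring d c) {a b : ℤ} (h : c a = c b) : |a - b| < d := by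
  have key : ∀ a b : ℤ, c a = c b → b - a < d := by
    intro a b h
    by_contra hge
    exact hc.ne a (hc.eq_of_between (t := a + d) (by lia) (by lia) h).symm
  rw [abs_lt]
  have := key a b h
  have := key b a h.symm
  lia

theorem IsColoring.simpleRefl_mem (hc : IsColoring d c) {s : ExtWeyl d} {a : ℤ}
    (hs : IsSimpleRefl s a) (h : c a = c (a + 1)) : s ∈ fixer d c := by
  intro t
  rcases hs.cases t with ⟨k, hk, e⟩ | ⟨k, hk, e⟩ | ⟨-, -, e⟩
  · rw [e, hk, show a + k * d + 1 = a + 1 + k * d by ring]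
    exact (hc.shift _ _ k h).symm
  · rw [e, hk, show a + 1 + k * d - 1 = a + k * d by ring]
    exact hc.shift _ _ k h
  · rw [e]

/-- Fibres are intervals by monotonicity, so a failure of monotonicity on a fibre already shows at
two neighbours of the same color. -/
theorem IsColoring.exists_descent (hc : IsColoring d c) {g : ExtWeyl d} (h : ¬ IncOn c g) :
    ∃ a, c a = c (a + 1) ∧ g⁻¹.1 (a + 1) < g⁻¹.1 a := by
  by_contra hno
  push Not at hno
  apply h
  intro a b hab hcab
  obtain ⟨k, rfl⟩ : ∃ k : ℕ, b = a + 1 + k := ⟨(b - a - 1).toNat, by lia⟩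
  clear hab
  have adj : ∀ a, c a = c (a + 1) → g⁻¹.1 a < g⁻¹.1 (a + 1) := fun a ha =>
    lt_of_le_of_ne (hno a ha) fun e => by
      have := g⁻¹.1.injective e
      lia
  induction k with
  | zero => simpa using adj a (by simpa using hcab)
  | succ k ih =>
    have h1 : c (a + 1 + k) = c a :=
      hc.eq_of_between (by lia) (by push_cast; lia) hcab
    have h2 := adj (a + 1 + k) (by rw [h1, hcab]; push_cast; ring_nf)
    have := ih h1.symm
    push_cast
    rw [← add_assoc]
    exact this.trans h2

theorem IsColoring.exists_simpleRefl (hc : IsColoring d c) (hd : 0 < d) {g : ExtWeyl d}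
    (h : ¬ IncOn c g) : ∃ a s, IsSimpleRefl s a ∧ c a = c (a + 1) ∧ g⁻¹.1 (a + 1) < g⁻¹.1 a ∧
      s ∈ fixer d c ∧ length g = length (s * g) + 1 := by
  obtain ⟨a, h1, h2⟩ := hc.exists_descent h
  obtain ⟨s, hs⟩ := exists_isSimpleRefl (two_le_of_descent hd h2) a
  exact ⟨a, s, hs, h1, h2, hc.simpleRefl_mem hs h1, length_simpleRefl_mul_of_gt hd hs h2⟩

/-- The inverse is increasing within fibres by hypothesis and across fibres because it preserves a
monotone coloring. It is therefore a translation, and a nonzero translation leaves every fibre after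
`d` iterations. -/
theorem IsColoring.eq_one (hc : IsColoring d c) {w : ExtWeyl d} (hw : w ∈ fixer d c)
    (hi : IncOn c w) : w = 1 := by
  have hmono : StrictMono w⁻¹.1 := by
    intro a b hab
    by_cases h : c a = c b
    · exact hi a b hab h
    · by_contra hge
      have := hc.mono (not_lt.1 hge)
      rw [inv_apply_of_mem_fixer hw, inv_apply_of_mem_fixer hw] at this
      exact h (le_antisymm (hc.mono hab.le) this)
  obtain ⟨z, hz⟩ := exists_rot_zpow_of_strictMono hmono
  have hmul : ∀ k : ℕ, c (0 + k * z) = c 0 := by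
    intro k
    induction k with
    | zero => simp
    | succ k ih =>
      have := inv_apply_of_mem_fixer hw (0 + k * z)
      rw [hz, rot_zpow_apply, ih] at this
      rw [← this]
      congr 1; push_cast; ring
  have h0 := hc.abs_sub_lt (hmul d)
  have hz0 : z = 0 := by
    by_contra hz0
    have := Int.one_le_abs hz0
    rw [zero_add, sub_zero, abs_mul, Nat.abs_cast] at h0
    nlinarith
  rw [hz0, zpow_zero] at hz
  exact inv_eq_one.1 hz

/-- Induction on `length w`: a left descent of `w` inside a fibre stays a left descent of `w * g`,
since `w⁻¹` preserves the fibre and `g⁻¹` is increasing there. -/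
theorem IsColoring.length_mul (hc : IsColoring d c) (hd : 0 < d) {w g : ExtWeyl d}
    (hw : w ∈ fixer d c) (hg : IncOn c g) : length (w * g) = length w + length g := by
  induction hk : length w using Nat.strong_induction_on generalizing w with
  | _ k ih =>
    by_cases hi : IncOn c w
    · rw [← hk, hc.eq_one hw hi, length_one hd, one_mul, zero_add]
    · obtain ⟨a, s, hs, h1, h2, h3, h4⟩ := hc.exists_simpleRefl hd hi
      have h5 := ih (length (s * w)) (by lia) ((fixer d c).mul_mem h3 hw) rfl
      have h6 : (w * g)⁻¹.1 (a + 1) < (w * g)⁻¹.1 a := by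
        rw [mul_inv_rev, mul_apply, mul_apply]
        refine hg _ _ h2 ?_
        rw [inv_apply_of_mem_fixer hw, inv_apply_of_mem_fixer hw, h1]
      have := length_simpleRefl_mul_of_gt hd hs h6
      rw [← mul_assoc] at this
      lia

theorem IsColoring.length_mul_inv (hc : IsColoring d c) (hd : 0 < d) {w g : ExtWeyl d}
    (hw : w ∈ fixer d c) (hg : IncOn c g⁻¹) : length (g * w) = length g + length w := by
  rw [← length_inv hd, mul_inv_rev, hc.length_mul hd ((fixer d c).inv_mem hw) hg, length_inv hd,
    length_inv hd, add_comm]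

theorem IsColoring.exists_mul (hc : IsColoring d c) (hd : 0 < d) (g : ExtWeyl d) :
    ∃ w ∈ fixer d c, IncOn c (w * g) := by
  induction hk : length g using Nat.strong_induction_on generalizing g with
  | _ k ih =>
    by_cases hi : IncOn c g
    · exact ⟨1, one_mem _, by rwa [one_mul]⟩
    · obtain ⟨a, s, hs, h1, h2, h3, h4⟩ := hc.exists_simpleRefl hd hi
      obtain ⟨w, hw, hw'⟩ := ih (length (s * g)) (by lia) (s * g) rfl
      exact ⟨w * s, mul_mem hw h3, by rwa [mul_assoc]⟩

theorem IsColoring.eq_of_mul_eq (hc : IsColoring d c) {w w' g g' : ExtWeyl d}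
    (hw : w ∈ fixer d c) (hw' : w' ∈ fixer d c) (hg : IncOn c g) (hg' : IncOn c g')
    (h : w * g = w' * g') : w = w' ∧ g = g' := by
  have hu : w'⁻¹ * w ∈ fixer d c := mul_mem (inv_mem hw') hw
  have e : w'⁻¹ * w * g = g' := by rw [mul_assoc, h, inv_mul_cancel_left]
  have h1 := (incOn_mul_iff (fun _ _ h => h) hu hg).1 (by rwa [e])
  have h2 : w'⁻¹ * w = 1 := hc.eq_one hu h1
  exact ⟨(inv_mul_eq_one.1 h2).symm, by rw [← e, h2, one_mul]⟩

theorem IsColoring.fixer_eq_closure (hc : IsColoring d c) (hd : 0 < d) :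
    fixer d c = Subgroup.closure {s | ∃ a, IsSimpleRefl s a ∧ c a = c (a + 1)} := by
  apply le_antisymm
  · intro w hw
    induction hk : length w using Nat.strong_induction_on generalizing w with
    | _ k ih =>
      by_cases hi : IncOn c w
      · rw [hc.eq_one hw hi]; exact one_mem _
      · obtain ⟨a, s, hs, h1, h2, h3, h4⟩ := hc.exists_simpleRefl hd hi
        have h5 := ih (length (s * w)) (by lia) (mul_mem h3 hw) rfl
        have h6 := mul_mem (Subgroup.subset_closure ⟨a, hs, h1⟩ :
          s ∈ Subgroup.closure {s : ExtWeyl d | ∃ a, IsSimpleRefl s a ∧ c a = c (a + 1)}) h5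
        rwa [← mul_assoc, hs.mul_self, one_mul] at h6
  · rw [Subgroup.closure_le]
    rintro s ⟨a, hs, h⟩
    exact hc.simpleRefl_mem hs h

/-- Such an element is determined by its displacements on one period, and each displacement lies
strictly between `-d` and `d`. -/
theorem IsColoring.fixer_finite (hc : IsColoring d c) (hd : 0 < d) :
    ((fixer d c : Subgroup (ExtWeyl d)) : Set (ExtWeyl d)).Finite := by
  have hd' : (0 : ℤ) < d := by exact_mod_cast hd
  let F : (fixer d c) → (Fin d → Set.Ioo (-d : ℤ) d) := fun w i =>
    ⟨w.1.1 (i : ℕ) - (i : ℕ), abs_lt.1 (hc.abs_sub_lt (w.2 _))⟩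
  have hF : Function.Injective F := by
    intro w w' h
    refine Subtype.ext (ext_apply fun t => ?_)
    have h1 := Int.emod_add_ediv_mul t d
    have h2 := Int.emod_nonneg t hd'.ne'
    have h3 := Int.emod_lt_of_pos t hd'
    have h4 := congrArg Subtype.val (congrFun h ⟨(t % d).toNat, by lia⟩)
    simp only [F, Int.toNat_of_nonneg h2] at h4
    rw [← h1, apply_add_mul, apply_add_mul]
    lia
  exact Set.finite_coe_iff.1 (Finite.of_injective F hF)

/-- Right multiplication of a shortest coset representative by a simple reflection either gives a
shortest coset representative or stays in the coset. -/
theorem IsColoring.incOn_mul_or (hc : IsColoring d c) {g s : ExtWeyl d} {a : ℤ} (hg : IncOn c g)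
    (hs : IsSimpleRefl s a) : IncOn c (g * s) ∨ g * s * g⁻¹ ∈ fixer d c := by
  by_contra hno
  push Not at hno
  obtain ⟨h1, h2⟩ := hno
  simp only [IncOn] at h1
  push Not at h1
  obtain ⟨p, q, hpq, hcpq, h3⟩ := h1
  rw [mul_inv_rev, hs.inv_eq, mul_apply, mul_apply] at h3
  -- A simple reflection reverses only the pairs it swaps. Hence `g⁻¹ p` and `g⁻¹ q` are swapped by
  -- `s`, and `g s g⁻¹` exchanges the translates of `p` and `q`, which have equal colors.
  have h4 : ∃ k : ℤ, g⁻¹.1 p = a + k * d ∧ g⁻¹.1 q = g⁻¹.1 p + 1 := by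
    by_contra h5
    push Not at h5
    exact absurd (hs.lt_of_lt (hg p q hpq hcpq) h5) (not_lt.2 h3)
  obtain ⟨k, h5, h6⟩ := h4
  have hp : ∀ j : ℤ, g.1 (a + j * d) = p + (j - k) * d := by
    intro j
    rw [show a + j * d = g⁻¹.1 p + (j - k) * d by rw [h5]; ring, apply_add_mul, apply_inv_self]
  have hq : ∀ j : ℤ, g.1 (a + 1 + j * d) = q + (j - k) * d := by
    intro j
    rw [show a + 1 + j * d = g⁻¹.1 q + (j - k) * d by rw [h6, h5]; ring, apply_add_mul,
      apply_inv_self]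
  apply h2
  intro t
  rw [mul_apply, mul_apply]
  rcases hs.cases (g⁻¹.1 t) with ⟨j, hj, e⟩ | ⟨j, hj, e⟩ | ⟨-, -, e⟩
  · have ht : t = p + (j - k) * d := by rw [← hp, ← hj, apply_inv_self]
    rw [e, hj, show a + j * d + 1 = a + 1 + j * d by ring, hq, ht]
    exact (hc.shift _ _ _ hcpq).symm
  · have ht : t = q + (j - k) * d := by rw [← hq, ← hj, apply_inv_self]
    rw [e, hj, show a + 1 + j * d - 1 = a + j * d by ring, hp, ht]
    exact hc.shift _ _ _ hcpq
  · rw [e, apply_inv_self]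

theorem IsColoring.of_equivariant {n : ℕ} (hn : 0 < n) {c : ℤ → ℤ} (hm : Monotone c)
    (h : ∀ t, c (t + d) = c t + n) : IsColoring d c where
  mono := hm
  shift := by
    have key : ∀ t k : ℤ, c (t + k * d) = c t + k * n := by
      intro t k
      induction k using Int.induction_on with
      | zero => simp
      | succ k ih =>
        rw [show t + ((k : ℤ) + 1) * d = t + k * d + d by ring, h, ih]; ring
      | pred k ih =>
        have := h (t + (-(k : ℤ) - 1) * d)
        rw [show t + (-(k : ℤ) - 1) * d + d = t + -k * d by ring, ih] at this
        linarith
    intro a b k hab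
    rw [key, key, hab]
  ne := by
    intro a hab
    rw [h] at hab
    lia

/-- Common refinements of colorings take values in a product order; this is why colors are only
required to form a partial order. -/
theorem IsColoring.prod [PartialOrder Q] {e : ℤ → Q} (hc : IsColoring d c) (he : IsColoring d e) :
    IsColoring d fun t => (c t, e t) where
  mono := fun _ _ h => ⟨hc.mono h, he.mono h⟩
  shift := fun a b k h => by
    rw [Prod.mk.injEq] at h
    rw [hc.shift a b k h.1, he.shift a b k h.2]
  ne := fun a h => hc.ne a (Prod.mk.inj h).1

theorem IsColoring.translate (hc : IsColoring d c) (z : ℤ) : IsColoring d fun t => c (t - z) where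
  mono := fun _ _ h => hc.mono (by lia)
  shift := fun a b k h => by
    rw [show a + k * d - z = a - z + k * d by ring, show b + k * d - z = b - z + k * d by ring]
    exact hc.shift _ _ k h
  ne := fun a h => hc.ne (a - z) (by rwa [show a - z + d = a + d - z by ring])

theorem mem_fixer_translate {R : Type*} {c : ℤ → R} {w : ExtWeyl d} (z : ℤ) :
    w ∈ fixer d (fun t => c (t - z)) ↔ (rot d ^ z)⁻¹ * w * rot d ^ z ∈ fixer d c := by
  have e : ∀ t, ((rot d ^ z)⁻¹ * w * rot d ^ z).1 t = w.1 (t + z) - z := by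
    intro t
    rw [mul_apply, mul_apply, rot_zpow_apply, ← zpow_neg, rot_zpow_apply, sub_eq_add_neg]
  constructor
  · intro h t
    rw [e]
    have := h (t + z)
    simpa using this
  · intro h t
    have := h (t - z)
    rw [e] at this
    simpa using this

end Coloring

/-! ### The coloring of a composition -/

section Comp

variable {n d : ℕ}

theorem Comp.psum_mul_add (hn : 0 < n) (l : Comp n d) (q : ℤ) {r : ℕ} (hr : r ≤ n) :
    l.psum (q * n + r) = q * d + ∑ k : Fin n, if (k : ℕ) < r then (l.1 k : ℤ) else 0 := by
  have hn' : (0 : ℤ) < n := by exact_mod_cast hn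
  rcases hr.lt_or_eq with h | rfl
  · have h1 : (q * n + r) / (n : ℤ) = q := by
      rw [add_comm, Int.add_mul_ediv_right _ _ hn'.ne', Int.ediv_eq_zero_of_lt (by lia) (by lia),
        zero_add]
    have h2 : (q * n + r) % (n : ℤ) = r := by
      rw [add_comm, Int.add_mul_emod_self_right, Int.emod_eq_of_lt (by lia) (by lia)]
    rw [Comp.psum, h1, h2]
    simp only [Nat.cast_lt]
  · have h1 : (q * r + r) / (r : ℤ) = q + 1 := by
      rw [← add_one_mul, Int.mul_ediv_cancel _ hn'.ne']
    have h2 : (q * r + r) % (r : ℤ) = 0 := by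
      rw [← add_one_mul, Int.mul_emod_left]
    rw [Comp.psum, h1, h2]
    have h3 : ∑ k : Fin r, (if (k : ℕ) < r then (l.1 k : ℤ) else 0) = d := by
      simp only [Fin.is_lt, if_true]
      exact_mod_cast l.2
    have h4 : ∑ k : Fin r, (if ((k : ℕ) : ℤ) < 0 then (l.1 k : ℤ) else 0) = 0 :=
      Finset.sum_eq_zero fun k _ => if_neg (by lia)
    rw [h3, h4]; ring

theorem Comp.psum_zero (hn : 0 < n) (l : Comp n d) : l.psum 0 = 0 := by
  have := l.psum_mul_add hn 0 (Nat.zero_le n)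
  simpa using this

theorem Comp.psum_add (hn : 0 < n) (l : Comp n d) (m : ℤ) : l.psum (m + n) = l.psum m + d := by
  have hn' : (0 : ℤ) < n := by exact_mod_cast hn
  rw [Comp.psum, Comp.psum, Int.add_emod_right]
  have h1 : (m + n) / (n : ℤ) = m / n + 1 := by
    rw [Int.add_ediv_of_dvd_right (dvd_refl _), Int.ediv_self hn'.ne']
  rw [h1]; ring

theorem Comp.psum_mul (hn : 0 < n) (l : Comp n d) (q : ℤ) : l.psum (q * n) = q * d := by
  have := l.psum_mul_add hn q (Nat.zero_le n)
  simpa using this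

theorem Comp.psum_sub (hn : 0 < n) (l : Comp n d) (q : ℤ) (k : Fin n) :
    l.psum (q * n + k + 1) = l.psum (q * n + k) + l.1 k := by
  have h1 := l.psum_mul_add hn q k.2.le
  have h2 := l.psum_mul_add hn q (Nat.succ_le_of_lt k.2)
  rw [Nat.cast_succ, ← add_assoc] at h2
  rw [h1, h2, add_assoc, ← Finset.add_sum_erase _ _ (Finset.mem_univ k),
    ← Finset.add_sum_erase (a := k) Finset.univ
      (fun j : Fin n => if (j : ℕ) < k then (l.1 j : ℤ) else 0) (Finset.mem_univ k)]
  have : ∑ j ∈ Finset.univ.erase k, (if (j : ℕ) < (k : ℕ) + 1 then (l.1 j : ℤ) else 0) =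
      ∑ j ∈ Finset.univ.erase k, (if (j : ℕ) < k then (l.1 j : ℤ) else 0) := by
    refine Finset.sum_congr rfl fun j hj => ?_
    have hne : (j : ℕ) ≠ k := fun h => (Finset.mem_erase.1 hj).1 (Fin.ext h)
    have : (j : ℕ) < (k : ℕ) + 1 ↔ (j : ℕ) < k := by omega
    simp only [this]
  simp only [Nat.succ_eq_add_one, this, if_pos (Nat.lt_succ_self _), lt_irrefl, if_false]
  ring

theorem exists_eq_mul_add (hn : 0 < n) (m : ℤ) : ∃ (q : ℤ) (k : Fin n), m = q * n + k + 1 := by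
  have hn' : (0 : ℤ) < n := by exact_mod_cast hn
  have h1 := Int.emod_add_ediv_mul (m - 1) n
  have h2 := Int.emod_nonneg (m - 1) hn'.ne'
  have h3 := Int.emod_lt_of_pos (m - 1) hn'
  refine ⟨(m - 1) / n, ⟨((m - 1) % n).toNat, by lia⟩, ?_⟩
  simp only [Int.toNat_of_nonneg h2]
  linarith

theorem Comp.psum_mono (hn : 0 < n) (l : Comp n d) : Monotone l.psum := by
  refine monotone_int_of_le_succ fun m => ?_
  obtain ⟨q, k, hk⟩ := exists_eq_mul_add hn (m + 1)
  have := l.psum_sub hn q k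
  rw [hk, this, show m = q * n + k by linarith]
  lia

/-- The index `i` with `t ∈ R_i^λ`. -/
def Comp.color (l : Comp n d) (t : ℤ) : ℤ := sInf {i | t ≤ l.psum i}

/-- The Galois connection between `color` and `psum`. The infimum is attained since `psum (q n) = q
d` is unbounded in both directions. -/
theorem Comp.color_le_iff (hn : 0 < n) (hd : 0 < d) (l : Comp n d) {t i : ℤ} :
    l.color t ≤ i ↔ t ≤ l.psum i := by
  have hd' : (0 : ℤ) < d := by exact_mod_cast hd
  have hne : {i | t ≤ l.psum i}.Nonempty :=
    ⟨|t| * n, by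
      rw [Set.mem_ofPred_eq, l.psum_mul hn]
      nlinarith [abs_nonneg t, le_abs_self t]⟩
  have hb : BddBelow {i | t ≤ l.psum i} := by
    refine ⟨-(|t| + 1) * n, fun i hi => ?_⟩
    by_contra hlt
    have h1 : t ≤ l.psum i := hi
    have h2 := l.psum_mono hn (not_le.1 hlt).le
    rw [l.psum_mul hn] at h2
    nlinarith [neg_abs_le t, abs_nonneg t]
  constructor
  · intro h
    have h1 : t ≤ l.psum (l.color t) := Int.csInf_mem hne hb
    exact h1.trans (l.psum_mono hn h)
  · intro h
    exact csInf_le hb h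

theorem Comp.lt_color_iff (hn : 0 < n) (hd : 0 < d) (l : Comp n d) {t i : ℤ} :
    i < l.color t ↔ l.psum i < t := by
  rw [← not_le, l.color_le_iff hn hd, not_le]

theorem Comp.mem_interval_iff (hn : 0 < n) (hd : 0 < d) (l : Comp n d) {t i : ℤ} :
    t ∈ l.interval i ↔ l.color t = i := by
  rw [Comp.interval, Set.mem_Ioc, ← l.lt_color_iff hn hd, ← l.color_le_iff hn hd]
  lia

theorem Comp.color_mono (hn : 0 < n) (hd : 0 < d) (l : Comp n d) : Monotone l.color := by
  intro a b h
  rw [l.color_le_iff hn hd]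
  exact h.trans ((l.color_le_iff hn hd).1 le_rfl)

theorem Comp.color_add (hn : 0 < n) (hd : 0 < d) (l : Comp n d) (t : ℤ) :
    l.color (t + d) = l.color t + n := by
  have key : ∀ i, l.color (t + d) ≤ i + n ↔ l.color t ≤ i := by
    intro i
    rw [l.color_le_iff hn hd, l.color_le_iff hn hd, l.psum_add hn]
    lia
  apply le_antisymm
  · exact (key _).2 le_rfl
  · have := (key (l.color (t + d) - n)).1 (by lia)
    lia

theorem Comp.isColoring (hn : 0 < n) (hd : 0 < d) (l : Comp n d) : IsColoring d l.color :=
  IsColoring.of_equivariant hn (l.color_mono hn hd) (l.color_add hn hd)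

/-- The reflection at `i` preserves the coloring exactly when `i` and `i + 1` have the same color,
that is, when `i` is not a partial sum. Reflections at arbitrary positions are translated into the
range `1 ≤ i ≤ d`. -/
theorem parabolic_eq_fixer (hn : 0 < n) (hd : 0 < d) (l : Comp n d) :
    parabolic l = fixer d l.color := by
  have hd' : (0 : ℤ) < d := by exact_mod_cast hd
  have hc := l.isColoring hn hd
  have hpn : l.psum n = d := by simpa using l.psum_mul hn 1
  apply le_antisymm
  · rw [parabolic, Subgroup.closure_le]
    rintro s ⟨i, h1, h2, hs, h3⟩
    refine hc.simpleRefl_mem hs (le_antisymm (hc.mono (by lia)) ?_)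
    rw [l.color_le_iff hn hd]
    have h4 : i ≤ l.psum (l.color i) := (l.color_le_iff hn hd).1 le_rfl
    have h5 : 0 < l.color i := by rw [l.lt_color_iff hn hd, l.psum_zero hn]; lia
    have h6 : l.color i ≤ n := by rw [l.color_le_iff hn hd, hpn]; exact h2
    have := h3 (l.color i) (by lia) h6
    lia
  · rw [hc.fixer_eq_closure hd, Subgroup.closure_le]
    rintro s ⟨a, hs, h⟩
    apply Subgroup.subset_closure
    have h1 := Int.emod_add_ediv_mul (a - 1) d
    have h2 := Int.emod_nonneg (a - 1) hd'.ne'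
    have h3 := Int.emod_lt_of_pos (a - 1) hd'
    have e : a + -((a - 1) / d) * d = (a - 1) % d + 1 := by linarith
    have hs' := hs.shift (-((a - 1) / d))
    have hcol := hc.shift _ _ (-((a - 1) / d)) h
    rw [show a + 1 + -((a - 1) / d) * d = a + -((a - 1) / d) * d + 1 by ring, e] at hcol
    rw [e] at hs'
    refine ⟨(a - 1) % d + 1, by lia, by lia, hs', fun m _ _ hm => ?_⟩
    have h4 : l.color ((a - 1) % d + 1) ≤ m := by rw [l.color_le_iff hn hd]; exact hm.le
    rw [hcol, l.color_le_iff hn hd] at h4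
    lia

theorem mem_distinguished_iff (hn : 0 < n) (hd : 0 < d) (l : Comp n d) {g : ExtWeyl d} :
    g ∈ distinguished l ↔ IncOn l.color g := by
  have hc := l.isColoring hn hd
  constructor
  · intro h
    by_contra hi
    obtain ⟨a, s, hs, h1, h2, h3, h4⟩ := hc.exists_simpleRefl hd hi
    have := h s (by rwa [parabolic_eq_fixer hn hd])
    rw [length_simpleRefl hd hs] at this
    lia
  · intro h w hw
    rw [parabolic_eq_fixer hn hd] at hw
    exact hc.length_mul hd hw h

end Comp

/-! ### Equivariant functions and their matrices -/

section Equivariant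

variable {n d : ℕ}

/-- Functions `c` on `ℤ` with `c (t + d) = c t + n`. -/
abbrev EquivFun (n d : ℕ) : Type := {c : ℤ → ℤ // ∀ t, c (t + d) = c t + n}

theorem EquivFun.apply_add_mul (c : EquivFun n d) (t k : ℤ) : c.1 (t + k * d) = c.1 t + k * n := by
  induction k using Int.induction_on with
  | zero => simp
  | succ k ih =>
    rw [show t + ((k : ℤ) + 1) * d = t + k * d + d by ring, c.2, ih]; ring
  | pred k ih =>
    have := c.2 (t + (-(k : ℤ) - 1) * d)
    rw [show t + (-(k : ℤ) - 1) * d + d = t + -k * d by ring, ih] at this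
    linarith

/-- `d c(t) - n t` is periodic. All finiteness statements about fibres and bandwidths rest on this
closeness to the line of slope `n / d`. -/
theorem EquivFun.exists_bound (hd : 0 < d) (c : EquivFun n d) :
    ∃ C : ℤ, ∀ t, |d * c.1 t - n * t| ≤ C := by
  obtain ⟨C, hC⟩ := ((Finset.Ico (0 : ℤ) d).image fun t => |d * c.1 t - n * t|).bddAbove
  refine ⟨C, fun t => ?_⟩
  have hd' : (0 : ℤ) < d := by exact_mod_cast hd
  have h1 := c.apply_add_mul (t % d) (t / d)
  have h2 : t % d + t / d * d = t := Int.emod_add_ediv_mul t d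
  rw [h2] at h1
  have : d * c.1 t - n * t = d * c.1 (t % d) - n * (t % d) := by
    rw [h1]; linear_combination (-(n : ℤ)) * h2.symm
  rw [this]
  apply hC
  simp only [Finset.coe_image, Set.mem_image, Finset.coe_Ico, Set.mem_Ico]
  exact ⟨t % d, ⟨Int.emod_nonneg _ hd'.ne', Int.emod_lt_of_pos _ hd'⟩, rfl⟩

theorem EquivFun.finite_le_le (hn : 0 < n) (hd : 0 < d) (c e : EquivFun n d) (i j : ℤ) :
    {t | c.1 t ≤ i ∧ j ≤ e.1 t}.Finite := by
  have hn' : (1 : ℤ) ≤ n := by exact_mod_cast hn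
  have hd' : (1 : ℤ) ≤ d := by exact_mod_cast hd
  obtain ⟨C, hC⟩ := c.exists_bound hd
  obtain ⟨E, hE⟩ := e.exists_bound hd
  refine (Set.finite_Icc (-(|d * j| + |E|)) (|d * i| + |C|)).subset fun t ht => ?_
  have h1 := abs_le.1 (hC t)
  have h2 := abs_le.1 (hE t)
  have h3 : (d : ℤ) * c.1 t ≤ d * i := by nlinarith [ht.1]
  have h4 : (d : ℤ) * j ≤ d * e.1 t := by nlinarith [ht.2]
  have h5 : (n : ℤ) * t ≤ |d * i| + |C| := by
    have := le_abs_self (d * i : ℤ); have := le_abs_self C; linarith [h1.1]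
  have h6 : -(|d * j| + |E|) ≤ (n : ℤ) * t := by
    have := neg_abs_le (d * j : ℤ); have := le_abs_self E; linarith [h2.2]
  have h7 : 0 ≤ |d * i| + |C| := by positivity
  have h8 : 0 ≤ |d * j| + |E| := by positivity
  constructor
  · by_contra hlt
    rw [not_le] at hlt
    nlinarith
  · by_contra hlt
    rw [not_le] at hlt
    nlinarith

theorem EquivFun.finite_eq (hn : 0 < n) (hd : 0 < d) (c : EquivFun n d) (i : ℤ) :
    {t | c.1 t = i}.Finite :=
  (c.finite_le_le hn hd c i i).subset fun _ h => ⟨le_of_eq h, ge_of_eq h⟩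

/-- Counting a finite set by the values of a function. -/
theorem finsum_ncard_fiber {α β : Type*} {S : Set α} (hS : S.Finite) (f : α → β) :
    ∑ᶠ b, {t | t ∈ S ∧ f t = b}.ncard = S.ncard := by
  classical
  have hsub : (Function.support fun b => {t | t ∈ S ∧ f t = b}.ncard) ⊆
      (hS.toFinset.image f : Finset β) := by
    intro b hb
    rw [Function.mem_support] at hb
    obtain ⟨t, ht⟩ := Set.nonempty_of_ncard_ne_zero hb
    simp only [Finset.coe_image, Set.Finite.coe_toFinset, Set.mem_image]
    exact ⟨t, ht.1, ht.2⟩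
  rw [finsum_eq_sum_of_support_subset _ hsub, Set.ncard_eq_toFinset_card S hS,
    Finset.card_eq_sum_card_image f]
  refine Finset.sum_congr rfl fun b _ => ?_
  rw [← Set.ncard_coe_finset]
  congr 1
  ext t
  simp

theorem finsum_ite_ncard {α β : Type*} (f : α → β) (Q : β → Prop) [DecidablePred Q]
    (hS : {t | Q (f t)}.Finite) :
    ∑ᶠ b, (if Q b then {t | f t = b}.ncard else 0) = {t | Q (f t)}.ncard := by
  rw [← finsum_ncard_fiber hS f]
  refine finsum_congr fun b => ?_
  split_ifs with h
  · congr 1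
    ext t
    simp only [Set.mem_ofPred_eq]
    exact ⟨fun ht => ⟨by rwa [ht], ht⟩, fun ht => ht.2⟩
  · symm
    have : {t | t ∈ {t | Q (f t)} ∧ f t = b} = ∅ := by
      ext t
      simp only [Set.mem_ofPred_eq, Set.mem_empty_iff_false, iff_false]
      rintro ⟨h1, rfl⟩
      exact h h1
    rw [this, Set.ncard_empty]

/-- Together with `image_period`: the window `1 ≤ c t ≤ n` and the interval `0 ≤ t < d` are both
transversals of `ℤ / d`. -/
theorem EquivFun.injOn_period (c : EquivFun n d) :
    Set.InjOn (fun t : ℤ => t % d) {t | 1 ≤ c.1 t ∧ c.1 t ≤ n} := by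
  intro a ha b hb h
  obtain ⟨k, hk⟩ := (show a ≡ b [ZMOD d] from h).dvd
  have hb' : b = a + k * d := by linarith
  have := c.apply_add_mul a k
  rw [← hb'] at this
  obtain ⟨h1, h2⟩ := ha
  obtain ⟨h3, h4⟩ := hb
  rcases lt_trichotomy k 0 with h | h | h
  · nlinarith
  · subst h; linarith
  · nlinarith

theorem EquivFun.image_period (hn : 0 < n) (hd : 0 < d) (c : EquivFun n d) :
    (fun t : ℤ => t % d) '' {t | 1 ≤ c.1 t ∧ c.1 t ≤ n} = Finset.Ico (0 : ℤ) d := by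
  have hn' : (0 : ℤ) < n := by exact_mod_cast hn
  have hd' : (0 : ℤ) < d := by exact_mod_cast hd
  ext r
  simp only [Set.mem_image, Finset.coe_Ico, Set.mem_Ico]
  constructor
  · rintro ⟨t, -, rfl⟩
    exact ⟨Int.emod_nonneg _ hd'.ne', Int.emod_lt_of_pos _ hd'⟩
  · rintro ⟨h1, h2⟩
    have h3 := Int.emod_add_ediv_mul (c.1 r - 1) n
    have h4 := Int.emod_nonneg (c.1 r - 1) hn'.ne'
    have h5 := Int.emod_lt_of_pos (c.1 r - 1) hn'
    have h6 := c.apply_add_mul r (-((c.1 r - 1) / n))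
    refine ⟨r + -((c.1 r - 1) / n) * d, ⟨?_, ?_⟩, ?_⟩
    · rw [h6]; linarith
    · rw [h6]; linarith
    · rw [Int.add_mul_emod_self_right, Int.emod_eq_of_lt h1 h2]

theorem EquivFun.ncard_period (hn : 0 < n) (hd : 0 < d) (c : EquivFun n d) :
    {t | 1 ≤ c.1 t ∧ c.1 t ≤ n}.ncard = d := by
  rw [← c.injOn_period.ncard_image, c.image_period hn hd, Set.ncard_coe_finset]
  simp

theorem EquivFun.sum_ncard (hn : 0 < n) (hd : 0 < d) (c : EquivFun n d) :
    ∑ i ∈ Finset.Icc (1 : ℤ) n, {t | c.1 t = i}.ncard = d := by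
  have hfin : {t | 1 ≤ c.1 t ∧ c.1 t ≤ n}.Finite :=
    (c.finite_le_le hn hd c n 1).subset fun t h => ⟨h.2, h.1⟩
  have h1 := finsum_ite_ncard c.1 (fun i => 1 ≤ i ∧ i ≤ (n : ℤ)) hfin
  rw [c.ncard_period hn hd] at h1
  refine Eq.trans ?_ h1
  rw [finsum_eq_sum_of_support_subset (s := Finset.Icc (1 : ℤ) n)]
  · refine Finset.sum_congr rfl fun i hi => ?_
    rw [if_pos (Finset.mem_Icc.1 hi)]
  · intro i hi
    by_contra h
    rw [Function.mem_support, if_neg (by simpa using h)] at hi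
    exact hi rfl

theorem EquivFun.ncard_pair_add (c e : EquivFun n d) (i j : ℤ) :
    {t | c.1 t = i + n ∧ e.1 t = j + n}.ncard = {t | c.1 t = i ∧ e.1 t = j}.ncard := by
  have : {t | c.1 t = i + n ∧ e.1 t = j + n} =
      (fun t => t + (d : ℤ)) '' {t | c.1 t = i ∧ e.1 t = j} := by
    ext t
    simp only [Set.mem_ofPred_eq, Set.mem_image]
    constructor
    · rintro ⟨h1, h2⟩
      have h3 := c.2 (t - d)
      have h4 := e.2 (t - d)
      rw [sub_add_cancel] at h3 h4
      exact ⟨t - d, ⟨by lia, by lia⟩, by ring⟩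
    · rintro ⟨u, ⟨h1, h2⟩, rfl⟩
      rw [c.2, e.2, h1, h2]
      exact ⟨rfl, rfl⟩
  rw [this, Set.ncard_image_of_injective _ (add_left_injective _)]

theorem EquivFun.ncard_add (c : EquivFun n d) (i : ℤ) :
    {t | c.1 t = i + n}.ncard = {t | c.1 t = i}.ncard := by
  simpa using c.ncard_pair_add c i i

/-- The matrix that counts the integers with given values of two equivariant functions. -/
def matOf (hn : 0 < n) (hd : 0 < d) (c e : EquivFun n d) : Theta n d where
  entry i j := {t | c.1 t = i ∧ e.1 t = j}.ncard
  periodic := c.ncard_pair_add e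
  finite i := by
    refine ((c.finite_eq hn hd i).image e.1).subset fun j hj => ?_
    obtain ⟨t, ht⟩ := Set.nonempty_of_ncard_ne_zero (Function.mem_support.1 hj)
    exact ⟨t, ht.1, ht.2⟩
  total := by
    refine Eq.trans ?_ (c.sum_ncard hn hd)
    exact Finset.sum_congr rfl fun i _ => finsum_ncard_fiber (c.finite_eq hn hd i) e.1

theorem matOf_entry (hn : 0 < n) (hd : 0 < d) (c e : EquivFun n d) (i j : ℤ) :
    (matOf hn hd c e).entry i j = {t | c.1 t = i ∧ e.1 t = j}.ncard := rfl

theorem matOf_ro (hn : 0 < n) (hd : 0 < d) (c e : EquivFun n d) (i : ℤ) :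
    (matOf hn hd c e).ro i = {t | c.1 t = i}.ncard :=
  finsum_ncard_fiber (c.finite_eq hn hd i) e.1

theorem matOf_co (hn : 0 < n) (hd : 0 < d) (c e : EquivFun n d) (j : ℤ) :
    (matOf hn hd c e).co j = {t | e.1 t = j}.ncard := by
  rw [← finsum_ncard_fiber (e.finite_eq hn hd j) c.1]
  refine finsum_congr fun i => ?_
  rw [matOf_entry]
  congr 1
  ext t
  exact and_comm

theorem matOf_sigma_of_lt (hn : 0 < n) (hd : 0 < d) (c e : EquivFun n d) {i j : ℤ} (h : i < j) :
    (matOf hn hd c e).sigma i j = {t | c.1 t ≤ i ∧ j ≤ e.1 t}.ncard := by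
  rw [Theta.sigma, if_pos h]
  have := finsum_ite_ncard (fun t => (c.1 t, e.1 t)) (fun p : ℤ × ℤ => p.1 ≤ i ∧ j ≤ p.2)
    (c.finite_le_le hn hd e i j)
  rw [← this]
  refine finsum_congr fun p => ?_
  simp only [matOf_entry, Prod.ext_iff]

theorem matOf_sigma_of_gt (hn : 0 < n) (hd : 0 < d) (c e : EquivFun n d) {i j : ℤ} (h : j < i) :
    (matOf hn hd c e).sigma i j = {t | i ≤ c.1 t ∧ e.1 t ≤ j}.ncard := by
  rw [Theta.sigma, if_neg (not_lt.2 h.le)]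
  have := finsum_ite_ncard (fun t => (c.1 t, e.1 t)) (fun p : ℤ × ℤ => i ≤ p.1 ∧ p.2 ≤ j)
    ((e.finite_le_le hn hd c j i).subset fun t ht => ⟨ht.2, ht.1⟩)
  rw [← this]
  refine finsum_congr fun p => ?_
  simp only [matOf_entry, Prod.ext_iff]

/-- The action of the Weyl group on equivariant functions. -/
def EquivFun.act (g : ExtWeyl d) (c : EquivFun n d) : EquivFun n d :=
  ⟨fun t => c.1 (g⁻¹.1 t), fun t => by beta_reduce; rw [apply_add, c.2]⟩

theorem EquivFun.act_apply (g : ExtWeyl d) (c : EquivFun n d) (t : ℤ) :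
    (c.act g).1 t = c.1 (g⁻¹.1 t) := rfl

theorem EquivFun.act_mul (g h : ExtWeyl d) (c : EquivFun n d) : c.act (g * h) = (c.act h).act g :=
  Subtype.ext <| funext fun t => by
    rw [act_apply, act_apply, act_apply, mul_inv_rev, mul_apply]

theorem EquivFun.act_of_mem_fixer {w : ExtWeyl d} {c : EquivFun n d} (h : w ∈ fixer d c.1) :
    c.act w = c :=
  Subtype.ext <| funext fun t => inv_apply_of_mem_fixer h t

theorem EquivFun.mem_fixer_iff {w : ExtWeyl d} {c : EquivFun n d} :
    w ∈ fixer d c.1 ↔ c.act w = c := by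
  refine ⟨act_of_mem_fixer, fun h t => ?_⟩
  have := congrArg (fun e => e.1 (w.1 t)) h
  simp only [act_apply, inv_apply_self] at this
  exact this.symm

theorem matOf_act (hn : 0 < n) (hd : 0 < d) (w : ExtWeyl d) (c e : EquivFun n d) :
    matOf hn hd (c.act w) (e.act w) = matOf hn hd c e := by
  ext i j
  rw [matOf_entry, matOf_entry]
  have : {t | (c.act w).1 t = i ∧ (e.act w).1 t = j} = w.1 '' {t | c.1 t = i ∧ e.1 t = j} := by
    ext t
    simp only [Set.mem_ofPred_eq, Set.mem_image, EquivFun.act_apply]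
    constructor
    · intro h; exact ⟨_, h, apply_inv_self w t⟩
    · rintro ⟨u, hu, rfl⟩
      rwa [inv_apply_self]
  rw [this, Set.ncard_image_of_injective _ w.1.injective]

end Equivariant

/-! ### Equivariant bijections -/

section Bijection

theorem color_zpow {S K : Type*} (τ : Equiv.Perm S) (σ : Equiv.Perm K) (C : S → K)
    (hC : ∀ s, C (τ s) = σ (C s)) (k : ℤ) (s : S) : C ((τ ^ k) s) = (σ ^ k) (C s) := by
  induction k using Int.induction_on with
  | zero => simp
  | succ k ih =>
    rw [zpow_add_one, (Commute.zpow_self τ k).eq, Equiv.Perm.mul_apply, hC, ih, zpow_add_one,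
      (Commute.zpow_self σ k).eq, Equiv.Perm.mul_apply]
  | pred k ih =>
    have := hC ((τ ^ (-(k : ℤ) - 1)) s)
    rw [← Equiv.Perm.mul_apply, ← zpow_one_add, add_sub_cancel, ih] at this
    apply σ.injective
    rw [← this, ← Equiv.Perm.mul_apply, ← zpow_one_add, add_sub_cancel]

theorem height_zpow {S : Type*} (τ : Equiv.Perm S) (ht : S → ℤ) (h : ∀ s, ht (τ s) = ht s + 1)
    (k : ℤ) (s : S) : ht ((τ ^ k) s) = ht s + k := by
  -- The height is a coloring with values in `ℤ`, on which the generator acts as the translation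
  -- `rot 1`.
  rw [color_zpow τ (rot 1).1 ht h, ← Subgroup.coe_zpow]
  exact rot_zpow_apply k (ht s)

/-- A set with a free action of `ℤ` is the product of `ℤ` with the elements of height zero. -/
def heightEquiv {S : Type*} (τ : Equiv.Perm S) (ht : S → ℤ) (h : ∀ s, ht (τ s) = ht s + 1) :
    S ≃ ℤ × {s // ht s = 0} where
  toFun s := (ht s, ⟨(τ ^ (-ht s)) s, by
    rw [height_zpow τ ht h]; ring⟩)
  invFun p := (τ ^ p.1) p.2.1
  left_inv s := by
    change (τ ^ ht s) ((τ ^ (-ht s)) s) = s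
    rw [← Equiv.Perm.mul_apply, ← zpow_add, add_neg_cancel, zpow_zero, Equiv.Perm.one_apply]
  right_inv := by
    rintro ⟨k, s, hs⟩
    have e : ht ((τ ^ k) s) = k := by rw [height_zpow τ ht h, hs, zero_add]
    refine Prod.ext e (Subtype.ext ?_)
    change (τ ^ (-ht ((τ ^ k) s))) ((τ ^ k) s) = s
    rw [e, ← Equiv.Perm.mul_apply, ← zpow_add, neg_add_cancel, zpow_zero, Equiv.Perm.one_apply]

theorem heightEquiv_shift {S : Type*} (τ : Equiv.Perm S) (ht : S → ℤ)
    (h : ∀ s, ht (τ s) = ht s + 1) (s : S) :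
    heightEquiv τ ht h (τ s) = ((heightEquiv τ ht h s).1 + 1, (heightEquiv τ ht h s).2) := by
  refine Prod.ext (h s) (Subtype.ext ?_)
  change (τ ^ (-ht (τ s))) (τ s) = (τ ^ (-ht s)) s
  rw [h, ← Equiv.Perm.mul_apply, ← zpow_add_one]
  congr 2
  ring

/-- Two sets with free actions of `ℤ` and equivariant colorings are isomorphic as soon as the
fibres of height zero are equinumerous. -/
theorem exists_equivariant_equiv {S S' K : Type*} (τ : Equiv.Perm S) (τ' : Equiv.Perm S')
    (σ : Equiv.Perm K) (ht : K → ℤ) (hht : ∀ k, ht (σ k) = ht k + 1) (C : S → K) (C' : S' → K)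
    (hC : ∀ s, C (τ s) = σ (C s)) (hC' : ∀ s, C' (τ' s) = σ (C' s))
    (hcard : ∀ k, ht k = 0 → Nonempty ({s // C s = k} ≃ {s // C' s = k})) :
    ∃ f : S ≃ S', (∀ s, f (τ s) = τ' (f s)) ∧ ∀ s, C' (f s) = C s := by
  have h : ∀ s, ht (C (τ s)) = ht (C s) + 1 := fun s => by rw [hC, hht]
  have h' : ∀ s, ht (C' (τ' s)) = ht (C' s) + 1 := fun s => by rw [hC', hht]
  choose F hF using fun k (hk : ht k = 0) => (⟨(hcard k hk).some, trivial⟩ :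
    ∃ _ : {s // C s = k} ≃ {s // C' s = k}, True)
  -- The fibrewise bijections are glued over all colors of height zero. The auxiliary `key`
  -- statements let the color vary, so that equalities of colors can be substituted.
  let G : {s // ht (C s) = 0} ≃ {s // ht (C' s) = 0} :=
    { toFun := fun s => ⟨(F (C s.1) s.2 ⟨s.1, rfl⟩).1, by
        rw [(F (C s.1) s.2 ⟨s.1, rfl⟩).2]; exact s.2⟩
      invFun := fun s => ⟨((F (C' s.1) s.2).symm ⟨s.1, rfl⟩).1, by
        rw [((F (C' s.1) s.2).symm ⟨s.1, rfl⟩).2]; exact s.2⟩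
      left_inv := by
        rintro ⟨s, hs⟩
        apply Subtype.ext
        have key : ∀ k (hk : ht k = 0) (e : C s = k) (x : {s // C' s = k}),
            x = F k hk ⟨s, e⟩ → ((F k hk).symm x).1 = s := by
          rintro k hk e x rfl
          rw [Equiv.symm_apply_apply]
        have e := (F (C s) hs ⟨s, rfl⟩).2
        refine key _ _ e.symm _ ?_
        apply Subtype.ext
        have key2 : ∀ k (hk : ht k = 0) (e : C s = k),
            (F k hk ⟨s, e⟩).1 = (F (C s) hs ⟨s, rfl⟩).1 := by
          rintro k hk rfl; rfl
        exact (key2 _ _ _).symm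
      right_inv := by
        rintro ⟨s, hs⟩
        apply Subtype.ext
        have key : ∀ k (hk : ht k = 0) (e : C' s = k) (x : {s // C s = k}),
            x = (F k hk).symm ⟨s, e⟩ → ((F k hk) x).1 = s := by
          rintro k hk e x rfl
          rw [Equiv.apply_symm_apply]
        have e := ((F (C' s) hs).symm ⟨s, rfl⟩).2
        refine key _ _ e.symm _ ?_
        apply Subtype.ext
        have key2 : ∀ k (hk : ht k = 0) (e : C' s = k),
            ((F k hk).symm ⟨s, e⟩).1 = ((F (C' s) hs).symm ⟨s, rfl⟩).1 := by
          rintro k hk rfl; rfl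
        exact (key2 _ _ _).symm }
  have hG : ∀ s, C' (G s).1 = C s.1 := fun s => (F (C s.1) s.2 ⟨s.1, rfl⟩).2
  let E := heightEquiv τ (fun s => ht (C s)) h
  let E' := heightEquiv τ' (fun s => ht (C' s)) h'
  -- The bijection at height zero is extended along the free orbits.
  let f : S ≃ S' := E.trans (((Equiv.refl ℤ).prodCongr G).trans E'.symm)
  have hf : ∀ s, f s = E'.symm ((E s).1, G (E s).2) := fun s => rfl
  have hshift : ∀ s, f (τ s) = τ' (f s) := by
    intro s
    apply E'.injective
    rw [heightEquiv_shift τ' _ h' (f s)]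
    change E' (f (τ s)) = ((E' (f s)).1 + 1, (E' (f s)).2)
    rw [hf, hf, Equiv.apply_symm_apply, Equiv.apply_symm_apply]
    have : E (τ s) = ((E s).1 + 1, (E s).2) := heightEquiv_shift τ _ h s
    rw [this]
  refine ⟨f, hshift, fun s => ?_⟩
  have e1 : f s = (τ' ^ (ht (C s))) (G (E s).2).1 := rfl
  have e2 : ((E s).2).1 = (τ ^ (-ht (C s))) s := rfl
  rw [e1, color_zpow τ' σ C' hC', hG, e2, color_zpow τ σ C hC, ← Equiv.Perm.mul_apply, ← zpow_add, add_neg_cancel, zpow_zero,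
    Equiv.Perm.one_apply]

end Bijection

/-! ### Realization of matrices -/

section Realization

variable {n d : ℕ}

/-- Bijections of finite sets with the same number of elements. -/
theorem nonempty_equiv_of_ncard_eq {α β : Type*} {S : Set α} {S' : Set β} (hS : S.Finite)
    (hS' : S'.Finite) (h : S.ncard = S'.ncard) : Nonempty (S ≃ S') := by
  have := hS.to_subtype
  have := hS'.to_subtype
  exact Finite.card_eq.1 (by rwa [Nat.card_coe_set_eq, Nat.card_coe_set_eq])

theorem add_ediv_self (hn : 0 < n) (i : ℤ) : (i + n) / (n : ℤ) = i / n + 1 := by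
  have hn' : (0 : ℤ) < n := by exact_mod_cast hn
  rw [Int.add_ediv_of_dvd_right (dvd_refl _), Int.ediv_self hn'.ne']

/-- An equivariant function is determined up to the Weyl group by the sizes of its fibres. -/
theorem EquivFun.exists_act (hn : 0 < n) (hd : 0 < d) (c e : EquivFun n d)
    (h : ∀ i, {t | c.1 t = i}.ncard = {t | e.1 t = i}.ncard) : ∃ g : ExtWeyl d, c.act g = e := by
  obtain ⟨f, hf1, hf2⟩ := exists_equivariant_equiv (Equiv.addRight (d : ℤ)) (Equiv.addRight (d : ℤ))
    (Equiv.addRight (n : ℤ)) (fun i => i / n) (fun i => add_ediv_self hn i) c.1 e.1 c.2 e.2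
    (fun i _ => nonempty_equiv_of_ncard_eq (c.finite_eq hn hd i) (e.finite_eq hn hd i) (h i))
  refine ⟨⟨f, hf1⟩, Subtype.ext (funext fun t => ?_)⟩
  rw [act_apply]
  have := hf2 (f.symm t)
  rw [Equiv.apply_symm_apply] at this
  exact this.symm

/-- A pair of equivariant functions is determined up to the Weyl group by its matrix. -/
theorem exists_act_pair (hn : 0 < n) (hd : 0 < d) (c c' e e' : EquivFun n d)
    (h : matOf hn hd c c' = matOf hn hd e e') :
    ∃ g : ExtWeyl d, c.act g = e ∧ c'.act g = e' := by
  obtain ⟨f, hf1, hf2⟩ := exists_equivariant_equiv (Equiv.addRight (d : ℤ)) (Equiv.addRight (d : ℤ))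
    ((Equiv.addRight (n : ℤ)).prodCongr (Equiv.addRight (n : ℤ))) (fun p : ℤ × ℤ => p.1 / n)
    (fun p => add_ediv_self hn p.1) (fun t => (c.1 t, c'.1 t)) (fun t => (e.1 t, e'.1 t))
    (fun t => Prod.ext (c.2 t) (c'.2 t)) (fun t => Prod.ext (e.2 t) (e'.2 t))
    (fun p _ => nonempty_equiv_of_ncard_eq
      (S := {t | (c.1 t, c'.1 t) = p}) (S' := {t | (e.1 t, e'.1 t) = p})
      ((c.finite_eq hn hd p.1).subset fun t ht => congrArg Prod.fst ht)
      ((e.finite_eq hn hd p.1).subset fun t ht => congrArg Prod.fst ht) (by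
        have := congrArg (fun A => A.entry p.1 p.2) h
        simp only [matOf_entry] at this
        simpa only [Prod.ext_iff] using this))
  have h1 : ∀ t, e.1 t = c.1 (f.symm t) ∧ e'.1 t = c'.1 (f.symm t) := by
    intro t
    have := hf2 (f.symm t)
    rw [Equiv.apply_symm_apply] at this
    exact ⟨congrArg Prod.fst this, congrArg Prod.snd this⟩
  exact ⟨⟨f, hf1⟩, Subtype.ext (funext fun t => (h1 t).1.symm),
    Subtype.ext (funext fun t => (h1 t).2.symm)⟩

theorem Comp.ncard_color (hn : 0 < n) (hd : 0 < d) (l : Comp n d) (q : ℤ) (k : Fin n) :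
    {t | l.color t = q * n + k + 1}.ncard = l.1 k := by
  have : {t | l.color t = q * n + k + 1} =
      (Finset.Ioc (l.psum (q * n + k)) (l.psum (q * n + k + 1)) : Finset ℤ) := by
    ext t
    rw [Set.mem_ofPred_eq, ← l.mem_interval_iff hn hd, Comp.interval, add_sub_cancel_right,
      Finset.coe_Ioc]
  rw [this, Set.ncard_coe_finset, Int.card_Ioc, l.psum_sub hn]
  simp

theorem Comp.ext_of_ncard (hn : 0 < n) (hd : 0 < d) {l m : Comp n d}
    (h : ∀ i, {t | l.color t = i}.ncard = {t | m.color t = i}.ncard) : l = m := by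
  refine Subtype.ext (funext fun k => ?_)
  rw [← l.ncard_color hn hd 0 k, ← m.ncard_color hn hd 0 k, h]

/-- The coloring of a composition as an equivariant function. -/
def Comp.fn (hn : 0 < n) (hd : 0 < d) (l : Comp n d) : EquivFun n d :=
  ⟨l.color, l.color_add hn hd⟩

theorem exists_comp (hn : 0 < n) (hd : 0 < d) (r : ℤ → ℕ) (hr : ∀ i, r (i + n) = r i)
    (hs : ∑ i ∈ Finset.Icc (1 : ℤ) n, r i = d) :
    ∃ l : Comp n d, ∀ i, {t | l.color t = i}.ncard = r i := by
  have e : ∑ k : Fin n, r (k + 1) = ∑ i ∈ Finset.Icc (1 : ℤ) n, r i := by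
    refine Finset.sum_bij (fun k _ => ((k : ℕ) : ℤ) + 1) ?_ ?_ ?_ ?_
    · intro k _
      rw [Finset.mem_Icc]
      have := k.2
      lia
    · intro a _ b _ h
      exact Fin.ext (by lia)
    · intro i hi
      rw [Finset.mem_Icc] at hi
      exact ⟨⟨(i - 1).toNat, by lia⟩, Finset.mem_univ _, by simp only; lia⟩
    · intro k _; rfl
  refine ⟨⟨fun k => r (k + 1), e.trans hs⟩, fun i => ?_⟩
  obtain ⟨q, k, rfl⟩ := exists_eq_mul_add hn i
  rw [Comp.ncard_color hn hd]
  have key : ∀ (q : ℤ), r (k + 1) = r (q * n + k + 1) := by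
    intro q
    induction q using Int.induction_on with
    | zero => simp
    | succ q ih =>
      rw [ih, ← hr]; congr 1; ring
    | pred q ih =>
      rw [ih, ← hr ((-(q : ℤ) - 1) * n + k + 1)]; congr 1; ring
  exact key q

theorem EquivFun.exists_comp (hn : 0 < n) (hd : 0 < d) (c : EquivFun n d) :
    ∃ (l : Comp n d) (g : ExtWeyl d), (l.fn hn hd).act g = c := by
  obtain ⟨l, hl⟩ := AffineSchur.exists_comp hn hd (fun i => {t | c.1 t = i}.ncard) c.ncard_add
    (c.sum_ncard hn hd)
  exact ⟨l, EquivFun.exists_act hn hd (l.fn hn hd) c hl⟩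

theorem Theta.ro_add {n d : ℕ} (A : Theta n d) (i : ℤ) : A.ro (i + n) = A.ro i := by
  rw [Theta.ro, Theta.ro, ← finsum_comp_equiv (Equiv.addRight (n : ℤ))]
  exact finsum_congr fun j => A.periodic i j

/-- Every matrix is the matrix of a pair of equivariant functions. -/
theorem Theta.exists_fn (hn : 0 < n) (hd : 0 < d) (A : Theta n d) :
    ∃ (l : Comp n d) (e : EquivFun n d), matOf hn hd (l.fn hn hd) e = A := by
  obtain ⟨l, hl⟩ := AffineSchur.exists_comp hn hd A.ro A.ro_add A.total
  -- `S` has `a_{ij}` points over each position `(i, j)`, translated by `(n, n)`. It is matched with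
  -- `ℤ`, colored by the composition of row sums; the column index then becomes the second
  -- equivariant function.
  let S : Type := {x : ℤ × ℤ × ℕ // x.2.2 < A.entry x.1 x.2.1}
  let τ : Equiv.Perm S :=
    { toFun := fun x => ⟨(x.1.1 + n, x.1.2.1 + n, x.1.2.2), by
        simp only; rw [A.periodic]; exact x.2⟩
      invFun := fun x => ⟨(x.1.1 - n, x.1.2.1 - n, x.1.2.2), by
        simp only
        rw [← A.periodic, sub_add_cancel, sub_add_cancel]; exact x.2⟩
      left_inv := fun x => by simp
      right_inv := fun x => by simp }
  have hfib : ∀ i j, {x : S | x.1.1 = i ∧ x.1.2.1 = j}.Finite ∧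
      {x : S | x.1.1 = i ∧ x.1.2.1 = j}.ncard = A.entry i j := by
    intro i j
    let φ : Fin (A.entry i j) → S := fun r => ⟨(i, j, r), r.2⟩
    have hφ : Function.Injective φ := by
      intro r r' h
      have := congrArg (fun x : S => x.1.2.2) h
      exact Fin.ext this
    have him : {x : S | x.1.1 = i ∧ x.1.2.1 = j} = Set.range φ := by
      ext x
      simp only [Set.mem_ofPred_eq, Set.mem_range]
      constructor
      · rintro ⟨rfl, rfl⟩
        exact ⟨⟨x.1.2.2, x.2⟩, rfl⟩
      · rintro ⟨r, rfl⟩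
        exact ⟨rfl, rfl⟩
    rw [him]
    refine ⟨Set.finite_range φ, ?_⟩
    rw [← Set.image_univ, Set.ncard_image_of_injective _ hφ, Set.ncard_univ, Nat.card_eq_fintype_card,
      Fintype.card_fin]
  have hrow : ∀ i, {x : S | x.1.1 = i}.Finite := by
    intro i
    have : {x : S | x.1.1 = i} ⊆ ⋃ j ∈ Function.support (A.entry i), {x : S | x.1.1 = i ∧ x.1.2.1 = j} := by
      rintro x rfl
      simp only [Set.mem_iUnion]
      refine ⟨x.1.2.1, ?_, rfl, rfl⟩
      have := x.2
      rw [Function.mem_support]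
      lia
    exact ((A.finite i).biUnion fun j _ => (hfib i j).1).subset this
  have hcard : ∀ i, {x : S | x.1.1 = i}.ncard = A.ro i := by
    intro i
    rw [← finsum_ncard_fiber (hrow i) fun x : S => x.1.2.1]
    exact finsum_congr fun j => (hfib i j).2
  obtain ⟨f, hf1, hf2⟩ := exists_equivariant_equiv τ (Equiv.addRight (d : ℤ))
    (Equiv.addRight (n : ℤ)) (fun i => i / n) (fun i => add_ediv_self hn i) (fun x : S => x.1.1)
    l.color (fun x => rfl) (l.color_add hn hd)
    (fun i _ => nonempty_equiv_of_ncard_eq (S := {x : S | x.1.1 = i}) (S' := {t | l.color t = i})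
      (hrow i) ((l.fn hn hd).finite_eq hn hd i) (by rw [hcard, hl]))
  have hsym : ∀ t, f.symm (t + d) = τ (f.symm t) := by
    intro t
    apply f.injective
    rw [hf1, Equiv.apply_symm_apply, Equiv.apply_symm_apply]
    rfl
  refine ⟨l, ⟨fun t => (f.symm t).1.2.1, fun t => ?_⟩, ?_⟩
  · beta_reduce
    rw [hsym]
    rfl
  · ext i j
    rw [matOf_entry, ← (hfib i j).2]
    have : {t | (l.fn hn hd).1 t = i ∧ (f.symm t).1.2.1 = j} =
        f '' {x : S | x.1.1 = i ∧ x.1.2.1 = j} := by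
      ext t
      simp only [Set.mem_ofPred_eq, Set.mem_image]
      constructor
      · rintro ⟨h1, h2⟩
        refine ⟨f.symm t, ⟨?_, h2⟩, f.apply_symm_apply t⟩
        rw [← hf2, Equiv.apply_symm_apply]
        exact h1
      · rintro ⟨x, ⟨h1, h2⟩, rfl⟩
        refine ⟨?_, by rwa [Equiv.symm_apply_apply]⟩
        rw [← h1, ← hf2]
        rfl
    exact (congrArg Set.ncard this).trans (Set.ncard_image_of_injective _ f.injective)

/-- The matrix of a triple `(λ, g, μ)`. -/
def mat (hn : 0 < n) (hd : 0 < d) (l : Comp n d) (g : ExtWeyl d) (m : Comp n d) : Theta n d :=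
  matOf hn hd (l.fn hn hd) ((m.fn hn hd).act g)

theorem exists_mat_eq (hn : 0 < n) (hd : 0 < d) (A : Theta n d) :
    ∃ l g m, mat hn hd l g m = A := by
  obtain ⟨l, e, h⟩ := A.exists_fn hn hd
  obtain ⟨m, g, rfl⟩ := e.exists_comp hn hd
  exact ⟨l, g, m, h⟩

theorem mat_mul_left (hn : 0 < n) (hd : 0 < d) {l m : Comp n d} {w : ExtWeyl d} (g : ExtWeyl d)
    (hw : w ∈ fixer d l.color) : mat hn hd l (w * g) m = mat hn hd l g m := by
  have h : (l.fn hn hd).act w = l.fn hn hd := EquivFun.act_of_mem_fixer hw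
  rw [mat, mat, EquivFun.act_mul]
  nth_rewrite 1 [← h]
  rw [matOf_act]

theorem mat_mul_right (hn : 0 < n) (hd : 0 < d) {l m : Comp n d} {w : ExtWeyl d} (g : ExtWeyl d)
    (hw : w ∈ fixer d m.color) : mat hn hd l (g * w) m = mat hn hd l g m := by
  have h : (m.fn hn hd).act w = m.fn hn hd := EquivFun.act_of_mem_fixer hw
  rw [mat, mat, EquivFun.act_mul, h]

/-- A Weyl group element relating the two pairs fixes the coloring of `λ`, hence lies in `W_λ`; what
remains between the second functions stabilizes the coloring of `μ`. -/
theorem mat_eq_mat_iff (hn : 0 < n) (hd : 0 < d) {l m : Comp n d} {g g' : ExtWeyl d} :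
    mat hn hd l g' m = mat hn hd l g m ↔
      g' ∈ DoubleCoset.doubleCoset g (parabolic l : Set (ExtWeyl d)) (parabolic m) := by
  rw [DoubleCoset.mem_doubleCoset, parabolic_eq_fixer hn hd, parabolic_eq_fixer hn hd]
  constructor
  · intro h
    obtain ⟨w, h1, h2⟩ := exists_act_pair hn hd _ _ _ _ h.symm
    rw [← EquivFun.act_mul] at h2
    have hw : w ∈ fixer d (l.fn hn hd).1 := EquivFun.mem_fixer_iff.2 h1
    have hw' : (w * g)⁻¹ * g' ∈ fixer d (m.fn hn hd).1 := by
      rw [EquivFun.mem_fixer_iff, EquivFun.act_mul, ← h2, ← EquivFun.act_mul, inv_mul_cancel]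
      exact EquivFun.act_of_mem_fixer (one_mem _)
    exact ⟨w, hw, _, hw', by group⟩
  · rintro ⟨w, hw, w', hw', rfl⟩
    rw [mat_mul_right hn hd _ hw', mat_mul_left hn hd _ hw]

theorem mat_left_unique (hn : 0 < n) (hd : 0 < d) {l m l' m' : Comp n d} {g g' : ExtWeyl d}
    (h : mat hn hd l g m = mat hn hd l' g' m') : l = l' := by
  refine Comp.ext_of_ncard hn hd fun i => ?_
  have := congrArg (fun A => A.ro i) h
  simp only [mat, matOf_ro] at this
  exact this

theorem EquivFun.ncard_act (g : ExtWeyl d) (c : EquivFun n d) (i : ℤ) :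
    {t | (c.act g).1 t = i}.ncard = {t | c.1 t = i}.ncard := by
  have : {t | (c.act g).1 t = i} = g.1 '' {t | c.1 t = i} := by
    ext t
    simp only [Set.mem_ofPred_eq, Set.mem_image, EquivFun.act_apply]
    constructor
    · intro h; exact ⟨_, h, apply_inv_self g t⟩
    · rintro ⟨u, hu, rfl⟩
      rwa [inv_apply_self]
  rw [this, Set.ncard_image_of_injective _ g.1.injective]

theorem mat_right_unique (hn : 0 < n) (hd : 0 < d) {l m l' m' : Comp n d} {g g' : ExtWeyl d}
    (h : mat hn hd l g m = mat hn hd l' g' m') : m = m' := by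
  refine Comp.ext_of_ncard hn hd fun i => ?_
  have := congrArg (fun A => A.co i) h
  simp only [mat, matOf_co, EquivFun.ncard_act] at this
  exact this

theorem isKappa_iff (hn : 0 < n) (hd : 0 < d) {l m : Comp n d} {g : ExtWeyl d} {A : Theta n d} :
    IsKappa l g m A ↔ (IncOn l.color g ∧ IncOn m.color g⁻¹) ∧ mat hn hd l g m = A := by
  have e : ∀ i j, (l.interval i ∩ g.1 '' m.interval j) =
      {t | (l.fn hn hd).1 t = i ∧ ((m.fn hn hd).act g).1 t = j} := by
    intro i j
    ext t
    rw [Set.mem_inter_iff, l.mem_interval_iff hn hd]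
    refine and_congr Iff.rfl ?_
    simp only [Set.mem_image, m.mem_interval_iff hn hd]
    constructor
    · rintro ⟨u, hu, rfl⟩
      rw [EquivFun.act_apply, inv_apply_self]; exact hu
    · intro h
      exact ⟨g⁻¹.1 t, h, apply_inv_self g t⟩
  rw [IsKappa, distinguishedDouble]
  refine and_congr (and_congr (mem_distinguished_iff hn hd l) (mem_distinguished_iff hn hd m)) ?_
  simp only [e]
  constructor
  · intro h; ext i j; exact (h i j).symm
  · rintro rfl i j; rfl

/-- Stripping left and right descents inside the parabolic subgroups shortens `g` and leaves its
matrix unchanged. -/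
theorem exists_kappa (hn : 0 < n) (hd : 0 < d) (l m : Comp n d) (g : ExtWeyl d) :
    ∃ g', IsKappa l g' m (mat hn hd l g m) := by
  induction hk : length g using Nat.strong_induction_on generalizing g with
  | _ k ih =>
    by_cases h1 : IncOn l.color g
    · by_cases h2 : IncOn m.color g⁻¹
      · exact ⟨g, (isKappa_iff hn hd).2 ⟨⟨h1, h2⟩, rfl⟩⟩
      · obtain ⟨a, s, hs, -, -, h3, h4⟩ := (m.isColoring hn hd).exists_simpleRefl hd h2
        obtain ⟨g', hg'⟩ := ih (length (g * s)) (by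
          rw [length_inv hd, ← length_inv hd (s * g⁻¹), mul_inv_rev, inv_inv, hs.inv_eq] at h4
          lia) (g * s) rfl
        exact ⟨g', by rwa [mat_mul_right hn hd _ h3] at hg'⟩
    · obtain ⟨a, s, hs, -, -, h3, h4⟩ := (l.isColoring hn hd).exists_simpleRefl hd h1
      obtain ⟨g', hg'⟩ := ih (length (s * g)) (by lia) (s * g) rfl
      exact ⟨g', by rwa [mat_mul_left hn hd _ h3] at hg'⟩

theorem phi_congr {l m : Comp n d} {g g' : ExtWeyl d}
    (h : DoubleCoset.doubleCoset g (parabolic l : Set (ExtWeyl d)) (parabolic m) =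
      DoubleCoset.doubleCoset g' (parabolic l : Set (ExtWeyl d)) (parabolic m)) :
    phi l m g = phi l m g' := by
  rw [phi, phi, phiHom, phiHom, h]

theorem doubleCoset_eq_setOf_mat (hn : 0 < n) (hd : 0 < d) (l m : Comp n d) (g : ExtWeyl d) :
    DoubleCoset.doubleCoset g (parabolic l : Set (ExtWeyl d)) (parabolic m) =
      {z | mat hn hd l z m = mat hn hd l g m} := by
  ext z
  exact (mat_eq_mat_iff hn hd).symm

/-- The triple chosen in `eElt` is immaterial: row and column sums recover both compositions, the
matrix recovers the double coset, and `phi` depends on nothing else. -/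
theorem eElt_mat (hn : 0 < n) (hd : 0 < d) (l m : Comp n d) (g : ExtWeyl d) :
    eElt (mat hn hd l g m) = phi l m g := by
  have h : ∃ t : Comp n d × ExtWeyl d × Comp n d,
      IsKappa t.1 t.2.1 t.2.2 (mat hn hd l g m) := by
    obtain ⟨g', hg'⟩ := exists_kappa hn hd l m g
    exact ⟨(l, g', m), hg'⟩
  rw [eElt, dif_pos h]
  have h1 := ((isKappa_iff hn hd).1 h.choose_spec).2
  generalize h.choose = t at h1
  obtain ⟨l', g', m'⟩ := t
  obtain rfl : l' = l := mat_left_unique hn hd h1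
  obtain rfl : m' = m := mat_right_unique hn hd h1
  refine phi_congr ?_
  rw [doubleCoset_eq_setOf_mat hn hd, doubleCoset_eq_setOf_mat hn hd, h1]

end Realization

/-! ### Computations in the Hecke algebra -/

section Hecke

open Classical

variable {n d : ℕ} {P : Type*} [PartialOrder P] {c : ℤ → P}

theorem heckeT_one : heckeT (1 : ExtWeyl d) = 1 := by
  have := RingQuot.mkAlgHom_rel Zv (HeckeRel.one (d := d))
  rwa [map_one] at this

theorem heckeT_mul {w w' : ExtWeyl d} (h : length (w * w') = length w + length w') :
    heckeT w * heckeT w' = heckeT (w * w') := by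
  have := RingQuot.mkAlgHom_rel Zv (HeckeRel.mul w w' h.symm)
  rwa [map_mul] at this

theorem heckeT_quad {s : ExtWeyl d} (h : s ∈ simpleRefls d) :
    (1 + heckeT s) * heckeT s = vpow 2 • (1 + heckeT s) := by
  have := RingQuot.mkAlgHom_rel Zv (HeckeRel.quad s h)
  rw [map_mul, map_add, map_sub, map_one, map_zero, AlgHom.commutes] at this
  change (heckeT s + 1) * (heckeT s - algebraMap Zv (Hecke d) (vpow 2)) = 0 at this
  have h2 := sub_eq_zero.1 ((mul_sub (heckeT s + 1) (heckeT s)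
    (algebraMap Zv (Hecke d) (vpow 2))).symm.trans this)
  rw [← Algebra.commutes, ← Algebra.smul_def] at h2
  rw [add_comm, h2]

theorem heckeTSet_eq_sum {X : Set (ExtWeyl d)} (hX : X.Finite) :
    heckeTSet X = ∑ w ∈ hX.toFinset, heckeT w :=
  finsum_mem_eq_finite_toFinset_sum _ hX

/-- The finite group of the elements that preserve a coloring, as a finset. -/
def IsColoring.fixset (hc : IsColoring d c) (hd : 0 < d) : Finset (ExtWeyl d) :=
  (hc.fixer_finite hd).toFinset

theorem IsColoring.mem_fixset (hc : IsColoring d c) (hd : 0 < d) {w : ExtWeyl d} :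
    w ∈ hc.fixset hd ↔ w ∈ fixer d c := by
  rw [fixset, Set.Finite.mem_toFinset, SetLike.mem_coe]

/-- The sum of `T_w` over the group that preserves a coloring. -/
def IsColoring.x (hc : IsColoring d c) (hd : 0 < d) : Hecke d := ∑ w ∈ hc.fixset hd, heckeT w

theorem IsColoring.x_mul (hc : IsColoring d c) (hd : 0 < d) {y : ExtWeyl d} (hy : IncOn c y) :
    hc.x hd * heckeT y = ∑ w ∈ hc.fixset hd, heckeT (w * y) := by
  rw [x, Finset.sum_mul]
  refine Finset.sum_congr rfl fun w hw => ?_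
  exact heckeT_mul (hc.length_mul hd ((hc.mem_fixset hd).1 hw) hy)

/-- `X` is a disjoint union of cosets of the fixer. Each has one shortest representative `y`, and
`T_w T_y = T_{wy}` along the coset. -/
theorem IsColoring.sum_left (hc : IsColoring d c) (hd : 0 < d) (X : Finset (ExtWeyl d))
    (hX : ∀ w ∈ fixer d c, ∀ x ∈ X, w * x ∈ X) :
    ∑ x ∈ X, heckeT x = hc.x hd * ∑ y ∈ X with IncOn c y, heckeT y := by
  rw [Finset.mul_sum]
  have : ∀ y ∈ X.filter (IncOn c), hc.x hd * heckeT y = ∑ w ∈ hc.fixset hd, heckeT (w * y) :=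
    fun y hy => hc.x_mul hd (Finset.mem_filter.1 hy).2
  rw [Finset.sum_congr rfl this, ← Finset.sum_product']
  symm
  refine Finset.sum_bij (fun p _ => p.2 * p.1) ?_ ?_ ?_ fun _ _ => rfl
  · rintro ⟨y, w⟩ h
    rw [Finset.mem_product, Finset.mem_filter, hc.mem_fixset] at h
    exact hX w h.2 y h.1.1
  · rintro ⟨y, w⟩ h ⟨y', w'⟩ h' e
    rw [Finset.mem_product, Finset.mem_filter, hc.mem_fixset] at h h'
    obtain ⟨h1, h2⟩ := hc.eq_of_mul_eq h.2 h'.2 h.1.2 h'.1.2 e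
    exact Prod.ext h2 h1
  · intro x hx
    obtain ⟨w, hw, hi⟩ := hc.exists_mul hd x
    refine ⟨(w * x, w⁻¹), ?_, by simp⟩
    rw [Finset.mem_product, Finset.mem_filter, hc.mem_fixset]
    exact ⟨⟨hX w hw x hx, hi⟩, inv_mem hw⟩

theorem IsColoring.sum_right (hc : IsColoring d c) (hd : 0 < d) (X : Finset (ExtWeyl d))
    (hX : ∀ w ∈ fixer d c, ∀ x ∈ X, x * w ∈ X) :
    ∑ x ∈ X, heckeT x = (∑ y ∈ X with IncOn c y⁻¹, heckeT y) * hc.x hd := by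
  rw [Finset.sum_mul]
  have : ∀ y ∈ X.filter (fun y => IncOn c y⁻¹),
      heckeT y * hc.x hd = ∑ w ∈ hc.fixset hd, heckeT (y * w) := by
    intro y hy
    rw [x, Finset.mul_sum]
    refine Finset.sum_congr rfl fun w hw => ?_
    exact heckeT_mul (hc.length_mul_inv hd ((hc.mem_fixset hd).1 hw) (Finset.mem_filter.1 hy).2)
  rw [Finset.sum_congr rfl this, ← Finset.sum_product']
  symm
  refine Finset.sum_bij (fun p _ => p.1 * p.2) ?_ ?_ ?_ fun _ _ => rfl
  · rintro ⟨y, w⟩ h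
    rw [Finset.mem_product, Finset.mem_filter, hc.mem_fixset] at h
    exact hX w h.2 y h.1.1
  · rintro ⟨y, w⟩ h ⟨y', w'⟩ h' e
    rw [Finset.mem_product, Finset.mem_filter, hc.mem_fixset] at h h'
    have e' : w⁻¹ * y⁻¹ = w'⁻¹ * y'⁻¹ := by rw [← mul_inv_rev, ← mul_inv_rev]; exact congrArg _ e
    obtain ⟨h1, h2⟩ := hc.eq_of_mul_eq (inv_mem h.2) (inv_mem h'.2) h.1.2 h'.1.2 e'
    exact Prod.ext (inv_injective h2) (inv_injective h1)
  · intro x hx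
    obtain ⟨w, hw, hi⟩ := hc.exists_mul hd x⁻¹
    refine ⟨(x * w⁻¹, w), ?_, by simp⟩
    rw [Finset.mem_product, Finset.mem_filter, hc.mem_fixset]
    exact ⟨⟨hX _ (inv_mem hw) x hx, by rwa [mul_inv_rev, inv_inv]⟩, hw⟩

/-- Grouping the fixer into pairs `{w, w s}` extracts a right factor `1 + T_s`, on which `T_s` acts
by `v²`. -/
theorem IsColoring.x_mul_simpleRefl (hc : IsColoring d c) (hd : 0 < d) {s : ExtWeyl d} {a : ℤ}
    (hs : IsSimpleRefl s a) (h : c a = c (a + 1)) :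
    hc.x hd * heckeT s = vpow 2 • hc.x hd := by
  have hsm := hc.simpleRefl_mem hs h
  have key : hc.x hd =
      (∑ w ∈ (hc.fixset hd).filter (fun w => w.1 a < w.1 (a + 1)), heckeT w) * (1 + heckeT s) := by
    rw [x, ← Finset.sum_filter_add_sum_filter_not (hc.fixset hd) (fun w => w.1 a < w.1 (a + 1)),
      mul_add, mul_one]
    congr 1
    rw [Finset.sum_mul]
    symm
    refine Finset.sum_bij (fun w _ => w * s) ?_ ?_ ?_ ?_
    · intro w hw
      rw [Finset.mem_filter, hc.mem_fixset] at hw ⊢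
      refine ⟨mul_mem hw.1 hsm, ?_⟩
      rw [mul_apply, mul_apply, hs.1, hs.2.1]
      exact not_lt.2 hw.2.le
    · intro w _ w' _ e
      exact mul_right_cancel e
    · intro w hw
      rw [Finset.mem_filter, hc.mem_fixset] at hw
      refine ⟨w * s, ?_, by rw [mul_assoc, hs.mul_self, mul_one]⟩
      rw [Finset.mem_filter, hc.mem_fixset]
      refine ⟨mul_mem hw.1 hsm, ?_⟩
      rw [mul_apply, mul_apply, hs.1, hs.2.1]
      refine lt_of_le_of_ne (not_lt.1 hw.2) fun e => ?_
      have := w.1.injective e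
      lia
    · intro w hw
      rw [Finset.mem_filter] at hw
      refine heckeT_mul ?_
      rw [length_mul_simpleRefl hd hs hw.2, length_simpleRefl hd hs]
  rw [key, mul_assoc, heckeT_quad (hs.mem hd), mul_smul_comm]

theorem vpow_add (a b : ℤ) : vpow (a + b) = vpow a * vpow b := LaurentPolynomial.T_add a b

theorem vpow_zero : vpow 0 = 1 := LaurentPolynomial.T_zero

theorem IsColoring.x_mul_fixer (hc : IsColoring d c) (hd : 0 < d) {u : ExtWeyl d}
    (hu : u ∈ fixer d c) : hc.x hd * heckeT u = vpow (2 * length u) • hc.x hd := by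
  induction hk : length u using Nat.strong_induction_on generalizing u with
  | _ k ih =>
    by_cases hi : IncOn c u
    · obtain rfl := hc.eq_one hu hi
      rw [length_one hd] at hk
      subst hk
      rw [heckeT_one, mul_one, Nat.cast_zero, mul_zero, vpow_zero, one_smul]
    · obtain ⟨a, s, hs, h1, -, h3, h4⟩ := hc.exists_simpleRefl hd hi
      have h5 := ih (length (s * u)) (by lia) (mul_mem h3 hu) rfl
      have h6 : heckeT u = heckeT s * heckeT (s * u) := by
        rw [heckeT_mul] <;> rw [← mul_assoc, hs.mul_self, one_mul]
        rw [length_simpleRefl hd hs]; lia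
      rw [h6, ← mul_assoc, hc.x_mul_simpleRefl hd hs h1, smul_mul_assoc, h5, smul_smul, ← vpow_add,
        ← hk, h4]
      congr 2
      push_cast
      ring

/-- An element of the group of the coloring that carries `y` to the shortest representative of its
coset. -/
def IsColoring.reducer (hc : IsColoring d c) (hd : 0 < d) (y : ExtWeyl d) : ExtWeyl d :=
  (hc.exists_mul hd y).choose

theorem IsColoring.reducer_mem (hc : IsColoring d c) (hd : 0 < d) (y : ExtWeyl d) :
    hc.reducer hd y ∈ fixer d c := (hc.exists_mul hd y).choose_spec.1

theorem IsColoring.incOn_reducer (hc : IsColoring d c) (hd : 0 < d) (y : ExtWeyl d) :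
    IncOn c (hc.reducer hd y * y) := (hc.exists_mul hd y).choose_spec.2

theorem IsColoring.reducer_mul (hc : IsColoring d c) (hd : 0 < d) {u g : ExtWeyl d}
    (hu : u ∈ fixer d c) (hg : IncOn c g) : hc.reducer hd (u * g) = u⁻¹ := by
  have := hc.eq_of_mul_eq (mul_mem (hc.reducer_mem hd (u * g)) hu) (one_mem _) hg
    (hc.incOn_reducer hd (u * g)) (by rw [one_mul, mul_assoc])
  exact eq_inv_of_mul_eq_one_left this.1

/-- If `y = u g` with `u` in the fixer and `g` shortest, then `T_u` is absorbed at the cost of `v^{2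
ℓ(u)}`. The reducer of `y` is `u⁻¹`, which has the same length. -/
theorem IsColoring.x_mul_heckeT (hc : IsColoring d c) (hd : 0 < d) (y : ExtWeyl d) :
    hc.x hd * heckeT y =
      vpow (2 * length (hc.reducer hd y)) • ∑ w ∈ hc.fixset hd, heckeT (w * y) := by
  set r := hc.reducer hd y with hr
  have hrm : r ∈ fixer d c := hc.reducer_mem hd y
  have hinc : IncOn c (r * y) := hc.incOn_reducer hd y
  have h1 : heckeT y = heckeT r⁻¹ * heckeT (r * y) := by
    rw [heckeT_mul, inv_mul_cancel_left]
    exact hc.length_mul hd (inv_mem hrm) hinc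
  rw [h1, ← mul_assoc, hc.x_mul_fixer hd (inv_mem hrm), length_inv hd, smul_mul_assoc,
    hc.x_mul hd hinc]
  congr 1
  refine Finset.sum_bij (fun w _ => w * r) ?_ ?_ ?_ ?_
  · intro w hw
    rw [hc.mem_fixset] at hw ⊢
    exact mul_mem hw hrm
  · intro w _ w' _ e
    exact mul_right_cancel e
  · intro w hw
    rw [hc.mem_fixset] at hw
    exact ⟨w * r⁻¹, (hc.mem_fixset hd).2 (mul_mem hw (inv_mem hrm)), by simp⟩
  · intro w _
    rw [mul_assoc]

/-! ### Multiplicities of cosets -/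

/-- The multiplicity of the coset of `z` in the product of `x_λ` with the sum of a finite
set `Y`. -/
def IsColoring.mult (hc : IsColoring d c) (hd : 0 < d) (Y : Finset (ExtWeyl d)) (z : ExtWeyl d) :
    Zv :=
  ∑ y ∈ Y with y * z⁻¹ ∈ fixer d c, vpow (2 * length (hc.reducer hd y))

theorem IsColoring.x_mul_sum (hc : IsColoring d c) (hd : 0 < d) (Y V : Finset (ExtWeyl d))
    (hV : ∀ w ∈ fixer d c, ∀ y ∈ Y, w * y ∈ V) :
    hc.x hd * ∑ y ∈ Y, heckeT y = ∑ z ∈ V, hc.mult hd Y z • heckeT z := by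
  have h1 : ∀ z ∈ V, hc.mult hd Y z • heckeT z = ∑ y ∈ Y,
      if y * z⁻¹ ∈ fixer d c then vpow (2 * length (hc.reducer hd y)) • heckeT z else 0 := by
    intro z _
    rw [mult, Finset.sum_smul, Finset.sum_filter]
  rw [Finset.sum_congr rfl h1, Finset.sum_comm, Finset.mul_sum]
  refine Finset.sum_congr rfl fun y hy => ?_
  rw [hc.x_mul_heckeT, ← Finset.sum_filter, Finset.smul_sum]
  refine Finset.sum_bij (fun w _ => w * y) ?_ ?_ ?_ fun _ _ => rfl
  · intro w hw
    rw [hc.mem_fixset] at hw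
    rw [Finset.mem_filter]
    exact ⟨hV w hw y hy, by simpa using inv_mem hw⟩
  · intro w _ w' _ e
    exact mul_right_cancel e
  · intro z hz
    rw [Finset.mem_filter] at hz
    refine ⟨z * y⁻¹, (hc.mem_fixset hd).2 ?_, by simp⟩
    have := inv_mem hz.2
    rwa [mul_inv_rev, inv_inv] at this

theorem IsColoring.mult_left (hc : IsColoring d c) (hd : 0 < d) (Y : Finset (ExtWeyl d))
    {w : ExtWeyl d} (hw : w ∈ fixer d c) (z : ExtWeyl d) :
    hc.mult hd Y (w * z) = hc.mult hd Y z := by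
  have : ∀ y : ExtWeyl d, y * (w * z)⁻¹ ∈ fixer d c ↔ y * z⁻¹ ∈ fixer d c := by
    intro y
    rw [mul_inv_rev, ← mul_assoc]
    exact Subgroup.mul_mem_cancel_right _ (inv_mem hw)
  simp only [mult, this]

variable {Q : Type*} {e : ℤ → Q}

/-- For the shortest `z0` in the coset of `z` there are two cases. If `z0 s` is shortest, then `y ↦
y s` matches the two sums without changing reducers; otherwise `z0 s` lies in the coset of `z0`.
With left invariance this makes multiplicities constant on double cosets. -/
theorem IsColoring.mult_simpleRefl (hc : IsColoring d c) (hd : 0 < d)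
    (he : ∀ a b, e a = e b → c a = c b) (X : Finset (ExtWeyl d)) {s : ExtWeyl d} {a : ℤ}
    (hs : IsSimpleRefl s a) (hX : ∀ x, x * s ∈ X ↔ x ∈ X) (z : ExtWeyl d) :
    hc.mult hd (X.filter (IncOn e)) (z * s) = hc.mult hd (X.filter (IncOn e)) z := by
  have hz : ∃ w ∈ fixer d c, ∃ z0, IncOn c z0 ∧ z = w * z0 :=
    ⟨(hc.reducer hd z)⁻¹, inv_mem (hc.reducer_mem hd z), _, hc.incOn_reducer hd z, by simp⟩
  obtain ⟨w, hw, z0, hz0, rfl⟩ := hz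
  rw [mul_assoc, hc.mult_left hd _ hw, hc.mult_left hd _ hw]
  rcases hc.incOn_mul_or hz0 hs with h | h
  · have key : ∀ y : ExtWeyl d, y * z0⁻¹ ∈ fixer d c →
        (IncOn e (y * s) ↔ IncOn e y) ∧
          hc.reducer hd (y * s) = hc.reducer hd y := by
      intro y hy
      obtain ⟨u, rfl⟩ : ∃ u, y = u * z0 := ⟨y * z0⁻¹, by simp⟩
      rw [mul_inv_cancel_right] at hy
      rw [mul_assoc, incOn_mul_iff he hy h, incOn_mul_iff he hy hz0, hc.reducer_mul hd hy h,
        hc.reducer_mul hd hy hz0]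
      exact ⟨Iff.rfl, rfl⟩
    symm
    refine Finset.sum_bij (fun y _ => y * s) ?_ ?_ ?_ ?_
    · intro y hy
      simp only [Finset.mem_filter] at hy ⊢
      refine ⟨⟨(hX y).2 hy.1.1, ((key y hy.2).1).2 hy.1.2⟩, ?_⟩
      rw [mul_inv_rev, mul_assoc, mul_inv_cancel_left]
      exact hy.2
    · intro y _ y' _ e
      exact mul_right_cancel e
    · intro y hy
      simp only [Finset.mem_filter] at hy
      have e1 : y * s * s = y := by rw [mul_assoc, hs.mul_self, mul_one]
      have e2 : y * s * z0⁻¹ ∈ fixer d c := by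
        have := hy.2
        rwa [mul_inv_rev, hs.inv_eq, ← mul_assoc] at this
      refine ⟨y * s, ?_, e1⟩
      simp only [Finset.mem_filter]
      refine ⟨⟨(hX y).2 hy.1.1, ((key _ e2).1).1 ?_⟩, e2⟩
      rw [e1]
      exact hy.1.2
    · intro y hy
      simp only [Finset.mem_filter] at hy
      rw [(key y hy.2).2]
  · have : z0 * s = z0 * s * z0⁻¹ * z0 := by simp
    rw [this, hc.mult_left hd _ h]

theorem IsColoring.mult_right {R : Type*} [PartialOrder R] {b : ℤ → R} (hc : IsColoring d c)
    (hb : IsColoring d b) (hd : 0 < d) (he : ∀ a b, e a = e b → c a = c b)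
    (X : Finset (ExtWeyl d)) (hX : ∀ w ∈ fixer d b, ∀ x, x * w ∈ X ↔ x ∈ X) {w : ExtWeyl d}
    (hw : w ∈ fixer d b) (z : ExtWeyl d) :
    hc.mult hd (X.filter (IncOn e)) (z * w) = hc.mult hd (X.filter (IncOn e)) z := by
  induction hk : length w using Nat.strong_induction_on generalizing w z with
  | _ k ih =>
    by_cases hi : IncOn b w
    · rw [hb.eq_one hw hi, mul_one]
    · obtain ⟨a, s, hs, -, -, h3, h4⟩ := hb.exists_simpleRefl hd hi
      have h5 := ih (length (s * w)) (by lia) (mul_mem h3 hw) (z * s) rfl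
      rw [← mul_assoc, mul_assoc z s s, hs.mul_self, mul_one] at h5
      rw [h5, hc.mult_simpleRefl hd he X hs (hX s h3)]

/-- The multiplicity of a coset that contains exactly one coset of the finer coloring. -/
theorem IsColoring.mult_eq_one {Q : Type*} [PartialOrder Q] {e : ℤ → Q} (hc : IsColoring d c)
    (hec : IsColoring d e) (hd : 0 < d)
    (he : ∀ a b, e a = e b → c a = c b) (X : Finset (ExtWeyl d)) {g : ExtWeyl d} (hg : IncOn c g)
    (hgX : g ∈ X) (hX : ∀ u ∈ fixer d c, u * g ∈ X → u ∈ fixer d e) :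
    hc.mult hd (X.filter (IncOn e)) g = 1 := by
  rw [mult]
  -- A competitor has the form `u g`. By `hX` the element `u` preserves the finer coloring, and the
  -- filter makes `u` shortest for it, so `u = 1`.
  have : (X.filter (IncOn e)).filter (fun y => y * g⁻¹ ∈ fixer d c) = {g} := by
    ext y
    simp only [Finset.mem_filter, Finset.mem_singleton]
    constructor
    · rintro ⟨⟨h1, h2⟩, h3⟩
      obtain ⟨u, rfl⟩ : ∃ u, y = u * g := ⟨y * g⁻¹, by simp⟩
      rw [mul_inv_cancel_right] at h3
      rw [hec.eq_one (hX u h3 h1) ((incOn_mul_iff he h3 hg).1 h2), one_mul]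
    · rintro rfl
      exact ⟨⟨hgX, hg.refine he⟩, by simp⟩
  rw [this, Finset.sum_singleton]
  have := hc.reducer_mul hd (one_mem _) hg
  rw [one_mul, inv_one] at this
  rw [this, length_one hd, Nat.cast_zero, mul_zero, vpow_zero]

end Hecke

/-! ### Multiplication in the Schur algebra -/

section Schur

open Classical

variable {n d : ℕ}

theorem fixer_color_finite (hn : 0 < n) (hd : 0 < d) (l : Comp n d) :
    (parabolic l : Set (ExtWeyl d)).Finite := by
  rw [parabolic_eq_fixer hn hd]
  exact (l.isColoring hn hd).fixer_finite hd

theorem doubleCoset_finite (hn : 0 < n) (hd : 0 < d) (l m : Comp n d) (g : ExtWeyl d) :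
    (DoubleCoset.doubleCoset g (parabolic l : Set (ExtWeyl d)) (parabolic m)).Finite :=
  ((fixer_color_finite hn hd l).mul (Set.finite_singleton g)).mul (fixer_color_finite hn hd m)

theorem xElt_eq (hn : 0 < n) (hd : 0 < d) (l : Comp n d) :
    xElt l = (l.isColoring hn hd).x hd := by
  rw [xElt, heckeTSet_eq_sum (fixer_color_finite hn hd l), IsColoring.x]
  refine Finset.sum_congr ?_ fun _ _ => rfl
  ext w
  rw [IsColoring.mem_fixset, Set.Finite.mem_toFinset, SetLike.mem_coe, parabolic_eq_fixer hn hd]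

/-- The double coset of `g` as a finset. -/
def dcoset (hn : 0 < n) (hd : 0 < d) (l m : Comp n d) (g : ExtWeyl d) : Finset (ExtWeyl d) :=
  (doubleCoset_finite hn hd l m g).toFinset

theorem mem_dcoset (hn : 0 < n) (hd : 0 < d) {l m : Comp n d} {g z : ExtWeyl d} :
    z ∈ dcoset hn hd l m g ↔ mat hn hd l z m = mat hn hd l g m := by
  rw [dcoset, Set.Finite.mem_toFinset, mat_eq_mat_iff]

theorem heckeTSet_doubleCoset (hn : 0 < n) (hd : 0 < d) (l m : Comp n d) (g : ExtWeyl d) :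
    heckeTSet (DoubleCoset.doubleCoset g (parabolic l : Set (ExtWeyl d)) (parabolic m)) =
      ∑ w ∈ dcoset hn hd l m g, heckeT w :=
  heckeTSet_eq_sum _

theorem mem_xIdeal {l : Comp n d} {x : Hecke d} : x ∈ xIdeal l ↔ ∃ k, x = xElt l * k := by
  rw [xIdeal, Submodule.mem_span_singleton]
  constructor
  · rintro ⟨a, rfl⟩
    exact ⟨a.unop, rfl⟩
  · rintro ⟨k, rfl⟩
    exact ⟨MulOpposite.op k, rfl⟩

theorem xIdeal_hom_ext {l m : Comp n d} {f f' : xIdeal m →ₗ[(Hecke d)ᵐᵒᵖ] xIdeal l}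
    (h : (f (xGen m) : Hecke d) = f' (xGen m)) : f = f' := by
  ext ⟨y, hy⟩ : 1
  obtain ⟨a, rfl⟩ := Submodule.mem_span_singleton.1 hy
  have e : (⟨a • xElt m, hy⟩ : xIdeal m) = a • xGen m := rfl
  rw [e, map_smul, map_smul, Subtype.ext h]

/-- Left multiplication as a map of right modules. -/
def leftMul (h : Hecke d) : Hecke d →ₗ[(Hecke d)ᵐᵒᵖ] Hecke d where
  toFun x := h * x
  map_add' := mul_add h
  map_smul' a x := (mul_assoc h x a.unop).symm

/-- The double coset sum is both `x_λ h'` and `h x_μ`. The second form makes left multiplication by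
`h` the required map, and the first puts its image in `x_λ H`. -/
theorem exists_phiHom (hn : 0 < n) (hd : 0 < d) (l m : Comp n d) (g : ExtWeyl d) :
    ∃ f : xIdeal m →ₗ[(Hecke d)ᵐᵒᵖ] xIdeal l, (f (xGen m) : Hecke d) =
      heckeTSet (DoubleCoset.doubleCoset g (parabolic l : Set (ExtWeyl d)) (parabolic m)) := by
  have hl := (l.isColoring hn hd).sum_left hd (dcoset hn hd l m g) fun w hw x hx => by
    rw [mem_dcoset] at hx ⊢
    rw [mat_mul_left hn hd _ hw, hx]
  have hm := (m.isColoring hn hd).sum_right hd (dcoset hn hd l m g) fun w hw x hx => by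
    rw [mem_dcoset] at hx ⊢
    rw [mat_mul_right hn hd _ hw, hx]
  rw [← xElt_eq hn hd] at hl hm
  rw [heckeTSet_doubleCoset hn hd]
  refine ⟨(leftMul (∑ y ∈ dcoset hn hd l m g with IncOn m.color y⁻¹, heckeT y)).restrict ?_, hm.symm⟩
  intro x hx
  obtain ⟨k, rfl⟩ := mem_xIdeal.1 hx
  rw [mem_xIdeal]
  refine ⟨(∑ y ∈ dcoset hn hd l m g with IncOn l.color y, heckeT y) * k, ?_⟩
  rw [← mul_assoc, ← hl, hm]
  exact (mul_assoc _ _ _).symm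

theorem phiHom_xGen (hn : 0 < n) (hd : 0 < d) (l m : Comp n d) (g : ExtWeyl d) :
    (phiHom l m g (xGen m) : Hecke d) = ∑ w ∈ dcoset hn hd l m g, heckeT w := by
  have h := exists_phiHom hn hd l m g
  rw [phiHom, dif_pos h, h.choose_spec, heckeTSet_doubleCoset hn hd]

theorem phiHom_apply (hn : 0 < n) (hd : 0 < d) {l m : Comp n d} {g : ExtWeyl d} {h : Hecke d}
    (hh : ∑ w ∈ dcoset hn hd l m g, heckeT w = h * xElt m) (y : xIdeal m) :
    (phiHom l m g y : Hecke d) = h * y := by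
  obtain ⟨y, hy⟩ := y
  obtain ⟨a, rfl⟩ := Submodule.mem_span_singleton.1 hy
  have e : (⟨a • xElt m, hy⟩ : xIdeal m) = a • xGen m := rfl
  rw [e, map_smul, Submodule.coe_smul, phiHom_xGen hn hd, hh]
  exact mul_assoc _ _ _

/-- A map between two summands as an element of the Schur algebra. -/
def ofHom {l m : Comp n d} (f : xIdeal m →ₗ[(Hecke d)ᵐᵒᵖ] xIdeal l) : Schur n d :=
  DirectSum.lof (Hecke d)ᵐᵒᵖ (Comp n d) (fun k => xIdeal k) l ∘ₗ f ∘ₗ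
    DirectSum.component (Hecke d)ᵐᵒᵖ (Comp n d) (fun k => xIdeal k) m

theorem phi_eq_ofHom (l m : Comp n d) (g : ExtWeyl d) : phi l m g = ofHom (phiHom l m g) := rfl

theorem ofHom_mul {l m k : Comp n d} (f : xIdeal m →ₗ[(Hecke d)ᵐᵒᵖ] xIdeal l)
    (f' : xIdeal k →ₗ[(Hecke d)ᵐᵒᵖ] xIdeal m) : ofHom f * ofHom f' = ofHom (f ∘ₗ f') := by
  refine LinearMap.ext fun x => ?_
  simp only [ofHom, Module.End.mul_apply, LinearMap.comp_apply, DirectSum.component.lof_self]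

theorem ofHom_sum {ι : Type*} {l m : Comp n d} (s : Finset ι)
    (f : ι → xIdeal m →ₗ[(Hecke d)ᵐᵒᵖ] xIdeal l) :
    ofHom (∑ i ∈ s, f i) = ∑ i ∈ s, ofHom (f i) := by
  refine LinearMap.ext fun x => ?_
  simp only [ofHom, LinearMap.comp_apply, LinearMap.sum_apply, map_sum]

theorem ofHom_smul {l m : Comp n d} (r : Zv) (f : xIdeal m →ₗ[(Hecke d)ᵐᵒᵖ] xIdeal l) :
    ofHom (r • f) = r • ofHom f := by
  refine LinearMap.ext fun x => ?_
  simp only [ofHom, LinearMap.comp_apply, LinearMap.smul_apply]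
  exact LinearMap.map_smul_of_tower _ r _

/-- The common refinement of the coloring of `λ` and the translate of the coloring of `μ`. -/
def refinement (l m : Comp n d) (z : ℤ) (t : ℤ) : ℤ × ℤ := (l.color t, m.color (t - z))

theorem refinement_isColoring (hn : 0 < n) (hd : 0 < d) (l m : Comp n d) (z : ℤ) :
    IsColoring d (refinement l m z) :=
  (l.isColoring hn hd).prod ((m.isColoring hn hd).translate z)

theorem refinement_left {l m : Comp n d} {z a b : ℤ} (h : refinement l m z a = refinement l m z b) :
    l.color a = l.color b := congrArg Prod.fst h

/-- The refinement is designed for this: its fixer is `W_λ ∩ π^z W_μ π^{-z}`, the overlap of the two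
sides of the double coset of `π^z`. -/
theorem mem_fixer_refinement {l m : Comp n d} {z : ℤ} {w : ExtWeyl d} :
    w ∈ fixer d (refinement l m z) ↔ w ∈ fixer d l.color ∧
      (rot d ^ z)⁻¹ * w * rot d ^ z ∈ fixer d m.color := by
  rw [← mem_fixer_translate]
  constructor
  · intro h
    exact ⟨fun t => congrArg Prod.fst (h t), fun t => congrArg Prod.snd (h t)⟩
  · rintro ⟨h1, h2⟩ t
    exact Prod.ext (h1 t) (h2 t)

/-- Only pairs with equal `λ`-color need the hypothesis: `w` preserves that coloring and so cannot
reverse pairs of different colors. -/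
theorem incOn_mul_rot (hn : 0 < n) (hd : 0 < d) {l m : Comp n d} {z : ℤ} {w : ExtWeyl d}
    (hw : w ∈ fixer d l.color) (h : IncOn (refinement l m z) w⁻¹) :
    IncOn m.color (w * rot d ^ z)⁻¹ := by
  intro a b hab hcab
  rw [inv_inv, mul_apply, mul_apply, rot_zpow_apply, rot_zpow_apply]
  by_cases hl : l.color (a + z) = l.color (b + z)
  · have := h (a + z) (b + z) (by lia) (Prod.ext hl (by simpa [refinement] using hcab))
    rwa [inv_inv] at this
  · by_contra hge
    have h1 := l.color_mono hn hd (not_lt.1 hge)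
    rw [apply_of_mem_fixer hw, apply_of_mem_fixer hw] at h1
    exact hl (le_antisymm (l.color_mono hn hd (by lia)) h1)

theorem heckeT_mul_rot (hd : 0 < d) (w : ExtWeyl d) (z : ℤ) :
    heckeT w * heckeT (rot d ^ z) = heckeT (w * rot d ^ z) := by
  refine heckeT_mul ?_
  rw [← length_inv hd, mul_inv_rev, ← zpow_neg, length_rot_mul hd, length_inv hd, length_rot hd,
    add_zero]

theorem heckeT_rot_mul (hd : 0 < d) (w : ExtWeyl d) (z : ℤ) :
    heckeT (rot d ^ z) * heckeT w = heckeT (rot d ^ z * w) := by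
  refine heckeT_mul ?_
  rw [length_rot_mul hd, length_rot hd, zero_add]

/-- The sum over the double coset of a translation. -/
theorem sum_dcoset_rot (hn : 0 < n) (hd : 0 < d) (l m : Comp n d) (z : ℤ) :
    ∑ w ∈ dcoset hn hd l m (rot d ^ z), heckeT w =
      (∑ w ∈ (l.isColoring hn hd).fixset hd with IncOn (refinement l m z) w⁻¹, heckeT w) *
        heckeT (rot d ^ z) * xElt m := by
  have hm := (m.isColoring hn hd).sum_right hd (dcoset hn hd l m (rot d ^ z)) fun w hw x hx => by
    rw [mem_dcoset] at hx ⊢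
    rw [mat_mul_right hn hd _ hw, hx]
  rw [hm, ← xElt_eq hn hd]
  refine congrArg (· * xElt m) ?_
  rw [Finset.sum_mul]
  symm
  refine Finset.sum_bij (fun w _ => w * rot d ^ z) ?_ ?_ ?_ ?_
  · intro w hw
    rw [Finset.mem_filter, IsColoring.mem_fixset] at hw
    rw [Finset.mem_filter, mem_dcoset, mat_mul_left hn hd _ hw.1]
    exact ⟨rfl, incOn_mul_rot hn hd hw.1 hw.2⟩
  · intro w _ w' _ e
    exact mul_right_cancel e
  · intro y hy
    rw [Finset.mem_filter, mem_dcoset, mat_eq_mat_iff, DoubleCoset.mem_doubleCoset,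
      parabolic_eq_fixer hn hd, parabolic_eq_fixer hn hd] at hy
    obtain ⟨⟨u, hu, v, hv, rfl⟩, hi⟩ := hy
    -- In `u π^z v`, the factor `u` is replaced by the shortest element `u x⁻¹` of its coset modulo
    -- the overlap group. The remainder passes through `π^z` into `W_μ`, and uniqueness of shortest
    -- representatives identifies the result with the given element.
    obtain ⟨x, hx, hxi⟩ := (refinement_isColoring hn hd l m z).exists_mul hd u⁻¹
    obtain ⟨hx1, hx2⟩ := mem_fixer_refinement.1 hx
    have hw : u * x⁻¹ ∈ fixer d l.color := mul_mem hu (inv_mem hx1)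
    have hwi : IncOn (refinement l m z) (u * x⁻¹)⁻¹ := by rwa [mul_inv_rev, inv_inv]
    have key := (m.isColoring hn hd).eq_of_mul_eq (one_mem _)
      (inv_mem (mul_mem hx2 hv)) hi (incOn_mul_rot hn hd hw hwi) (by group)
    refine ⟨u * x⁻¹, ?_, ?_⟩
    · rw [Finset.mem_filter, IsColoring.mem_fixset]
      exact ⟨hw, hwi⟩
    · exact inv_injective key.2.symm
  · intro w _
    exact heckeT_mul_rot hd w z

/-- The elements `y` for which `π^{-z} y` lies in a given double coset. -/
def shiftedDcoset (hn : 0 < n) (hd : 0 < d) (m k : Comp n d) (z : ℤ) (g : ExtWeyl d) :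
    Finset (ExtWeyl d) :=
  (dcoset hn hd m k g).image fun x => rot d ^ z * x

theorem mem_shiftedDcoset (hn : 0 < n) (hd : 0 < d) {m k : Comp n d} {z : ℤ} {g y : ExtWeyl d} :
    y ∈ shiftedDcoset hn hd m k z g ↔
      mat hn hd m ((rot d ^ z)⁻¹ * y) k = mat hn hd m g k := by
  rw [shiftedDcoset, Finset.mem_image]
  constructor
  · rintro ⟨x, hx, rfl⟩
    rwa [inv_mul_cancel_left, ← mem_dcoset]
  · intro h
    exact ⟨_, (mem_dcoset hn hd).2 h, by simp⟩

/-- The sum over the shifted double coset splits off, on its left, the sum over the overlap group.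
That factor completes the shortest representatives from `sum_dcoset_rot` to all of `x_λ`. -/
theorem phiHom_comp_xGen (hn : 0 < n) (hd : 0 < d) (l m k : Comp n d) (z : ℤ) (g : ExtWeyl d) :
    ((phiHom l m (rot d ^ z) ∘ₗ phiHom m k g) (xGen k) : Hecke d) =
      (l.isColoring hn hd).x hd *
        ∑ y ∈ (shiftedDcoset hn hd m k z g).filter (IncOn (refinement l m z)), heckeT y := by
  rw [LinearMap.comp_apply, phiHom_apply hn hd (sum_dcoset_rot hn hd l m z), phiHom_xGen hn hd]
  have h1 : heckeT (rot d ^ z) * ∑ w ∈ dcoset hn hd m k g, heckeT w =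
      ∑ y ∈ shiftedDcoset hn hd m k z g, heckeT y := by
    rw [Finset.mul_sum, shiftedDcoset, Finset.sum_image fun _ _ _ _ e => mul_left_cancel e]
    exact Finset.sum_congr rfl fun w _ => heckeT_rot_mul hd w z
  have hc := refinement_isColoring hn hd l m z
  have h2 := hc.sum_left hd (shiftedDcoset hn hd m k z g) fun w hw y hy => by
    rw [mem_shiftedDcoset] at hy ⊢
    rw [← hy, show (rot d ^ z)⁻¹ * (w * y) =
      (rot d ^ z)⁻¹ * w * rot d ^ z * ((rot d ^ z)⁻¹ * y) by group]
    exact mat_mul_left hn hd _ (mem_fixer_refinement.1 hw).2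
  have h3 := hc.sum_right hd ((l.isColoring hn hd).fixset hd) fun w hw x hx => by
    rw [IsColoring.mem_fixset] at hx ⊢
    exact mul_mem hx (mem_fixer_refinement.1 hw).1
  rw [mul_assoc, h1, h2, ← mul_assoc, ← h3]
  rfl

/-- The product of the basis element of a translation with an arbitrary basis element. -/
theorem eElt_mul_eElt (hn : 0 < n) (hd : 0 < d) (l m k : Comp n d) (z : ℤ) (g : ExtWeyl d) :
    ∃ (M : Finset (Theta n d)) (F : Theta n d → Zv),
      eElt (mat hn hd l (rot d ^ z) m) * eElt (mat hn hd m g k) = ∑ A ∈ M, F A • eElt A ∧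
      (∀ A ∈ M, ∃ y, mat hn hd m ((rot d ^ z)⁻¹ * y) k = mat hn hd m g k ∧
        mat hn hd l y k = A) ∧
      ∀ g', IncOn l.color g' → mat hn hd m ((rot d ^ z)⁻¹ * g') k = mat hn hd m g k →
        (∀ u ∈ fixer d l.color, mat hn hd m ((rot d ^ z)⁻¹ * (u * g')) k = mat hn hd m g k →
          u ∈ fixer d (refinement l m z)) →
        mat hn hd l g' k ∈ M ∧ F (mat hn hd l g' k) = 1 := by
  have hc := l.isColoring hn hd
  have he : ∀ a b, refinement l m z a = refinement l m z b → l.color a = l.color b :=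
    fun a b h => refinement_left h
  set X := shiftedDcoset hn hd m k z g with hX
  have hXr : ∀ w ∈ fixer d k.color, ∀ x, x * w ∈ X ↔ x ∈ X := by
    intro w hw x
    rw [hX, mem_shiftedDcoset, mem_shiftedDcoset, ← mul_assoc, mat_mul_right hn hd _ hw]
  -- The coefficient of `T_y` in the product; `hf` shows that it depends only on the matrix of `y`,
  -- so it can be read as a function `F` of matrices.
  let f : ExtWeyl d → Zv := hc.mult hd (X.filter (IncOn (refinement l m z)))
  have hf : ∀ y y', mat hn hd l y k = mat hn hd l y' k → f y = f y' := by
    intro y y' h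
    rw [mat_eq_mat_iff, DoubleCoset.mem_doubleCoset, parabolic_eq_fixer hn hd,
      parabolic_eq_fixer hn hd] at h
    obtain ⟨w, hw, w', hw', rfl⟩ := h
    exact (hc.mult_right (k.isColoring hn hd) hd he X hXr hw' _).trans (hc.mult_left hd _ hw _)
  -- `V` contains every `y` that can occur, and it is a union of double cosets (`hVd`).
  let V : Finset (ExtWeyl d) := (hc.fixset hd ×ˢ X).image fun p => p.1 * p.2
  have hV : ∀ y, y ∈ V ↔ ∃ w ∈ fixer d l.color, ∃ x ∈ X, w * x = y := by
    intro y
    simp only [V, Finset.mem_image, Finset.mem_product, Prod.exists, hc.mem_fixset]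
    constructor
    · rintro ⟨w, x, ⟨h1, h2⟩, h3⟩; exact ⟨w, h1, x, h2, h3⟩
    · rintro ⟨w, h1, x, h2, h3⟩; exact ⟨w, x, ⟨h1, h2⟩, h3⟩
  let F : Theta n d → Zv := fun A => if h : ∃ y, mat hn hd l y k = A then f h.choose else 0
  have hF : ∀ y, F (mat hn hd l y k) = f y := by
    intro y
    have h : ∃ y', mat hn hd l y' k = mat hn hd l y k := ⟨y, rfl⟩
    simp only [F, dif_pos h]
    exact hf _ _ h.choose_spec
  have hVd : ∀ y ∈ V, ∀ y', mat hn hd l y' k = mat hn hd l y k → y' ∈ V := by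
    intro y hy y' h
    rw [mat_eq_mat_iff, DoubleCoset.mem_doubleCoset, parabolic_eq_fixer hn hd,
      parabolic_eq_fixer hn hd] at h
    obtain ⟨w, hw, w', hw', rfl⟩ := h
    rw [hV] at hy ⊢
    obtain ⟨u, hu, x, hx, rfl⟩ := hy
    exact ⟨w * u, mul_mem hw hu, x * w', (hXr w' hw' x).2 hx, by group⟩
  refine ⟨V.image fun y => mat hn hd l y k, F, ?_, ?_, ?_⟩
  · have hrep : ∀ A : Theta n d, ∃ φ : xIdeal k →ₗ[(Hecke d)ᵐᵒᵖ] xIdeal l,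
        A ∈ (V.image fun y => mat hn hd l y k) → eElt A = ofHom φ ∧
          (φ (xGen k) : Hecke d) = ∑ w ∈ V with mat hn hd l w k = A, heckeT w := by
      intro A
      by_cases hA : A ∈ V.image fun y => mat hn hd l y k
      · obtain ⟨y, hy, rfl⟩ := Finset.mem_image.1 hA
        refine ⟨phiHom l k y, fun _ => ⟨eElt_mat hn hd l k y, ?_⟩⟩
        rw [phiHom_xGen hn hd]
        refine Finset.sum_congr ?_ fun _ _ => rfl
        ext y'
        rw [mem_dcoset, Finset.mem_filter]
        exact ⟨fun h => ⟨hVd y hy y' h, h⟩, fun h => h.2⟩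
      · exact ⟨0, fun h => absurd h hA⟩
    choose φ hφ using hrep
    rw [eElt_mat, eElt_mat, phi_eq_ofHom, phi_eq_ofHom, ofHom_mul]
    have : phiHom l m (rot d ^ z) ∘ₗ phiHom m k g =
        ∑ A ∈ V.image fun y => mat hn hd l y k, F A • φ A := by
      apply xIdeal_hom_ext
      rw [phiHom_comp_xGen hn hd, hc.x_mul_sum hd _ V, LinearMap.sum_apply,
        AddSubmonoidClass.coe_finsetSum,
        ← Finset.sum_fiberwise_of_maps_to (t := V.image fun y => mat hn hd l y k)
          (g := fun y => mat hn hd l y k) fun y hy => Finset.mem_image_of_mem _ hy]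
      · refine Finset.sum_congr rfl fun A hA => ?_
        rw [LinearMap.smul_apply, Submodule.coe_smul_of_tower, (hφ A hA).2, Finset.smul_sum]
        refine Finset.sum_congr rfl fun y hy => ?_
        rw [← (Finset.mem_filter.1 hy).2, hF]
      · intro w hw y hy
        exact (hV _).2 ⟨w, hw, y, (Finset.mem_filter.1 hy).1, rfl⟩
    rw [this, ofHom_sum]
    refine Finset.sum_congr rfl fun A hA => ?_
    rw [ofHom_smul, (hφ A hA).1]
  · intro A hA
    obtain ⟨y, hy, rfl⟩ := Finset.mem_image.1 hA
    obtain ⟨w, hw, x, hx, rfl⟩ := (hV y).1 hy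
    -- The left factor in `W_λ` does not affect the matrix, so the witness can be taken in the
    -- shifted double coset itself.
    exact ⟨x, (mem_shiftedDcoset hn hd).1 hx, (mat_mul_left hn hd x hw).symm⟩
  · intro g' hg' h1 h2
    have hg'X : g' ∈ X := (mem_shiftedDcoset hn hd).2 h1
    refine ⟨Finset.mem_image_of_mem _ ((hV g').2 ⟨1, one_mem _, g', hg'X, one_mul g'⟩), ?_⟩
    rw [hF]
    exact hc.mult_eq_one (refinement_isColoring hn hd l m z) hd he X hg' hg'X
      fun u hu hux => h2 u hu ((mem_shiftedDcoset hn hd).1 hux)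

end Schur

/-! ### The numbers `d_A` -/

section DNum

variable {n d : ℕ}

/-- Summation over a finite set by the values of a function. -/
theorem finsum_ncard_fiber_mul {α β : Type*} {S : Set α} (hS : S.Finite) (f : α → β) (H : β → ℕ) :
    ∑ᶠ b, {t | t ∈ S ∧ f t = b}.ncard * H b = ∑ t ∈ hS.toFinset, H (f t) := by
  classical
  have hsub : (Function.support fun b => {t | t ∈ S ∧ f t = b}.ncard * H b) ⊆
      (hS.toFinset.image f : Finset β) := by
    intro b hb
    rw [Function.mem_support] at hb
    obtain ⟨t, ht⟩ := Set.nonempty_of_ncard_ne_zero (left_ne_zero_of_mul hb)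
    simp only [Finset.coe_image, Set.Finite.coe_toFinset, Set.mem_image]
    exact ⟨t, ht.1, ht.2⟩
  rw [finsum_eq_sum_of_support_subset _ hsub, Finset.sum_comp]
  refine Finset.sum_congr rfl fun b _ => ?_
  rw [← Set.ncard_coe_finset, smul_eq_mul]
  congr 2
  ext t
  simp

/-- The set of the integers that are inverted relative to `s` by a pair of equivariant
functions. -/
def invPairs (c e : EquivFun n d) (s : ℤ) : Set ℤ := {t | c.1 t ≤ c.1 s ∧ e.1 s < e.1 t}

theorem invPairs_finite (hn : 0 < n) (hd : 0 < d) (c e : EquivFun n d) (s : ℤ) :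
    (invPairs c e s).Finite :=
  (c.finite_le_le hn hd e (c.1 s) (e.1 s)).subset fun _ h => ⟨h.1, h.2.le⟩

theorem ncard_invPairs_add (c e : EquivFun n d) (s : ℤ) :
    (invPairs c e (s + d)).ncard = (invPairs c e s).ncard := by
  have : invPairs c e (s + d) = (fun t => t + (d : ℤ)) '' invPairs c e s := by
    ext t
    simp only [invPairs, Set.mem_ofPred_eq, Set.mem_image]
    constructor
    · rintro ⟨h1, h2⟩
      have h3 := c.2 (t - d)
      have h4 := e.2 (t - d)
      rw [sub_add_cancel] at h3 h4
      rw [c.2] at h1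
      rw [e.2] at h2
      exact ⟨t - d, ⟨by lia, by lia⟩, by ring⟩
    · rintro ⟨u, ⟨h1, h2⟩, rfl⟩
      rw [c.2, e.2, c.2, e.2]
      exact ⟨by lia, by lia⟩
  rw [this, Set.ncard_image_of_injective _ (add_left_injective _)]

theorem periodic_emod {f : ℤ → ℕ} (hf : ∀ s, f (s + d) = f s) (s : ℤ) : f (s % d) = f s := by
  have key : ∀ (q r : ℤ), f (r + q * d) = f r := by
    intro q r
    induction q using Int.induction_on with
    | zero => simp
    | succ q ih => rw [← ih, ← hf (r + q * d)]; congr 1; ring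
    | pred q ih => rw [← ih, ← hf (r + (-(q : ℤ) - 1) * d)]; congr 1; ring
  have := key (s / d) (s % d)
  rw [Int.emod_add_ediv_mul] at this
  exact this.symm

/-- Each unit of an entry `a_{ij}` is a point `s`, and the inner sum counts the `t` inverted
relative to it. The sum over the rows `1, …, n` is then moved to the transversal `0 ≤ s < d`. -/
theorem matOf_dNum (hn : 0 < n) (hd : 0 < d) (c e : EquivFun n d) :
    (matOf hn hd c e).dNum = ∑ s ∈ Finset.Ico (0 : ℤ) d, (invPairs c e s).ncard := by
  have hinner : ∀ i j : ℤ, (∑ᶠ p : ℤ × ℤ, if p.1 ≤ i ∧ j < p.2 then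
      (matOf hn hd c e).entry i j * (matOf hn hd c e).entry p.1 p.2 else 0) =
      {t | t ∈ {t | c.1 t = i} ∧ e.1 t = j}.ncard * {t | c.1 t ≤ i ∧ j < e.1 t}.ncard := by
    intro i j
    have hfin : {t | c.1 t ≤ i ∧ j < e.1 t}.Finite :=
      (c.finite_le_le hn hd e i j).subset fun _ h => ⟨h.1, h.2.le⟩
    have h1 := finsum_ite_ncard (fun t => (c.1 t, e.1 t)) (fun p : ℤ × ℤ => p.1 ≤ i ∧ j < p.2) hfin
    rw [← h1, mul_finsum]
    refine finsum_congr fun p => ?_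
    rw [mul_ite, mul_zero]
    simp only [matOf_entry, Prod.ext_iff, Set.mem_ofPred_eq]
  have hper : {t | 1 ≤ c.1 t ∧ c.1 t ≤ n}.Finite :=
    (c.finite_le_le hn hd c n 1).subset fun t h => ⟨h.2, h.1⟩
  have h2 : (matOf hn hd c e).dNum = ∑ s ∈ hper.toFinset, (invPairs c e s).ncard := by
    rw [Theta.dNum, ← Finset.sum_fiberwise_of_maps_to (s := hper.toFinset)
      (t := Finset.Icc (1 : ℤ) n) (g := c.1) (fun t ht => by simpa using ht)]
    refine Finset.sum_congr rfl fun i hi => ?_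
    rw [finsum_congr (hinner i), finsum_ncard_fiber_mul (c.finite_eq hn hd i) e.1
      fun j => {t | c.1 t ≤ i ∧ j < e.1 t}.ncard]
    have hset : (c.finite_eq hn hd i).toFinset = hper.toFinset.filter fun t => c.1 t = i := by
      ext t
      rw [Finset.mem_Icc] at hi
      simp only [Set.Finite.mem_toFinset, Finset.mem_filter, Set.mem_ofPred_eq]
      constructor
      · rintro rfl; exact ⟨hi, rfl⟩
      · exact fun h => h.2
    rw [hset]
    refine Finset.sum_congr rfl fun s hs => ?_
    rw [← (Finset.mem_filter.1 hs).2]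
    rfl
  rw [h2]
  have himg := c.image_period hn hd
  refine Finset.sum_bij (fun s _ => s % d) ?_ ?_ ?_ ?_
  · intro s hs
    rw [Set.Finite.mem_toFinset] at hs
    rw [← Finset.mem_coe, ← himg]
    exact ⟨s, hs, rfl⟩
  · intro s hs s' hs' h
    rw [Set.Finite.mem_toFinset] at hs hs'
    exact c.injOn_period hs hs' h
  · intro r hr
    rw [← Finset.mem_coe, ← himg] at hr
    obtain ⟨s, hs, rfl⟩ := hr
    exact ⟨s, (Set.Finite.mem_toFinset _).2 hs, rfl⟩
  · intro s _
    exact (periodic_emod (f := fun s => (invPairs c e s).ncard) (ncard_invPairs_add c e) s).symm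

end DNum

/-! ### Shifting the outermost diagonal -/

section Shift

variable {n d : ℕ}

/-- The function that agrees with `c` except where `e - c` has the extremal value `ε k`; there it
is moved by `ε`. -/
def EquivFun.push (ε k : ℤ) (c e : EquivFun n d) : EquivFun n d :=
  ⟨fun t => if e.1 t = c.1 t + ε * k then c.1 t + ε else c.1 t, fun t => by
    beta_reduce
    have : e.1 (t + d) = c.1 (t + d) + ε * k ↔ e.1 t = c.1 t + ε * k := by
      rw [c.2, e.2]
      constructor <;> intro h <;> linarith
    rw [if_congr this rfl rfl, c.2]
    split_ifs <;> ring⟩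

theorem EquivFun.push_of_eq {ε k : ℤ} {c e : EquivFun n d} {t : ℤ} (h : e.1 t = c.1 t + ε * k) :
    (EquivFun.push ε k c e).1 t = c.1 t + ε := if_pos h

theorem EquivFun.push_of_ne {ε k : ℤ} {c e : EquivFun n d} {t : ℤ} (h : e.1 t ≠ c.1 t + ε * k) :
    (EquivFun.push ε k c e).1 t = c.1 t := if_neg h

theorem EquivFun.push_cases (ε k : ℤ) (c e : EquivFun n d) (t : ℤ) :
    (e.1 t = c.1 t + ε * k ∧ (EquivFun.push ε k c e).1 t = c.1 t + ε) ∨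
      (e.1 t ≠ c.1 t + ε * k ∧ (EquivFun.push ε k c e).1 t = c.1 t) := by
  by_cases h : e.1 t = c.1 t + ε * k
  · exact Or.inl ⟨h, push_of_eq h⟩
  · exact Or.inr ⟨h, push_of_ne h⟩

variable {ε k : ℤ} {c e : EquivFun n d}

/-- All values of `ε (e - c)` are at most `k`. -/
def Bounded (ε k : ℤ) (c e : EquivFun n d) : Prop := ∀ t, ε * (e.1 t - c.1 t) ≤ k

/-- At each `s`, the pairs inverted by `(c, e)` are those inverted by `(c, p)` together with those
inverted by `(p, e)`, where `p` is the pushed function. The two kinds are disjoint because they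
order `p s` and `p t` oppositely; the bound `k` ensures that no other inversions enter. -/
theorem dNum_push (hn : 0 < n) (hd : 0 < d) (hε : ε = 1 ∨ ε = -1)
    (hb : Bounded ε k c e) :
    (matOf hn hd c e).dNum = (matOf hn hd c (EquivFun.push ε k c e)).dNum +
      (matOf hn hd (EquivFun.push ε k c e) e).dNum := by
  rw [matOf_dNum, matOf_dNum, matOf_dNum, ← Finset.sum_add_distrib]
  refine Finset.sum_congr rfl fun s _ => ?_
  rw [← Set.ncard_union_eq _ (invPairs_finite hn hd _ _ s) (invPairs_finite hn hd _ _ s)]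
  · congr 1
    ext t
    simp only [invPairs, Set.mem_union, Set.mem_ofPred_eq]
    have hs := hb s
    have ht := hb t
    rcases hε with rfl | rfl <;>
    rcases EquivFun.push_cases _ k c e s with ⟨h1, h2⟩ | ⟨h1, h2⟩ <;>
    rcases EquivFun.push_cases _ k c e t with ⟨h3, h4⟩ | ⟨h3, h4⟩ <;>
    rw [h2, h4] <;> lia
  · rw [Set.disjoint_left]
    rintro t ⟨-, h1⟩ ⟨h2, -⟩
    lia

theorem ncard_eq_add_of_push {S S'' D : Set ℤ} (hS : S.Finite) (h1 : S'' ⊆ S) (h2 : S \ S'' = D) :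
    S.ncard = S''.ncard + D.ncard := by
  rw [← h2, Set.ncard_sdiff h1 (hS.subset h1)]
  have := Set.ncard_le_ncard h1 hS
  lia

/-- On the side of the shifted diagonal, passing from `p` back to `c` adds to `σ_{ij}` the pushed
points of row `i` that lie in the corner. On the other side, `σ_{ij}` can only decrease for `f` and
does not decrease for `e`. -/
theorem leA_of_push (hn : 0 < n) (hd : 0 < d) (hε : ε = 1 ∨ ε = -1) (hk : 0 < k)
    (hb : Bounded ε k c e) (f : EquivFun n d)
    (h : (matOf hn hd (EquivFun.push ε k c e) f).LeA (matOf hn hd (EquivFun.push ε k c e) e)) :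
    (matOf hn hd c f).LeA (matOf hn hd c e) := by
  obtain ⟨-, h2, h3⟩ := h
  refine ⟨?_, ?_, ?_⟩
  · funext i
    rw [matOf_ro, matOf_ro]
  · funext j
    have := congrFun h2 j
    rwa [matOf_co, matOf_co] at this ⊢
  intro i j hij
  have h3' := h3 i j hij
  rcases hε with rfl | rfl
  · rcases lt_or_gt_of_ne hij with hlt | hlt
    · rw [matOf_sigma_of_lt hn hd _ _ hlt, matOf_sigma_of_lt hn hd _ _ hlt] at h3' ⊢
      have key : ∀ g : EquivFun n d, {t | c.1 t ≤ i ∧ j ≤ g.1 t}.ncard =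
          {t | (EquivFun.push 1 k c e).1 t ≤ i ∧ j ≤ g.1 t}.ncard +
            {t | (c.1 t = i ∧ e.1 t = i + k) ∧ j ≤ g.1 t}.ncard := by
        intro g
        refine ncard_eq_add_of_push (c.finite_le_le hn hd g i j) ?_ ?_
        · rintro t ⟨h4, h5⟩
          refine ⟨?_, h5⟩
          rcases EquivFun.push_cases 1 k c e t with ⟨-, h7⟩ | ⟨-, h7⟩ <;> lia
        · ext t
          simp only [Set.mem_sdiff, Set.mem_ofPred_eq]
          rcases EquivFun.push_cases 1 k c e t with ⟨h6, h7⟩ | ⟨h6, h7⟩ <;> rw [h7] <;> lia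
      rw [key f, key e]
      refine add_le_add h3' ?_
      -- If `j ≤ i + k`, for `e` all pushed points of row `i` lie in the corner, which is the
      -- maximal possible contribution. Otherwise the corner at `(i + 1, j)` is empty for `(p, e)`,
      -- hence for `(p, f)`, and no pushed point contributes.
      by_cases hjk : j ≤ i + k
      · refine Set.ncard_le_ncard ?_ ((c.finite_eq hn hd i).subset fun t ht => ht.1.1)
        rintro t ⟨h4, -⟩
        exact ⟨h4, by lia⟩
      · have hempty : {t | (EquivFun.push 1 k c e).1 t ≤ i + 1 ∧ j ≤ e.1 t} = ∅ := by
          ext t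
          simp only [Set.mem_ofPred_eq, Set.mem_empty_iff_false, iff_false]
          have := hb t
          rcases EquivFun.push_cases 1 k c e t with ⟨h6, h7⟩ | ⟨h6, h7⟩ <;> rw [h7] <;> lia
        have h4 := h3 (i + 1) j (by lia)
        rw [matOf_sigma_of_lt hn hd _ _ (by lia), matOf_sigma_of_lt hn hd _ _ (by lia), hempty,
          Set.ncard_empty, Nat.le_zero, Set.ncard_eq_zero (EquivFun.finite_le_le hn hd _ _ _ _)] at h4
        have h5 : {t | (c.1 t = i ∧ e.1 t = i + k) ∧ j ≤ f.1 t} = ∅ := by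
          rw [Set.eq_empty_iff_forall_notMem] at h4 ⊢
          rintro t ⟨⟨h5, h6⟩, h7⟩
          refine h4 t ⟨?_, h7⟩
          rw [EquivFun.push_of_eq (by lia)]
          lia
        rw [h5, Set.ncard_empty]
        exact Nat.zero_le _
    · rw [matOf_sigma_of_gt hn hd _ _ hlt, matOf_sigma_of_gt hn hd _ _ hlt] at h3' ⊢
      refine le_trans (Set.ncard_le_ncard ?_ ?_) (h3'.trans (Set.ncard_le_ncard ?_ ?_))
      · rintro t ⟨h4, h5⟩
        refine ⟨?_, h5⟩
        rcases EquivFun.push_cases 1 k c e t with ⟨-, h7⟩ | ⟨-, h7⟩ <;> lia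
      · exact (EquivFun.finite_le_le hn hd f (EquivFun.push 1 k c e) j i).subset
          fun t ht => ⟨ht.2, ht.1⟩
      -- A pushed point has `e t = c t + k ≥ p t`, so it cannot lie in a corner strictly below the
      -- diagonal.
      · rintro t ⟨h4, h5⟩
        refine ⟨?_, h5⟩
        rcases EquivFun.push_cases 1 k c e t with ⟨h6, h7⟩ | ⟨h6, h7⟩ <;> lia
      · exact (EquivFun.finite_le_le hn hd e c j i).subset fun t ht => ⟨ht.2, ht.1⟩
  · rcases lt_or_gt_of_ne hij with hlt | hlt
    · rw [matOf_sigma_of_lt hn hd _ _ hlt, matOf_sigma_of_lt hn hd _ _ hlt] at h3' ⊢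
      refine le_trans (Set.ncard_le_ncard ?_ ?_) (h3'.trans (Set.ncard_le_ncard ?_ ?_))
      · rintro t ⟨h4, h5⟩
        refine ⟨?_, h5⟩
        rcases EquivFun.push_cases (-1) k c e t with ⟨-, h7⟩ | ⟨-, h7⟩ <;> lia
      · exact EquivFun.finite_le_le hn hd _ _ _ _
      · rintro t ⟨h4, h5⟩
        refine ⟨?_, h5⟩
        rcases EquivFun.push_cases (-1) k c e t with ⟨h6, h7⟩ | ⟨h6, h7⟩ <;> lia
      · exact EquivFun.finite_le_le hn hd _ _ _ _
    · rw [matOf_sigma_of_gt hn hd _ _ hlt, matOf_sigma_of_gt hn hd _ _ hlt] at h3' ⊢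
      have key : ∀ g : EquivFun n d, {t | i ≤ c.1 t ∧ g.1 t ≤ j}.ncard =
          {t | i ≤ (EquivFun.push (-1) k c e).1 t ∧ g.1 t ≤ j}.ncard +
            {t | (c.1 t = i ∧ e.1 t = i - k) ∧ g.1 t ≤ j}.ncard := by
        intro g
        refine ncard_eq_add_of_push ((EquivFun.finite_le_le hn hd g c j i).subset
          fun t ht => ⟨ht.2, ht.1⟩) ?_ ?_
        · rintro t ⟨h4, h5⟩
          refine ⟨?_, h5⟩
          rcases EquivFun.push_cases (-1) k c e t with ⟨-, h7⟩ | ⟨-, h7⟩ <;> lia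
        · ext t
          simp only [Set.mem_sdiff, Set.mem_ofPred_eq]
          rcases EquivFun.push_cases (-1) k c e t with ⟨h6, h7⟩ | ⟨h6, h7⟩ <;> rw [h7] <;> lia
      rw [key f, key e]
      refine add_le_add h3' ?_
      by_cases hjk : i - k ≤ j
      · refine Set.ncard_le_ncard ?_ ((c.finite_eq hn hd i).subset fun t ht => ht.1.1)
        rintro t ⟨h4, -⟩
        exact ⟨h4, by lia⟩
      · have hempty : {t | i - 1 ≤ (EquivFun.push (-1) k c e).1 t ∧ e.1 t ≤ j} = ∅ := by
          ext t
          simp only [Set.mem_ofPred_eq, Set.mem_empty_iff_false, iff_false]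
          have := hb t
          rcases EquivFun.push_cases (-1) k c e t with ⟨h6, h7⟩ | ⟨h6, h7⟩ <;> rw [h7] <;> lia
        have h4 := h3 (i - 1) j (by lia)
        rw [matOf_sigma_of_gt hn hd _ _ (by lia), matOf_sigma_of_gt hn hd _ _ (by lia), hempty,
          Set.ncard_empty, Nat.le_zero, Set.ncard_eq_zero
            ((EquivFun.finite_le_le hn hd f (EquivFun.push (-1) k c e) j (i - 1)).subset
              fun t ht => ⟨ht.2, ht.1⟩)] at h4
        have h5 : {t | (c.1 t = i ∧ e.1 t = i - k) ∧ f.1 t ≤ j} = ∅ := by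
          rw [Set.eq_empty_iff_forall_notMem] at h4 ⊢
          rintro t ⟨⟨h5, h6⟩, h7⟩
          refine h4 t ⟨?_, h7⟩
          rw [EquivFun.push_of_eq (by lia)]
          lia
        rw [h5, Set.ncard_empty]
        exact Nat.zero_le _

/-- A matrix below the shifted matrix has no entries on the diagonal that was shifted. -/
theorem ne_of_leA_push (hn : 0 < n) (hd : 0 < d) (hε : ε = 1 ∨ ε = -1) (hk : 0 < k)
    (hb : Bounded ε k c e) (f : EquivFun n d)
    (h : (matOf hn hd (EquivFun.push ε k c e) f).LeA (matOf hn hd (EquivFun.push ε k c e) e))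
    (t : ℤ) : f.1 t ≠ (EquivFun.push ε k c e).1 t + ε * k := by
  intro ht
  have h3 := h.2.2 ((EquivFun.push ε k c e).1 t) (f.1 t)
  rcases hε with rfl | rfl
  · have hempty : {s | (EquivFun.push 1 k c e).1 s ≤ (EquivFun.push 1 k c e).1 t ∧
        f.1 t ≤ e.1 s} = ∅ := by
      ext s
      simp only [Set.mem_ofPred_eq, Set.mem_empty_iff_false, iff_false]
      have := hb s
      rcases EquivFun.push_cases 1 k c e s with ⟨h6, h7⟩ | ⟨h6, h7⟩ <;> rw [h7] <;> lia
    have h4 := h3 (by lia)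
    rw [matOf_sigma_of_lt hn hd _ _ (by lia), matOf_sigma_of_lt hn hd _ _ (by lia), hempty,
      Set.ncard_empty, Nat.le_zero, Set.ncard_eq_zero (EquivFun.finite_le_le hn hd _ _ _ _),
      Set.eq_empty_iff_forall_notMem] at h4
    exact h4 t ⟨le_rfl, le_rfl⟩
  · have hempty : {s | (EquivFun.push (-1) k c e).1 t ≤ (EquivFun.push (-1) k c e).1 s ∧
        e.1 s ≤ f.1 t} = ∅ := by
      ext s
      simp only [Set.mem_ofPred_eq, Set.mem_empty_iff_false, iff_false]
      have := hb s
      rcases EquivFun.push_cases (-1) k c e s with ⟨h6, h7⟩ | ⟨h6, h7⟩ <;> rw [h7] <;> lia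
    have h4 := h3 (by lia)
    rw [matOf_sigma_of_gt hn hd _ _ (by lia), matOf_sigma_of_gt hn hd _ _ (by lia), hempty,
      Set.ncard_empty, Nat.le_zero, Set.ncard_eq_zero
        ((EquivFun.finite_le_le hn hd f (EquivFun.push (-1) k c e) _ _).subset
          fun t ht => ⟨ht.2, ht.1⟩), Set.eq_empty_iff_forall_notMem] at h4
    exact h4 t ⟨le_rfl, le_rfl⟩

/-- An element that preserves `c` and moves `e` to a function without values on the shifted
diagonal preserves the shifted function. -/
theorem act_push_of_ne (hn : 0 < n) (hd : 0 < d) {w : ExtWeyl d} (hw : c.act w = c)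
    (h : ∀ t, (e.act w).1 t ≠ (EquivFun.push ε k c e).1 t + ε * k) :
    (EquivFun.push ε k c e).act w = EquivFun.push ε k c e := by
  have hw' : ∀ t, c.1 (w.1 t) = c.1 t := EquivFun.mem_fixer_iff.2 hw
  have himp : ∀ t, (e.act w).1 t = c.1 t + ε * k → e.1 t = c.1 t + ε * k := by
    intro t ht
    by_contra hne
    exact h t (by rw [EquivFun.push_of_ne hne, ht])
  have hiff : ∀ t, (e.act w).1 t = c.1 t + ε * k ↔ e.1 t = c.1 t + ε * k := by
    intro t
    refine ⟨himp t, fun ht => ?_⟩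
    have hsub : {s | c.1 s = c.1 t ∧ (e.act w).1 s = c.1 t + ε * k} ⊆
        {s | c.1 s = c.1 t ∧ e.1 s = c.1 t + ε * k} := by
      rintro s ⟨h1, h2⟩
      exact ⟨h1, by rw [← h1]; exact himp s (by rw [h1, h2])⟩
    -- Within each fibre of `c`, `e` and its translate by `w` have equally many points on the
    -- extremal diagonal, since `w` fixes `c`; the inclusion `hsub` is therefore an equality.
    have hcard : {s | c.1 s = c.1 t ∧ e.1 s = c.1 t + ε * k}.ncard =
        {s | c.1 s = c.1 t ∧ (e.act w).1 s = c.1 t + ε * k}.ncard := by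
      have := congrArg (fun A => A.entry (c.1 t) (c.1 t + ε * k)) (matOf_act hn hd w c e)
      simp only [matOf_entry, hw] at this
      exact this.symm
    have := Set.eq_of_subset_of_ncard_le hsub hcard.le
      ((c.finite_eq hn hd (c.1 t)).subset fun s hs => hs.1)
    exact (this.symm.subset ⟨rfl, ht⟩ : t ∈ {s | c.1 s = c.1 t ∧ (e.act w).1 s = c.1 t + ε * k}).2
  rw [← EquivFun.mem_fixer_iff]
  intro t
  have h1 := hiff (w.1 t)
  rw [EquivFun.act_apply, inv_apply_self, hw'] at h1
  rcases EquivFun.push_cases ε k c e t with ⟨h2, h3⟩ | ⟨h2, h3⟩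
  · rw [h3, EquivFun.push_of_eq (by rw [hw']; exact h1.1 h2), hw']
  · rw [h3, EquivFun.push_of_ne (by rw [hw']; exact fun h4 => h2 (h1.2 h4)), hw']

end Shift

/-! ### Products with bidiagonal matrices -/

section Step

variable {n d : ℕ}

/-- A monotone equivariant function is a translate of the coloring of a composition. -/
theorem EquivFun.exists_rot (hn : 0 < n) (hd : 0 < d) (c : EquivFun n d) (hc : Monotone c.1) :
    ∃ (m : Comp n d) (z : ℤ), (m.fn hn hd).act (rot d ^ z) = c := by
  obtain ⟨m, h, hmh⟩ := c.exists_comp hn hd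
  obtain ⟨w, hw, hi⟩ := (m.isColoring hn hd).exists_mul hd h⁻¹
  have h1 : (m.fn hn hd).act (h * w⁻¹) = c := by
    rw [EquivFun.act_mul, EquivFun.act_of_mem_fixer (inv_mem hw : w⁻¹ ∈ fixer d (m.fn hn hd).1), hmh]
  have hmono : StrictMono (h * w⁻¹).1 := by
    intro a b hab
    have hval : ∀ t, c.1 ((h * w⁻¹).1 t) = m.color t := by
      intro t
      rw [← h1, EquivFun.act_apply, inv_apply_self]
      rfl
    by_cases hcol : m.color a = m.color b
    · have := hi a b hab hcol
      rwa [mul_inv_rev, inv_inv] at this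
    · by_contra hge
      have h2 := hc (not_lt.1 hge)
      rw [hval, hval] at h2
      exact hcol (le_antisymm (m.color_mono hn hd hab.le) h2)
  obtain ⟨z, hz⟩ := exists_rot_zpow_of_strictMono hmono
  exact ⟨m, z, by rw [← hz, h1]⟩

theorem mat_inv_mul (hn : 0 < n) (hd : 0 < d) (m k : Comp n d) (h y : ExtWeyl d) :
    mat hn hd m (h⁻¹ * y) k = matOf hn hd ((m.fn hn hd).act h) ((k.fn hn hd).act y) := by
  rw [mat, ← matOf_act hn hd h, ← EquivFun.act_mul, mul_inv_cancel_left]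

theorem Theta.LeA.refl (A : Theta n d) : A.LeA A := ⟨rfl, rfl, fun _ _ _ => le_rfl⟩

/-- The span of the standard basis elements below `U`. -/
def lowerSpan (U : Theta n d) : Submodule Zv (Schur n d) :=
  Submodule.span Zv (std '' {A | A.LtA U})

theorem eElt_eq_smul_std (A : Theta n d) : eElt A = vpow A.dNum • std A := by
  rw [std, smul_smul, ← vpow_add, add_neg_cancel, vpow_zero, one_smul]

theorem std_mul_std {B A : Theta n d} {M : Finset (Theta n d)} {F : Theta n d → Zv}
    (h : eElt B * eElt A = ∑ C ∈ M, F C • eElt C) :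
    std B * std A = ∑ C ∈ M, (vpow (-B.dNum - A.dNum + C.dNum) * F C) • std C := by
  rw [std, std, smul_mul_smul_comm, h, Finset.smul_sum]
  refine Finset.sum_congr rfl fun C _ => ?_
  rw [eElt_eq_smul_std C, smul_smul, smul_smul, ← vpow_add, mul_right_comm, ← vpow_add,
    sub_eq_add_neg]

/-- Within a fibre of `c` the function `e` is weakly increasing because `g` is shortest. The pushed
points are thus the last ones for `ε = 1` and the first ones for `ε = -1`, and a push by one does
not cross a neighbouring fibre. -/
theorem monotone_push (hn : 0 < n) (hd : 0 < d) {ε k : ℤ} (hε : ε = 1 ∨ ε = -1) {l m : Comp n d}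
    {g : ExtWeyl d} (hg : IncOn l.color g)
    (hb : Bounded ε k (l.fn hn hd) ((m.fn hn hd).act g)) :
    Monotone (EquivFun.push ε k (l.fn hn hd) ((m.fn hn hd).act g)).1 := by
  refine monotone_iff_forall_lt.2 fun s t hst => ?_
  have hcm : (l.fn hn hd).1 s ≤ (l.fn hn hd).1 t := l.color_mono hn hd hst.le
  have hem : (l.fn hn hd).1 s = (l.fn hn hd).1 t →
      ((m.fn hn hd).act g).1 s ≤ ((m.fn hn hd).act g).1 t := fun h =>
    m.color_mono hn hd (hg s t hst h).le
  have hs := hb s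
  have ht := hb t
  rcases hε with rfl | rfl <;>
  rcases EquivFun.push_cases _ k (l.fn hn hd) ((m.fn hn hd).act g) s with ⟨h1, h2⟩ | ⟨h1, h2⟩ <;>
  rcases EquivFun.push_cases _ k (l.fn hn hd) ((m.fn hn hd).act g) t with ⟨h3, h4⟩ | ⟨h3, h4⟩ <;>
  rw [h2, h4] <;> lia

theorem entry_matOf_push_right (hn : 0 < n) (hd : 0 < d) {ε k : ℤ} (c e : EquivFun n d)
    {i j : ℤ} (hij : j ≠ i) : (matOf hn hd c (EquivFun.push ε k c e)).entry i j =
      if j = i + ε then (matOf hn hd c e).entry i (i + ε * k) else 0 := by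
  rw [matOf_entry]
  split_ifs with h
  · rw [matOf_entry]
    congr 1
    ext t
    simp only [Set.mem_ofPred_eq]
    rcases EquivFun.push_cases ε k c e t with ⟨h1, h2⟩ | ⟨h1, h2⟩ <;> rw [h2]
    · constructor
      · rintro ⟨rfl, -⟩; exact ⟨rfl, h1⟩
      · rintro ⟨rfl, -⟩; exact ⟨rfl, h.symm⟩
    · constructor
      · rintro ⟨rfl, h3⟩; exact absurd h3.symm hij
      · rintro ⟨rfl, h3⟩; exact absurd h3 h1
  · have : {t | c.1 t = i ∧ (EquivFun.push ε k c e).1 t = j} = ∅ := by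
      ext t
      simp only [Set.mem_ofPred_eq, Set.mem_empty_iff_false, iff_false]
      rintro ⟨rfl, h3⟩
      rcases EquivFun.push_cases ε k c e t with ⟨-, h2⟩ | ⟨-, h2⟩
      · exact h (by rw [← h3, h2])
      · exact hij (by rw [← h3, h2])
    rw [this, Set.ncard_empty]

/-- The truncated subtraction loses nothing: the diagonal part is either the whole entry or zero. -/
theorem entry_matOf_push_left (hn : 0 < n) (hd : 0 < d) {ε k : ℤ} (hε : ε = 1 ∨ ε = -1)
    (c e : EquivFun n d) (i j : ℤ) : (matOf hn hd (EquivFun.push ε k c e) e).entry i j =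
      (matOf hn hd c e).entry i j - (matOf hn hd c e).diagonalPart (ε * k) i j +
        (matOf hn hd c e).diagonalPart (ε * k) (i - ε) j := by
  have hε0 : ε ≠ 0 := by rcases hε with rfl | rfl <;> decide
  rw [Theta.diagonalPart, Theta.diagonalPart, matOf_entry, matOf_entry, matOf_entry]
  have h1 : {t | (EquivFun.push ε k c e).1 t = i ∧ e.1 t = j} =
      {t | (c.1 t = i ∧ e.1 t = j) ∧ j ≠ i + ε * k} ∪
        {t | (c.1 t = i - ε ∧ e.1 t = j) ∧ j = i - ε + ε * k} := by
    ext t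
    simp only [Set.mem_ofPred_eq, Set.mem_union]
    rcases EquivFun.push_cases ε k c e t with ⟨h1, h2⟩ | ⟨h1, h2⟩ <;> rw [h2]
    · constructor
      · rintro ⟨h3, rfl⟩
        exact Or.inr ⟨⟨by linarith, rfl⟩, by rw [h1]; linarith⟩
      · rintro (⟨⟨rfl, rfl⟩, h4⟩ | ⟨⟨h3, h4⟩, -⟩)
        · exact absurd h1 h4
        · exact ⟨by linarith, h4⟩
    · constructor
      · rintro ⟨rfl, rfl⟩
        exact Or.inl ⟨⟨rfl, rfl⟩, h1⟩
      · rintro (⟨h3, -⟩ | ⟨⟨h3, rfl⟩, h4⟩)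
        · exact h3
        · exact absurd (h4.trans (by rw [h3])) h1
  rw [h1, Set.ncard_union_eq ?_ ((c.finite_eq hn hd i).subset fun t ht => ht.1.1)
    ((c.finite_eq hn hd (i - ε)).subset fun t ht => ht.1.1)]
  · by_cases h2 : j = i + ε * k
    · rw [if_pos h2, Nat.sub_self, zero_add, if_neg (fun h3 => hε0 (by linarith))]
      have h4 : {t | (c.1 t = i ∧ e.1 t = j) ∧ j ≠ i + ε * k} = ∅ := by simp [h2]
      have h5 : {t | (c.1 t = i - ε ∧ e.1 t = j) ∧ j = i - ε + ε * k} = ∅ := by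
        ext t
        simp only [Set.mem_ofPred_eq, Set.mem_empty_iff_false, iff_false]
        rintro ⟨-, h3⟩
        exact hε0 (by linarith)
      rw [h4, h5, Set.ncard_empty]
    · rw [if_neg h2, Nat.sub_zero]
      simp only [ne_eq, h2, not_false_eq_true, and_true]
      congr 1
      split_ifs with h3
      · simp only [h3, and_true]
      · simp only [h3, and_false, Set.ofPred_false, Set.ncard_empty]
  · rw [Set.disjoint_left]
    rintro t ⟨⟨h2, -⟩, -⟩ ⟨⟨h3, -⟩, -⟩
    exact hε0 (by linarith)

/-- The bidiagonal matrix that shifts the outermost diagonal of `U`, and the triangularity of the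
multiplication by it. -/
theorem exists_shift (hn : 0 < n) (hd : 0 < d) {ε k : ℤ} (hε : ε = 1 ∨ ε = -1) (hk : 0 < k)
    (U : Theta n d) (hU : ∀ i j, k < ε * (j - i) → U.entry i j = 0) :
    ∃ B U' : Theta n d,
      (∀ i j, j ≠ i → B.entry i j = if j = i + ε then U.entry i (i + ε * k) else 0) ∧
      (∀ i j, U'.entry i j =
        U.entry i j - U.diagonalPart (ε * k) i j + U.diagonalPart (ε * k) (i - ε) j) ∧
      B.ro = U.ro ∧ B.co = U'.ro ∧ (∃ x ∈ lowerSpan U, std B * std U' = std U + x) ∧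
      ∀ A : Theta n d, A.LtA U' → std B * std A ∈ lowerSpan U := by
  classical
  obtain ⟨l, g, r, hmat⟩ : ∃ l g r, IsKappa l g r U := by
    obtain ⟨l, g, r, rfl⟩ := exists_mat_eq hn hd U
    obtain ⟨g', hg'⟩ := exists_kappa hn hd l r g
    exact ⟨l, g', r, hg'⟩
  obtain ⟨⟨hg, -⟩, hmat⟩ := (isKappa_iff hn hd).1 hmat
  set c := l.fn hn hd with hc
  set e := (r.fn hn hd).act g with he
  have hUe : U = matOf hn hd c e := hmat.symm
  have hb : Bounded ε k c e := by
    intro t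
    by_contra hlt
    have h1 := hU (c.1 t) (e.1 t) (not_le.1 hlt)
    rw [hUe, matOf_entry, Set.ncard_eq_zero ((c.finite_eq hn hd (c.1 t)).subset fun s hs => hs.1),
      Set.eq_empty_iff_forall_notMem] at h1
    exact h1 t ⟨rfl, rfl⟩
  set p := EquivFun.push ε k c e with hp
  obtain ⟨m, z, hmz⟩ := EquivFun.exists_rot hn hd p (monotone_push hn hd hε hg hb)
  have hB : matOf hn hd c p = mat hn hd l (rot d ^ z) m := by rw [mat, hmz]
  -- The rigidity used twice below: once for the uniqueness of the leading term, once for its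
  -- coefficient.
  have hfix : ∀ (w : ExtWeyl d), c.act w = c →
      (matOf hn hd p (e.act w)).LeA (matOf hn hd p e) → p.act w = p := fun w hw hle =>
    act_push_of_ne hn hd hw (ne_of_leA_push hn hd hε hk hb _ hle)
  have hprod : ∀ A : Theta n d, A.LeA (matOf hn hd p e) →
      ∃ (M : Finset (Theta n d)) (F : Theta n d → Zv),
        eElt (matOf hn hd c p) * eElt A = ∑ C ∈ M, F C • eElt C ∧ (∀ C ∈ M, C.LeA U) ∧
        (U ∈ M → A = matOf hn hd p e) ∧ (A = matOf hn hd p e → U ∈ M ∧ F U = 1) := by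
    intro A hA
    obtain ⟨m', g', r', hA'⟩ := exists_mat_eq hn hd A
    obtain rfl : m' = m := by
      refine Comp.ext_of_ncard hn hd fun i => ?_
      have := congrFun hA.1 i
      rw [← hA', mat, matOf_ro, matOf_ro, ← hmz, EquivFun.ncard_act] at this
      exact this
    obtain rfl : r' = r := by
      refine Comp.ext_of_ncard hn hd fun i => ?_
      have := congrFun hA.2.1 i
      rw [← hA', mat, matOf_co, matOf_co, EquivFun.ncard_act, he, EquivFun.ncard_act] at this
      exact this
    obtain ⟨M, F, h1, h2, h3⟩ := eElt_mul_eElt hn hd l m' r' z g'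
    rw [← hB, hA'] at h1
    have h2' : ∀ C ∈ M, ∃ f : EquivFun n d, matOf hn hd p f = A ∧ matOf hn hd c f = C := by
      intro C hC
      obtain ⟨y, hy1, hy2⟩ := h2 C hC
      rw [mat_inv_mul, hmz, hA'] at hy1
      exact ⟨_, hy1, hy2⟩
    refine ⟨M, F, h1, ?_, ?_, ?_⟩
    · intro C hC
      obtain ⟨f, hf1, rfl⟩ := h2' C hC
      rw [hUe]
      exact leA_of_push hn hd hε hk hb f (by rw [← hp, hf1]; exact hA)
    -- If `(c, f)` has matrix `U`, some `w ∈ W_λ` carries `e` to `f`. It also fixes `p`, so `(p, f)`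
    -- and `(p, e)` have the same matrix.
    · intro hUM
      obtain ⟨f, hf1, hf2⟩ := h2' U hUM
      rw [hUe] at hf2
      obtain ⟨w, hw1, hw2⟩ := exists_act_pair hn hd _ _ _ _ hf2.symm
      have hpw := hfix w hw1 (by rw [hw2, hf1]; exact hA)
      rw [← hf1, ← hw2, ← matOf_act hn hd w p e, hpw]
    -- Any `u ∈ W_λ` for which `u g` still lies in the shifted double coset fixes `p`, hence lies in
    -- the overlap group; this is the uniqueness condition for coefficient 1.
    · intro hAU
      have h4 := h3 g hg (by rw [mat_inv_mul, hmz, hA', hAU]) ?_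
      · rw [hmat] at h4
        exact h4
      · intro u hu hu2
        rw [mat_inv_mul, hmz, hA', hAU, EquivFun.act_mul, ← he] at hu2
        have hcu : c.act u = c := EquivFun.act_of_mem_fixer hu
        have hpu := hfix u hcu (by rw [hu2]; exact Theta.LeA.refl _)
        refine mem_fixer_refinement.2 ⟨hu, ?_⟩
        change _ ∈ fixer d (m'.fn hn hd).1
        rw [EquivFun.mem_fixer_iff, EquivFun.act_mul, EquivFun.act_mul, hmz, hpu, ← hmz,
          ← EquivFun.act_mul, inv_mul_cancel]
        exact EquivFun.act_of_mem_fixer (one_mem _)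
  have hlow : ∀ (M : Finset (Theta n d)) (F : Theta n d → Zv), (∀ C ∈ M, C.LtA U) →
      ∑ C ∈ M, F C • std C ∈ lowerSpan U := fun M F hM =>
    Submodule.sum_mem _ fun C hC => Submodule.smul_mem _ _
      (Submodule.subset_span ⟨C, hM C hC, rfl⟩)
  refine ⟨matOf hn hd c p, matOf hn hd p e, fun i j hij => ?_, fun i j => ?_, ?_, ?_, ?_, ?_⟩
  · rw [hUe]
    exact entry_matOf_push_right hn hd c e hij
  · rw [hUe]
    exact entry_matOf_push_left hn hd hε c e i j
  · rw [hUe]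
    funext i
    rw [matOf_ro, matOf_ro]
  · funext i
    rw [matOf_ro, matOf_co]
  · obtain ⟨M, F, h1, h2, -, h4⟩ := hprod _ (Theta.LeA.refl _)
    obtain ⟨hUM, hFU⟩ := h4 rfl
    have hd3 : U.dNum = (matOf hn hd c p).dNum + (matOf hn hd p e).dNum := by
      rw [hUe]; exact dNum_push hn hd hε hb
    rw [std_mul_std h1, ← Finset.add_sum_erase _ _ hUM, hFU, mul_one,
      show -((matOf hn hd c p).dNum : ℤ) - (matOf hn hd p e).dNum + U.dNum = 0 by
        rw [hd3]; push_cast; ring, vpow_zero, one_smul]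
    refine ⟨_, hlow _ _ fun C hC => ?_, rfl⟩
    rw [Finset.mem_erase] at hC
    exact ⟨h2 C hC.2, hC.1⟩
  · intro A hA
    obtain ⟨M, F, h1, h2, h3, -⟩ := hprod A hA.1
    rw [std_mul_std h1]
    refine hlow _ _ fun C hC => ⟨h2 C hC, ?_⟩
    rintro rfl
    exact hA.2 (h3 hC)

end Step

/-! ### The algorithm -/

section Algorithm

variable {n d : ℕ}

theorem Theta.exists_bandwidth (hn : 0 < n) (hd : 0 < d) (A : Theta n d) :
    ∃ K : ℕ, ∀ i j, A.entry i j ≠ 0 → |j - i| ≤ K := by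
  obtain ⟨l, e, rfl⟩ := A.exists_fn hn hd
  obtain ⟨C, hC⟩ := (l.fn hn hd).exists_bound hd
  obtain ⟨E, hE⟩ := e.exists_bound hd
  refine ⟨(C + E).toNat, fun i j hij => ?_⟩
  rw [matOf_entry] at hij
  obtain ⟨t, rfl, rfl⟩ := Set.nonempty_of_ncard_ne_zero hij
  have hd' : (1 : ℤ) ≤ d := by exact_mod_cast hd
  have h1 : |(d : ℤ) * (e.1 t - (l.fn hn hd).1 t)| ≤ C + E := by
    have h2 := abs_le.1 (hC t)
    have h3 := abs_le.1 (hE t)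
    rw [abs_le]
    constructor <;> linarith
  rw [abs_mul, Nat.abs_cast] at h1
  have h2 := abs_nonneg (e.1 t - (l.fn hn hd).1 t)
  have h3 : |e.1 t - (l.fn hn hd).1 t| ≤ C + E := by nlinarith
  exact h3.trans (Int.self_le_toNat _)

/-- This is how the row sum conditions pin down the diagonals that the algorithm leaves open. -/
theorem Theta.ext_of_offDiagonal {B B' : Theta n d} (h : ∀ i j, j ≠ i → B.entry i j = B'.entry i j)
    (hro : B.ro = B'.ro) : B = B' := by
  classical
  ext i j
  by_cases hij : j = i
  · subst hij
    have h1 := congrFun hro j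
    let S : Finset ℤ := insert j ((B.finite j).toFinset ∪ (B'.finite j).toFinset)
    have hS : Function.support (B.entry j) ⊆ S := by
      intro i hi
      simp only [S, Finset.coe_insert, Finset.coe_union, Set.Finite.coe_toFinset]
      exact Or.inr (Or.inl hi)
    have hS' : Function.support (B'.entry j) ⊆ S := by
      intro i hi
      simp only [S, Finset.coe_insert, Finset.coe_union, Set.Finite.coe_toFinset]
      exact Or.inr (Or.inr hi)
    rw [Theta.ro, Theta.ro, finsum_eq_sum_of_support_subset _ hS,
      finsum_eq_sum_of_support_subset _ hS',
      ← Finset.add_sum_erase S _ (Finset.mem_insert_self j _),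
      ← Finset.add_sum_erase S _ (Finset.mem_insert_self j _),
      Finset.sum_congr rfl fun i hi => h j i (Finset.ne_of_mem_erase hi)] at h1
    exact Nat.add_right_cancel h1
  · exact h i j hij

theorem UpperStep.unique {U B U' B₁ U₁ : Theta n d} (h : UpperStep U B U')
    (h₁ : UpperStep U B₁ U₁) (hro : B.ro = B₁.ro) : B = B₁ ∧ U' = U₁ := by
  obtain ⟨k, hk, ⟨i, hi⟩, h1, h2, h3⟩ := h
  obtain ⟨k₁, hk₁, ⟨i₁, hi₁⟩, h1₁, h2₁, h3₁⟩ := h₁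
  obtain rfl : k = k₁ := by
    rcases lt_trichotomy k k₁ with hlt | heq | hlt
    · exact absurd (h1 i₁ (i₁ + k₁) (by lia)) hi₁
    · exact heq
    · exact absurd (h1₁ i (i + k) (by lia)) hi
  refine ⟨Theta.ext_of_offDiagonal (fun i j hij => ?_) hro, ?_⟩
  · rw [h2 i j hij, h2₁ i j hij]
  · ext i j
    rw [h3, h3₁]

theorem LowerStep.unique {L B L' B₁ L₁ : Theta n d} (h : LowerStep L B L')
    (h₁ : LowerStep L B₁ L₁) (hro : B.ro = B₁.ro) : B = B₁ ∧ L' = L₁ := by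
  obtain ⟨k, hk, ⟨i, hi⟩, h1, h2, h3⟩ := h
  obtain ⟨k₁, hk₁, ⟨i₁, hi₁⟩, h1₁, h2₁, h3₁⟩ := h₁
  obtain rfl : k = k₁ := by
    rcases lt_trichotomy k k₁ with hlt | heq | hlt
    · exact absurd (h1 i₁ (i₁ - k₁) (by lia)) hi₁
    · exact heq
    · exact absurd (h1₁ i (i - k) (by lia)) hi
  refine ⟨Theta.ext_of_offDiagonal (fun i j hij => ?_) hro, ?_⟩
  · rw [h2 i j hij, h2₁ i j hij]
  · ext i j
    rw [h3, h3₁]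

/-- The column sums of each matrix of the list are the row sums of the next one. -/
abbrev Linked (Bs : List (Theta n d)) : Prop :=
  List.IsChain (fun B B' : Theta n d => B.co = B'.ro) Bs

theorem LowerLoop.unique {L : Theta n d} {Bs Bs' : List (Theta n d)} (h : LowerLoop L Bs)
    (h' : LowerLoop L Bs') (hl : Linked Bs) (hl' : Linked Bs')
    (hro : ∀ B ∈ Bs.head?, ∀ B' ∈ Bs'.head?, B.ro = B'.ro) : Bs = Bs' := by
  induction h generalizing Bs' with
  | done L hL =>
    cases h' with
    | done => rfl
    | step _ B L' Bs hn _ _ => exact absurd hL hn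
  | step L B L' Bs hn hs _ ih =>
    cases h' with
    | done _ hL => exact absurd hL hn
    | step _ B₁ L₁ Bs₁ _ hs₁ ht₁ =>
      obtain ⟨rfl, rfl⟩ := hs.unique hs₁ (hro B rfl B₁ rfl)
      rw [Linked, List.isChain_cons] at hl hl'
      rw [ih ht₁ hl.2 hl'.2 fun C hC C' hC' => (hl.1 C hC).symm.trans (hl'.1 C' hC')]

/-- The outermost diagonal determines `k`, the row sums determine `B`, and the column sums of `B`
pass the row sum condition on to the next factor, across the junction of the two loops. -/
theorem UpperLoop.unique {U L L' : Theta n d} {Bs Bs' Cs Cs' : List (Theta n d)}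
    (h : UpperLoop U Bs L) (h' : UpperLoop U Bs' L') (hL : LowerLoop L Cs) (hL' : LowerLoop L' Cs')
    (hl : Linked (Bs ++ Cs)) (hl' : Linked (Bs' ++ Cs'))
    (hro : ∀ B ∈ (Bs ++ Cs).head?, ∀ B' ∈ (Bs' ++ Cs').head?, B.ro = B'.ro) :
    Bs = Bs' ∧ Cs = Cs' := by
  induction h generalizing Bs' with
  | done U hU =>
    cases h' with
    | done => exact ⟨rfl, hL.unique hL' hl hl' hro⟩
    | step _ B L' _ Bs hn _ _ => exact absurd hU hn
  | step U B U' L Bs hn hs _ ih =>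
    cases h' with
    | done _ hU => exact absurd hU hn
    | step _ B₁ U₁ _ Bs₁ _ hs₁ ht₁ =>
      obtain ⟨rfl, rfl⟩ := hs.unique hs₁ (hro B rfl B₁ rfl)
      rw [List.cons_append, Linked, List.isChain_cons] at hl hl'
      obtain ⟨rfl, rfl⟩ := ih ht₁ hL hl.2 hl'.2
        fun C hC C' hC' => (hl.1 C hC).symm.trans (hl'.1 C' hC')
      exact ⟨rfl, rfl⟩

/-- The list is linked, starts with the row sums of `U`, and the product of its standard basis
elements has leading term `[U]`. -/
def Factors (U : Theta n d) (Bs : List (Theta n d)) : Prop :=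
  (∀ B ∈ Bs.head?, B.ro = U.ro) ∧ Linked Bs ∧
    ∃ x ∈ lowerSpan U, (Bs.map std).prod = std U + x

/-- The lower terms of the product for `U'` stay lower after multiplication by `[B]`; by linearity
it suffices to know this on the spanning elements. -/
theorem Factors.cons {U B U' : Theta n d} {Bs : List (Theta n d)} (h : Factors U' Bs)
    (hro : B.ro = U.ro) (hco : B.co = U'.ro) (h1 : ∃ x ∈ lowerSpan U, std B * std U' = std U + x)
    (h2 : ∀ A : Theta n d, A.LtA U' → std B * std A ∈ lowerSpan U) : Factors U (B :: Bs) := by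
  obtain ⟨h3, h4, y, hy, h5⟩ := h
  obtain ⟨x, hx, h1⟩ := h1
  refine ⟨?_, ?_, x + std B * y, ?_, ?_⟩
  · intro C hC
    rw [List.head?_cons, Option.mem_some_iff] at hC
    rwa [← hC]
  · exact List.isChain_cons.2 ⟨fun C hC => hco.trans (h3 C hC).symm, h4⟩
  · refine Submodule.add_mem _ hx ?_
    refine Submodule.span_induction (p := fun y _ => std B * y ∈ lowerSpan U) ?_ ?_ ?_ ?_ hy
    · rintro _ ⟨A, hA, rfl⟩
      exact h2 A hA
    · rw [mul_zero]; exact Submodule.zero_mem _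
    · intro a b _ _ ha hb
      rw [mul_add]; exact Submodule.add_mem _ ha hb
    · intro r a _ ha
      rw [mul_smul_comm]; exact Submodule.smul_mem _ r ha
  · rw [List.map_cons, List.prod_cons, h5, mul_add, h1, add_assoc]

/-- The outermost diagonal moves one step inwards, so the bandwidth on that side drops by one. -/
theorem entry_shift_eq_zero {ε k : ℤ} (hε : ε = 1 ∨ ε = -1) {U U' : Theta n d}
    (hU : ∀ i j, k < ε * (j - i) → U.entry i j = 0)
    (h : ∀ i j, U'.entry i j =
        U.entry i j - U.diagonalPart (ε * k) i j + U.diagonalPart (ε * k) (i - ε) j)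
    {i j : ℤ} (hij : k - 1 < ε * (j - i)) : U'.entry i j = 0 := by
  have h1 : U.diagonalPart (ε * k) (i - ε) j = 0 := by
    rw [Theta.diagonalPart, if_neg]
    rcases hε with rfl | rfl <;> lia
  rw [h, h1, add_zero]
  by_cases h2 : k < ε * (j - i)
  · rw [hU i j h2, Nat.zero_sub]
  · rw [Theta.diagonalPart, if_pos, Nat.sub_self]
    rcases hε with rfl | rfl <;> lia

/-- Induction on the lower bandwidth, bounded by `K + 1` and not `K`, since the loop stops when one
subdiagonal remains and keeps that matrix as its last factor. -/
theorem exists_lowerLoop (hn : 0 < n) (hd : 0 < d) (K : ℕ) (L : Theta n d)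
    (hL : L.IsLowerTriangular) (hK : ∀ i j, (K : ℤ) + 1 < i - j → L.entry i j = 0) :
    ∃ Bs, LowerLoop L Bs ∧ (∀ B ∈ Bs, B.IsLowerBidiagonal) ∧ Factors L Bs := by
  induction K generalizing L with
  | zero =>
    have hb : L.IsLowerBidiagonal := by
      intro i j h1 h2
      rcases lt_or_ge i j with h3 | h3
      · exact hL i j h3
      · exact hK i j (by push_cast; lia)
    refine ⟨[L], LowerLoop.done L hb, by simpa using hb, ?_, List.isChain_singleton _, 0,
      Submodule.zero_mem _, by simp⟩
    intro B hB
    rw [List.head?_cons, Option.mem_some_iff] at hB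
    rw [hB]
  | succ K ih =>
    -- `K + 2` is only a bound for the width: if that diagonal is empty the algorithm makes no step,
    -- and only the bound is lowered.
    by_cases hz : ∀ i, L.entry i (i - ((K : ℤ) + 2)) = 0
    · refine ih L hL fun i j hij => ?_
      by_cases h1 : j = i - ((K : ℤ) + 2)
      · rw [h1, hz]
      · exact hK i j (by push_cast; lia)
    · push Not at hz
      have hbound : ∀ i j, (K : ℤ) + 2 < -1 * (j - i) → L.entry i j = 0 := fun i j hij =>
        hK i j (by push_cast; lia)
      obtain ⟨B, L', h1, h2, h3, h4, h5, h6⟩ :=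
        exists_shift hn hd (Or.inr rfl) (show (0 : ℤ) < (K : ℤ) + 2 by lia) L hbound
      -- The shifted diagonal lands at distance `K + 1 ≥ 1` below the main one, so nothing appears
      -- above it.
      have hL' : L'.IsLowerTriangular := by
        intro i j hij
        rw [h2, hL i j hij, Nat.zero_sub, zero_add, Theta.diagonalPart, if_neg (by lia)]
      obtain ⟨Bs, h7, h8, h9⟩ := ih L' hL' fun i j hij =>
        entry_shift_eq_zero (Or.inr rfl) hbound h2 (by lia)
      have hnb : ¬ L.IsLowerBidiagonal := by
        intro hb
        obtain ⟨i, hi⟩ := hz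
        exact hi (hb i _ (by lia) (by lia))
      refine ⟨B :: Bs, LowerLoop.step L B L' Bs hnb ?_ h7, ?_, h9.cons h3 h4 h5 h6⟩
      · refine ⟨(K : ℤ) + 2, by lia, hz, fun i j hij => hbound i j (by lia), fun i j hij => ?_,
          fun i j => ?_⟩
        · have := h1 i j hij
          simpa only [neg_one_mul, ← sub_eq_add_neg] using this
        · have := h2 i j
          simpa only [neg_one_mul, sub_neg_eq_add] using this
      · intro C hC
        rcases List.mem_cons.1 hC with rfl | hC
        · intro i j hij hij'
          rw [h1 i j hij, if_neg (by lia)]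
        · exact h8 C hC

theorem exists_upperLoop (hn : 0 < n) (hd : 0 < d) (K : ℕ) (U : Theta n d)
    (hK : ∀ i j, (K : ℤ) < j - i → U.entry i j = 0) :
    ∃ Bs Cs L, UpperLoop U Bs L ∧ LowerLoop L Cs ∧ (∀ B ∈ Bs, B.IsUpperBidiagonal) ∧
      (∀ B ∈ Cs, B.IsLowerBidiagonal) ∧ Factors U (Bs ++ Cs) := by
  induction K generalizing U with
  | zero =>
    have hL : U.IsLowerTriangular := fun i j hij => hK i j (by push_cast; lia)
    obtain ⟨K, hK'⟩ := U.exists_bandwidth hn hd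
    obtain ⟨Cs, h1, h2, h3⟩ := exists_lowerLoop hn hd K U hL fun i j hij => by
      by_contra hne
      have := (abs_le.1 (hK' i j hne)).1
      lia
    exact ⟨[], Cs, U, UpperLoop.done U hL, h1, by simp, h2, h3⟩
  | succ K ih =>
    by_cases hz : ∀ i, U.entry i (i + ((K : ℤ) + 1)) = 0
    · refine ih U fun i j hij => ?_
      by_cases h1 : j = i + ((K : ℤ) + 1)
      · rw [h1, hz]
      · exact hK i j (by push_cast; lia)
    · push Not at hz
      have hbound : ∀ i j, (K : ℤ) + 1 < 1 * (j - i) → U.entry i j = 0 := fun i j hij =>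
        hK i j (by push_cast; lia)
      obtain ⟨B, U', h1, h2, h3, h4, h5, h6⟩ :=
        exists_shift hn hd (Or.inl rfl) (show (0 : ℤ) < (K : ℤ) + 1 by lia) U hbound
      obtain ⟨Bs, Cs, L, h7, h8, h9, h10, h11⟩ := ih U' fun i j hij =>
        entry_shift_eq_zero (Or.inl rfl) hbound h2 (by lia)
      have hnt : ¬ U.IsLowerTriangular := by
        intro hb
        obtain ⟨i, hi⟩ := hz
        exact hi (hb i _ (by lia))
      refine ⟨B :: Bs, Cs, L, UpperLoop.step U B U' L Bs hnt ?_ h7, h8, ?_, h10,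
        h11.cons h3 h4 h5 h6⟩
      · refine ⟨(K : ℤ) + 1, by lia, hz, fun i j hij => hbound i j (by lia), fun i j hij => ?_,
          fun i j => ?_⟩
        · simpa only [one_mul] using h1 i j hij
        · simpa only [one_mul] using h2 i j
      · intro C hC
        rcases List.mem_cons.1 hC with rfl | hC
        · intro i j hij hij'
          rw [h1 i j hij, if_neg hij']
        · exact h9 C hC

end Algorithm

end

end AffineSchur

/-! ### The triangular product formula -/

theorem theorem3p4 (n d : ℕ) (hn : 0 < n) (hd : 0 < d) (A : AffineSchur.Theta n d) :
    ∃ Bup Blow : List (AffineSchur.Theta n d),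
      AffineSchur.AlgorithmOutput A Bup Blow ∧
      (∀ Bup' Blow' : List (AffineSchur.Theta n d),
        AffineSchur.AlgorithmOutput A Bup' Blow' → Bup' = Bup ∧ Blow' = Blow) ∧
      (∀ B ∈ Bup, B.IsUpperBidiagonal) ∧
      (∀ B ∈ Blow, B.IsLowerBidiagonal) ∧
      ∃ c : AffineSchur.Theta n d →₀ AffineSchur.Zv,
        (∀ A' ∈ c.support, A'.LtA A) ∧
        (Bup.map AffineSchur.std).prod * (Blow.map AffineSchur.std).prod =
          AffineSchur.std A + c.sum fun A' r => r • AffineSchur.std A' := by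
  obtain ⟨K, hK⟩ := A.exists_bandwidth hn hd
  obtain ⟨Bs, Cs, L, h1, h2, h3, h4, h5, h6, x, hx, h7⟩ :=
    AffineSchur.exists_upperLoop hn hd K A fun i j hij => by
      by_contra hne
      have := (abs_le.1 (hK i j hne)).2
      lia
  refine ⟨Bs, Cs, ⟨⟨L, h1, h2⟩, h5, h6⟩, ?_, h3, h4, ?_⟩
  · rintro Bs' Cs' ⟨⟨L', h1', h2'⟩, h5', h6'⟩
    exact h1'.unique h1 h2' h2 h6' h6 fun B hB B' hB' => (h5' B hB).trans (h5 B' hB').symm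
  -- Membership in the span of the lower basis elements is unpacked into finitely many coefficients.
  · obtain ⟨c, hc, rfl⟩ := (Finsupp.mem_span_image_iff_linearCombination AffineSchur.Zv).1 hx
    refine ⟨c, fun A' hA' => (Finsupp.mem_supported _ _).1 hc hA', ?_⟩
    rw [← List.prod_append, ← List.map_append, h7, Finsupp.linearCombination_apply]
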